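/- **Model.** $R$ is an arbitrary commutative ring. A division-free straight-line program may introduce integer constants, add, subtract and multiply; each instruction counts as one operation in $R$. A *multiplication routine* is a family $(\mathcal M_d)_{d\ge 0}$ of such programs, $\mathcal M_d$ multiplying two polynomials of degree at most $d$ correctly over every commutative ring; it is *quasi-linear* if $\mathcal M_d$ has at most $\alpha\, d(\log d)^{\beta}$ instructions for all $d\ge 2$, for some constants $\alpha,\beta>0$. Power series modulo $z^{d+1}$ are multiplied by calling $\mathcal M_d$ and truncating, and a series with constant term $\pm1$ is inverted by Newton iteration. **Algorithm.** Let $n\ge 1$, $A\in R^{n\times n}$, $s=\lceil\sqrt n\,\rceil$, $r=\lceil 2n/s\rceil$. Let $C\in\mathbb Z^{n\times n}$ be Kaltofen's matrix, with ones directly above the diagonal, last row $(c_0,\dots,c_{n-1})$, $c_j=(-1)^{\lfloor (n-j-1)/2\rfloor}\binom{\lfloor (n+j)/2\rfloor}{j}$, and zeros elsewhere; let $\varphi=(1,0,\dots,0)\in\mathbb Z^{1\times n}$, $\psi=\big(\binom{i}{\lfloor i/2\rfloor}\big)_{0\le i<n}\in\mathbb Z^{n\times 1}$ and $Z(z)=C+z(A-C)$.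 The algorithm uses the cubic matrix product and power series modulo $z^{n+1}$, except where a precision is given. Determinant part (its results are stored): (i) $v_i=Z^i\psi$ for $0\le i<r$, and (ii) $B=Z^r$ by repeated squaring, both with polynomials of degree at most $r$; (iii) $u_j=\varphi B^j$ for $0\le j<s$; (iv) $h_{i+jr}=u_jv_i$; (v) by the extended Euclidean scheme on $x^{2n}$ and $h_0x^{2n-1}+\dots+h_{2n-1}$, the minimum polynomial $f=x^n+f_{n-1}x^{n-1}+\dots+f_0$ of $h_0,\dots,h_{2n-1}$, the last column $(g_0,\dots,g_{n-1})^T$ of the inverse of $H=(h_{i+j})_{0\le i,j<n}$, and $\det Z=(-1)^nf_0$. Adjoint part, where $\sigma_k(N)$ is the sum of the entries of $N$ whose indices, counted from $0$, add up to $k$, and $H_A=(h_{i+j+1})_{0\le i,j<n}$: * (i\*) $\partial h_k=(\sigma_{k-1}(H_A^{-1})-\sigma_k(H^{-1}))\det Z$ for $0\le k\le 2n-1$. Here $\sigma_k(H^{-1})$ is the coefficient of $x^k$ in $f'g-g'f$ for $k<n$, and $\sigma_{2n-2-k}(H^{-1})$ is the coefficient of $x^k$ in $\mathrm{rev}(g)'\,\mathrm{rev}(f)-\mathrm{rev}(f)'\,\mathrm{rev}(g)$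 for $k<n$, with $\mathrm{rev}(p)=x^np(1/x)$ and $g=\sum_i g_ix^i$. For $H_A^{-1}$ one replaces $g$ by $g^*=\sum_{i<n}\big(g_{i+1}-\tfrac{g_0}{f_0}f_{i+1}\big)x^i$, where $g_n=0$, $f_n=1$. * (ii\*) With $\partial H=(\partial h_{i+jr})_{0\le i<r,\,0\le j<s}$ (zero where $i+jr\ge 2n$): $[\partial u_0,\dots,\partial u_{s-1}]=[v_0,\dots,v_{r-1}]\,\partial H$, and the rows $\partial v_0,\dots,\partial v_{r-1}$ are those of $\partial H$ times the matrix with rows $u_0,\dots,u_{s-1}$. * (iii\*) $\partial B:=0$; for $j=s-1,\dots,1$: $\partial u_{j-1}:=\partial u_{j-1}+B\,\partial u_j$ and $\partial B:=\partial B+\partial u_j\,u_{j-1}$. * (iv\*), modified: write $\partial B=\sum_k b_kz^k$, $\partial B_H=\sum_{k=0}^{r-2}b_{n-r+2+k}z^k$, $\partial B_L=\sum_{k=0}^{n-r+1}b_k$, and compute in $R^{n\times n}$ $$E=\Big(\sum_{k=1}^rZ^{r-k}\,\partial B_H\,Z^{k-1}\bmod z^{r-1}\Big)(1)+\Big(\sum_{k=1}^rZ^{r-k}\,\partial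 B_L\,Z^{k-1}\Big)(1),$$ each sum by differentiating the repeated squaring of (ii) in reverse order, with series modulo $z^{r-1}$ and modulo $z^{r}$ respectively. * (v\*) $X:=0$; for $i=r-1,\dots,1$: $\partial v_{i-1}:=\partial v_{i-1}+\partial v_i\,Z$ and $X:=X+v_{i-1}\,\partial v_i$. The output is $E+X(1)$. **Theorem.** Quasi-linear multiplication routines exist. With any multiplication routine, for every $n\ge1$, every commutative ring $R$ and every $A\in R^{n\times n}$, the algorithm outputs the adjoint matrix $A^*$ (the adjugate of $A$), without divisions. If the routine is quasi-linear, the algorithm uses $\tilde O(n^3\sqrt n)$ operations in $R$: there are constants $\alpha,\beta>0$, depending only on the routine, such that for all $n\ge2$, all $R$ and all $A$ it executes at most $\alpha\, n^3\sqrt n\,(\log n)^{\beta}$ operations. -/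

import Mathlib

universe u

namespace DivFree

/-! ### Division-free straight-line programs and their cost -/

/-- A division-free straight-line computation. `V` is the type of the memory cells; each of the
four instructions (introducing an integer constant, addition, subtraction, multiplication) hands
a new cell to the rest of the computation. Programs below are written for an arbitrary `V`, about
which nothing is known, so they cannot look at the values, and they touch ring elements through
these instructions only. -/
inductive Prog (V : Type u) (α : Type u) : Type u
  | ret (a : α) : Prog V α
  | const (c : ℤ) (k : V → Prog V α) : Prog V α
  | add (x y : V) (k : V → Prog V α) : Prog V α
  | sub (x y : V) (k : V → Prog V α) : Prog V α
  | mul (x y : V) (k : V → Prog V α) : Prog V α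

namespace Prog

variable {V α β : Type u}

/-- Sequential composition. -/
def bind : Prog V α → (α → Prog V β) → Prog V β
  | ret a, f => f a
  | const c k, f => const c fun v => bind (k v) f
  | add x y k, f => add x y fun v => bind (k v) f
  | sub x y k, f => sub x y fun v => bind (k v) f
  | mul x y k, f => mul x y fun v => bind (k v) f

instance : Monad (Prog V) where
  pure := ret
  bind := bind

variable {R : Type u} [CommRing R]

/-- The result of a program when its cells hold elements of the ring `R`. -/
def run : Prog R α → α
  | ret a => a
  | const c k => run (k (c : R))
  | add x y k => run (k (x + y))
  | sub x y k => run (k (x - y))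
  | mul x y k => run (k (x * y))

/-- The number of instructions (operations in `R`) that a program executes. -/
def cost : Prog R α → ℕ
  | ret _ => 0
  | const c k => cost (k (c : R)) + 1
  | add x y k => cost (k (x + y)) + 1
  | sub x y k => cost (k (x - y)) + 1
  | mul x y k => cost (k (x * y)) + 1

end Prog

/-- First-order straight-line programs with `m` readable cells and `q` outputs: every instruction
appends one cell, and may refer only to earlier ones. -/
inductive SLP (q : ℕ) : ℕ → Type
  | out {m : ℕ} (o : Fin q → Fin m) : SLP q m
  | const {m : ℕ} (c : ℤ) (p : SLP q (m + 1)) : SLP q m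
  | add {m : ℕ} (j k : Fin m) (p : SLP q (m + 1)) : SLP q m
  | sub {m : ℕ} (j k : Fin m) (p : SLP q (m + 1)) : SLP q m
  | mul {m : ℕ} (j k : Fin m) (p : SLP q (m + 1)) : SLP q m

namespace SLP

/-- The number of instructions. -/
def size {q : ℕ} : {m : ℕ} → SLP q m → ℕ
  | _, out _ => 0
  | _, const _ p => p.size + 1
  | _, add _ _ p => p.size + 1
  | _, sub _ _ p => p.size + 1
  | _, mul _ _ p => p.size + 1

/-- Executing a straight-line program on the input cells `x`. -/
def call {V : Type u} {q : ℕ} : {m : ℕ} → SLP q m → (Fin m → V) → Prog V (Fin q → V)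
  | _, out o, x => .ret fun i => x (o i)
  | m, const c p, x => .const c fun v => p.call (Fin.snoc x v : Fin (m + 1) → V)
  | m, add j k p, x => .add (x j) (x k) fun v => p.call (Fin.snoc x v : Fin (m + 1) → V)
  | m, sub j k p, x => .sub (x j) (x k) fun v => p.call (Fin.snoc x v : Fin (m + 1) → V)
  | m, mul j k p, x => .mul (x j) (x k) fun v => p.call (Fin.snoc x v : Fin (m + 1) → V)

end SLP

/-- A multiplication routine for polynomials: for every degree `d`, a straight-line program that
takes the `d + 1` coefficients of each of two polynomials (constant coefficients first) and returns
`2 * d + 1` coefficients. -/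
abbrev MulRoutine : Type := (d : ℕ) → SLP (2 * d + 1) ((d + 1) + (d + 1))

/-- The routine multiplies polynomials of degree at most `d` correctly over every commutative
ring. -/
def MulRoutine.Correct (M : MulRoutine) : Prop :=
  ∀ (R : Type u) [CommRing R] (d : ℕ) (a b : Fin (d + 1) → R) (k : Fin (2 * d + 1)),
    ((M d).call (Fin.append a b)).run k =
      ((∑ i : Fin (d + 1), Polynomial.monomial (i : ℕ) (a i)) *
        (∑ i : Fin (d + 1), Polynomial.monomial (i : ℕ) (b i))).coeff k

/-- The routine uses a number of operations that is linear in the degree up to logarithmic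
factors. -/
def MulRoutine.QuasiLinear (M : MulRoutine) : Prop :=
  ∃ α β : ℝ, 0 < α ∧ 0 < β ∧ ∀ d : ℕ, 2 ≤ d → ((M d).size : ℝ) ≤ α * d * Real.log d ^ β

/-! ### Arrays and loops -/

section Loops

variable {V α : Type u}

/-- Computing the entries of an array one after the other. -/
def tab : {m : ℕ} → (Fin m → Prog V α) → Prog V (Fin m → α)
  | 0, _ => pure Fin.elim0
  | m + 1, f => do
      let a ← f 0
      let t ← tab fun i : Fin m => f i.succ
      pure (Fin.cons a t : Fin (m + 1) → α)

/-- Reading an array, with the value `z` outside its bounds. -/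
def get (z : α) {m : ℕ} (f : Fin m → α) (k : ℕ) : α :=
  if h : k < m then f ⟨k, h⟩ else z

/-- The values `a`, `f a`, `f (f a)`, … up to the `m`-fold iterate, each computed from the
preceding one and stored at the index that counts the iterations. -/
def iterates (f : α → Prog V α) (a : α) : ℕ → Prog V (ℕ → α)
  | 0 => pure fun _ => a
  | m + 1 => do
      let t ← iterates f a m
      let x ← f (t m)
      pure (Function.update t (m + 1) x)

end Loops

/-! ### Linear algebra over an arithmetic given by programs -/

/-- Programs for the arithmetic of a ring whose elements are represented by elements of `S`. -/
structure Arith (V S : Type u) where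
  zero : Prog V S
  one : Prog V S
  add : S → S → Prog V S
  sub : S → S → Prog V S
  mul : S → S → Prog V S

namespace Arith

variable {V S : Type u} (K : Arith V S)

/-- Sum of the entries of an array. -/
def sum : {m : ℕ} → (Fin m → S) → Prog V S
  | 0, _ => K.zero
  | m + 1, f => do
      let t ← sum fun i : Fin m => f i.castSucc
      K.add t (f (Fin.last m))

def dot {m : ℕ} (x y : Fin m → S) : Prog V S := do
  let p ← tab fun i => K.mul (x i) (y i)
  K.sum p

def vecAdd {m : ℕ} (x y : Fin m → S) : Prog V (Fin m → S) :=
  tab fun i => K.add (x i) (y i)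

/-- Row vector times matrix. -/
def vecMul {a b : ℕ} (x : Fin a → S) (M : Fin a → Fin b → S) : Prog V (Fin b → S) :=
  tab fun j => K.dot x fun i => M i j

/-- Matrix times column vector. -/
def mulVec {a b : ℕ} (M : Fin a → Fin b → S) (x : Fin b → S) : Prog V (Fin a → S) :=
  tab fun i => K.dot (M i) x

/-- Column vector times row vector. -/
def outer {a b : ℕ} (x : Fin a → S) (y : Fin b → S) : Prog V (Fin a → Fin b → S) :=
  tab fun i => tab fun j => K.mul (x i) (y j)

def matAdd {a b : ℕ} (M N : Fin a → Fin b → S) : Prog V (Fin a → Fin b → S) :=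
  tab fun i => K.vecAdd (M i) (N i)

/-- The cubic matrix product. -/
def matMul {a b c : ℕ} (M : Fin a → Fin b → S) (N : Fin b → Fin c → S) :
    Prog V (Fin a → Fin c → S) :=
  tab fun i => K.vecMul (M i) N

def matZero (a b : ℕ) : Prog V (Fin a → Fin b → S) :=
  tab fun _ => tab fun _ => K.zero

def matOne (a : ℕ) : Prog V (Fin a → Fin a → S) :=
  tab fun i => tab fun j => if i = j then K.one else K.zero

variable {n : ℕ}

/-- Repeated squaring. The result is a table, which holds the power `M ^ q` at each of the indices
`q = r, r / 2, r / 4, …, 1, 0` (integer quotients). -/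
def matPowers (M : Fin n → Fin n → S) (r : ℕ) : Prog V (ℕ → Fin n → Fin n → S) :=
  if h : r = 0 then do
    let I ← K.matOne n
    pure fun _ => I
  else do
    let T ← matPowers M (r / 2)
    let Q ← K.matMul (T (r / 2)) (T (r / 2))
    if r % 2 = 0 then
      pure (Function.update T r Q)
    else do
      let P ← K.matMul Q M
      pure (Function.update T r P)
termination_by r
decreasing_by omega

/-- The differentiation of repeated squaring, in the reverse order: given the table `T` of the
powers `M ^ q` above and the derivative `X` with respect to `M ^ r`, it computes
`∑ k ∈ {1, …, r}, M ^ (r - k) * X * M ^ (k - 1)`. An instruction `P := Q * M` contributes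
`X * Q`, and passes `M * X` on to `Q`; an instruction `Q := N * N` passes `N * X + X * N` on
to `N`. -/
def matPowersDiff (M : Fin n → Fin n → S) (T : ℕ → Fin n → Fin n → S) (r : ℕ)
    (X : Fin n → Fin n → S) : Prog V (Fin n → Fin n → S) :=
  if h : r = 0 then K.matZero n n
  else
    if r % 2 = 0 then do
      let Y₁ ← K.matMul (T (r / 2)) X
      let Y₂ ← K.matMul X (T (r / 2))
      let Y ← K.matAdd Y₁ Y₂
      matPowersDiff M T (r / 2) Y
    else do
      let Q ← K.matMul (T (r / 2)) (T (r / 2))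
      let W ← K.matMul X Q
      let X' ← K.matMul M X
      let Y₁ ← K.matMul (T (r / 2)) X'
      let Y₂ ← K.matMul X' (T (r / 2))
      let Y ← K.matAdd Y₁ Y₂
      let D ← matPowersDiff M T (r / 2) Y
      K.matAdd W D
termination_by r
decreasing_by all_goals omega

end Arith

/-! ### Truncated power series -/

/-- Power series modulo `z ^ (d + 1)`, as arrays of coefficients, constant coefficient first. -/
abbrev Ser (V : Type u) (d : ℕ) : Type u := Fin (d + 1) → V

section Series

variable {V : Type u}

/-- An integer constant, as a cell. -/
def lit (c : ℤ) : Prog V V := .const c .ret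

/-- The constant power series with constant coefficient `c`. -/
def serC (d : ℕ) (c : V) : Prog V (Ser V d) := do
  let z ← lit 0
  pure (Fin.cons c fun _ => z)

/-- The constant power series given by an integer. -/
def serLit (d : ℕ) (c : ℤ) : Prog V (Ser V d) := do
  let x ← lit c
  serC d x

/-- Power series arithmetic modulo `z ^ (d + 1)`. The product is the truncation of the product of
two polynomials of degree at most `d`. -/
def ser (M : MulRoutine) (d : ℕ) : Arith V (Ser V d) where
  zero := serLit d 0
  one := serLit d 1
  add a b := tab fun i => .add (a i) (b i) .ret
  sub a b := tab fun i => .sub (a i) (b i) .ret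
  mul a b := do
    let p ← (M d).call (Fin.append a b)
    pure fun i => p ⟨i, by omega⟩

/-- Multiplication of a power series by an integer. -/
def serScale {d : ℕ} (c : ℤ) (a : Ser V d) : Prog V (Ser V d) := do
  let x ← lit c
  tab fun i => .mul x (a i) .ret

/-- The inverse of a power series whose constant coefficient is `1` or `-1`, thus its own inverse,
by Newton iteration `b := b * (2 - a * b)`. -/
def serInv (M : MulRoutine) {d : ℕ} (a : Ser V d) : Prog V (Ser V d) := do
  let two ← serLit d 2
  let b₀ ← serC d (a 0)
  let t ← iterates (fun b => do
    let p ← (ser M d).mul a b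
    let e ← (ser M d).sub two p
    (ser M d).mul b e) b₀ (Nat.clog 2 (d + 1))
  pure (t (Nat.clog 2 (d + 1)))

/-- Truncation of a power series, or extension by zero coefficients. -/
def serResize {d : ℕ} (e : ℕ) (a : Ser V d) : Prog V (Ser V e) := do
  let z ← lit 0
  pure fun i => get z a i

def matResize {d a b : ℕ} (e : ℕ) (X : Fin a → Fin b → Ser V d) :
    Prog V (Fin a → Fin b → Ser V e) :=
  tab fun i => tab fun j => serResize e (X i j)

/-- Sum of an array of cells. -/
def cellSum : {m : ℕ} → (Fin m → V) → Prog V V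
  | 0, _ => lit 0
  | m + 1, f => do
      let t ← cellSum fun i : Fin m => f i.castSucc
      .add t (f (Fin.last m)) .ret

/-- Evaluation at `z = 1`. -/
def matEvalOne {d a b : ℕ} (X : Fin a → Fin b → Ser V d) : Prog V (Fin a → Fin b → V) :=
  tab fun i => tab fun j => cellSum (X i j)

end Series

/-! ### Kaltofen's matrix and projections -/

/-- The coefficients `c₀, …, c_{n-1}` in the last row of the matrix `C`. -/
def kaltofenCoeff (n j : ℕ) : ℤ :=
  (-1) ^ ((n - j - 1) / 2) * (((n + j) / 2).choose j : ℤ)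

/-- The companion matrix `C` with ones above the diagonal and with last row `c₀, …, c_{n-1}`. -/
def kaltofenC (n : ℕ) (i j : Fin n) : ℤ :=
  if (i : ℕ) + 1 < n then (if (j : ℕ) = i + 1 then 1 else 0) else kaltofenCoeff n j

/-- The row vector `φ = (1, 0, …, 0)`. -/
def kaltofenPhi (n : ℕ) (i : Fin n) : ℤ := if (i : ℕ) = 0 then 1 else 0

/-- The column vector `ψ` with the entries `i.choose (i / 2)`. -/
def kaltofenPsi (n : ℕ) (i : Fin n) : ℤ := ((i : ℕ).choose (i / 2) : ℤ)

/-! ### The determinant algorithm and its intermediary data -/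

/-- The number of giant steps `s = ⌈√n⌉`. -/
def giant (n : ℕ) : ℕ := if Nat.sqrt n ^ 2 = n then Nat.sqrt n else Nat.sqrt n + 1

/-- The number of baby steps `r = ⌈2 n / s⌉`. -/
def baby (n : ℕ) : ℕ := (2 * n) ⌈/⌉ (giant n)

/-- A state of the extended Euclidean scheme: two consecutive remainders and their cofactors. All
of them are polynomials, given by their coefficients. -/
structure EuclidState (S : Type u) where
  rPrev : ℕ → S
  rCur : ℕ → S
  tPrev : ℕ → S
  tCur : ℕ → S

section Algorithm

variable {V : Type u} (M : MulRoutine) {d : ℕ}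

/-- The first `L` coefficients of `p - (q₁ x + q₀) c`. -/
def polyReduce (L : ℕ) (q₁ q₀ : Ser V d) (p c : ℕ → Ser V d) : Prog V (ℕ → Ser V d) := do
  let z ← (ser M d).zero
  let w ← tab fun i : Fin L => do
    let x ← (ser M d).mul q₁ (if (i : ℕ) = 0 then z else c (i - 1))
    let y ← (ser M d).mul q₀ (c i)
    let v ← (ser M d).sub (p i) x
    (ser M d).sub v y
  pure (get z w)

/-- One division step in a normal sequence: the remainders have the degrees `e + 1` and `e`, and the
quotient is `q₁ x + q₀`. -/
def euclidStep (n e : ℕ) (st : EuclidState (Ser V d)) : Prog V (EuclidState (Ser V d)) := do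
  let inv ← serInv M (st.rCur e)
  let q₁ ← (ser M d).mul (st.rPrev (e + 1)) inv
  let w ← (ser M d).mul q₁ (st.rCur (e - 1))
  let y ← (ser M d).sub (st.rPrev e) w
  let q₀ ← (ser M d).mul y inv
  let r ← polyReduce M (2 * n + 1) q₁ q₀ st.rPrev st.rCur
  let t ← polyReduce M (n + 1) q₁ q₀ st.tPrev st.tCur
  pure ⟨st.rCur, r, st.tCur, t⟩

/-- The state after `i` division steps on `x ^ (2 n)` and `h₀ x ^ (2 n - 1) + … + h_{2 n - 1}`. -/
def euclid (n : ℕ) (h : ℕ → Ser V d) : ℕ → Prog V (EuclidState (Ser V d))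
  | 0 => do
      let z ← (ser M d).zero
      let o ← (ser M d).one
      pure { rPrev := fun k => if k = 2 * n then o else z
             rCur := fun k => if k < 2 * n then h (2 * n - 1 - k) else z
             tPrev := fun _ => z
             tCur := fun k => if k = 0 then o else z }
  | i + 1 => do
      let st ← euclid n h i
      euclidStep M n (2 * n - 1 - i) st

/-- The minimum polynomial `f` (monic, of degree `n`) of the sequence `h`, and the polynomial `g`
of the entries of the last column of the inverse of the Hankel matrix `(h_{i+j})`: after `n` steps
of the extended Euclidean scheme, `f` is the last cofactor divided by its leading coefficient, and
`g` is the preceding cofactor divided by the leading coefficient of the preceding remainder. -/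
def minPolyAndColumn (n : ℕ) (h : ℕ → Ser V d) :
    Prog V ((ℕ → Ser V d) × (ℕ → Ser V d)) := do
  let z ← (ser M d).zero
  let st ← euclid M n h n
  let a ← serInv M (st.tCur n)
  let b ← serInv M (st.rPrev n)
  let f ← tab fun i : Fin (n + 1) => (ser M d).mul (st.tCur i) a
  let g ← tab fun i : Fin n => (ser M d).mul (st.tPrev i) b
  pure (get z f, get z g)

/-- The coefficients of `p' q - v' w` modulo `x ^ n`, for polynomials in `x`. -/
def wronskian (n : ℕ) (p q v w : ℕ → Ser V d) : Prog V (Fin n → Ser V d) := do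
  let p' ← tab fun i : Fin n => serScale ((i : ℤ) + 1) (p (i + 1))
  let v' ← tab fun i : Fin n => serScale ((i : ℤ) + 1) (v (i + 1))
  tab fun k : Fin n => do
    let x ← (ser M d).dot (fun i : Fin (k + 1) => p' ⟨i, by omega⟩) (fun i => q (k - i))
    let y ← (ser M d).dot (fun i : Fin (k + 1) => v' ⟨i, by omega⟩) (fun i => w (k - i))
    (ser M d).sub x y

/-- The anti-diagonal sums `σ_k`, `0 ≤ k ≤ 2 n - 2`, of the inverse of an invertible `n × n` Hankel
matrix, from the polynomials `f` (monic, of degree `n`) and `g` (of degree less than `n`) that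
describe the inverse; zero for larger `k`. For small `k` they are the coefficients of
`f' g - g' f`, and for large `k` those of `rev(g)' rev(f) - rev(f)' rev(g)`. -/
def antiDiagonalSums (n : ℕ) (f g : ℕ → Ser V d) : Prog V (ℕ → Ser V d) := do
  let z ← (ser M d).zero
  let low ← wronskian M n f g g f
  let revf : ℕ → Ser V d := fun i => if i ≤ n then f (n - i) else z
  let revg : ℕ → Ser V d := fun i => if i ≤ n then g (n - i) else z
  let high ← wronskian M n revg revf revf revg
  pure fun k => if k < n then get z low k
    else if k ≤ 2 * n - 2 then get z high (2 * n - 2 - k) else z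

/-- The polynomial of the entries of the last column of the inverse of the shifted Hankel matrix
`(h_{i+j+1})`: the coefficients `g_{i+1} - (g₀ / f₀) f_{i+1}`. -/
def shiftedColumn (n : ℕ) (f g : ℕ → Ser V d) : Prog V (ℕ → Ser V d) := do
  let z ← (ser M d).zero
  let a ← serInv M (f 0)
  let q ← (ser M d).mul (g 0) a
  let w ← tab fun i : Fin n => do
    let x ← (ser M d).mul q (f (i + 1))
    (ser M d).sub (g (i + 1)) x
  pure (get z w)

/-- The matrix `Z(z) = C + z (A - C)` modulo `z ^ (d + 1)`. -/
def pencil (d : ℕ) {n : ℕ} (A : Fin n → Fin n → V) : Prog V (Fin n → Fin n → Ser V d) :=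
  tab fun i => tab fun j => do
    let z ← lit 0
    let c ← lit (kaltofenC n i j)
    let e ← Prog.sub (A i j) c .ret
    pure fun k => if (k : ℕ) = 0 then c else if (k : ℕ) = 1 then e else z

/-- The data that the determinant algorithm leaves for the adjoint algorithm. The powers of `Z`
are polynomials of degree at most `r`; everything else is known modulo `z ^ (n + 1)`. -/
structure DetData (V : Type u) (n : ℕ) where
  /-- `Z`, as a polynomial matrix -/
  Z : Fin n → Fin n → Ser V (baby n)
  /-- the table of the powers `Z ^ r`, `Z ^ (r / 2)`, … -/
  powers : ℕ → Fin n → Fin n → Ser V (baby n)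
  /-- `B = Z ^ r` -/
  B : Fin n → Fin n → Ser V n
  /-- `v i = Z ^ i ψ` -/
  v : ℕ → Fin n → Ser V n
  /-- `u j = φ B ^ j` -/
  u : ℕ → Fin n → Ser V n
  /-- the minimum polynomial -/
  f : ℕ → Ser V n
  /-- the last column of the inverse of the Hankel matrix -/
  g : ℕ → Ser V n
  /-- `det Z = (-1) ^ n f(0)` -/
  det : Ser V n

/-- The determinant algorithm with baby steps and giant steps, on `Z`, `φ` and `ψ`. The first two
steps only involve polynomials of degree at most `r`, and are carried out in this precision. -/
def detAlg {n : ℕ} (A : Fin n → Fin n → V) : Prog V (DetData V n) := do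
  let r := baby n
  let s := giant n
  let Z ← pencil r A
  -- step i
  let ψ ← tab fun i : Fin n => serLit r (kaltofenPsi n i)
  let vSmall ← iterates (fun x => (ser M r).mulVec Z x) ψ (r - 1)
  -- step ii
  let powers ← (ser M r).matPowers Z r
  let B ← matResize n (powers r)
  let v₀ ← matResize n fun (i : Fin r) => vSmall i
  let zv ← tab fun _ : Fin n => (ser M n).zero
  let v := get zv v₀
  -- step iii
  let φ ← tab fun i : Fin n => serLit n (kaltofenPhi n i)
  let u ← iterates (fun x => (ser M n).vecMul x B) φ (s - 1)
  -- step iv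
  let h₀ ← tab fun i : Fin r => tab fun j : Fin s => (ser M n).dot (u j) (v i)
  let z ← (ser M n).zero
  let h : ℕ → Ser V n := fun k => get z (get (fun _ => z) h₀ (k % r)) (k / r)
  -- step v
  let (f, g) ← minPolyAndColumn M n h
  let det ← if n % 2 = 0 then pure (f 0) else (ser M n).sub z (f 0)
  pure { Z := Z, powers := powers, B := B, v := v, u := u, f := f, g := g, det := det }

/-! ### The adjoint algorithm -/

/-- Step i*: the derivatives `∂h_k`, `0 ≤ k ≤ 2 n - 1`. -/
def stepI {n : ℕ} (D : DetData V n) : Prog V (Fin (2 * n) → Ser V n) := do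
  let z ← (ser M n).zero
  let gA ← shiftedColumn M n D.f D.g
  let σ ← antiDiagonalSums M n D.f D.g
  let σA ← antiDiagonalSums M n D.f gA
  tab fun k : Fin (2 * n) => do
    let x ← (ser M n).sub (if (k : ℕ) = 0 then z else σA (k - 1)) (σ k)
    (ser M n).mul x D.det

/-- Step iii*, for the indices `j, j - 1, …, 1`: it updates the column vectors `∂u` and the
matrix `∂B`. -/
def stepIII {n : ℕ} (B : Fin n → Fin n → Ser V n) (u : ℕ → Fin n → Ser V n) :
    ℕ → (ℕ → Fin n → Ser V n) → (Fin n → Fin n → Ser V n) → Prog V (Fin n → Fin n → Ser V n)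
  | 0, _, dB => pure dB
  | j + 1, du, dB => do
      let w ← (ser M n).mulVec B (du (j + 1))
      let x ← (ser M n).vecAdd (du j) w
      let o ← (ser M n).outer (du (j + 1)) (u j)
      let dB' ← (ser M n).matAdd dB o
      stepIII B u j (Function.update du j x) dB'

/-- Step iv*, modified by the lazy evaluation at `z = 1`. The coefficients of `∂B` of degree at
least `n - r + 2` form `∂B_H`, and the other ones are evaluated at `z = 1` and form `∂B_L`. -/
def stepIVLazy {n : ℕ} (D : DetData V n) (dB : Fin n → Fin n → Ser V n) :
    Prog V (Fin n → Fin n → V) := do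
  let r := baby n
  -- the first sum, modulo `z ^ (r - 1)`
  let zero ← lit 0
  let dBH : Fin n → Fin n → Ser V (r - 2) :=
    fun i j k => get zero (dB i j) (n + 2 - r + k)
  let Z₁ ← matResize (r - 2) D.Z
  let T₁ ← tab fun q : Fin (r + 1) => matResize (r - 2) (D.powers q)
  let z₁ ← (ser M (r - 2)).matZero n n
  let S₁ ← (ser M (r - 2)).matPowersDiff Z₁ (get z₁ T₁) r dBH
  let E₁ ← matEvalOne S₁
  -- the second sum, of degree at most `r - 1`
  let dBL ← tab fun i : Fin n => tab fun j : Fin n => do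
    let b ← cellSum fun k : Fin (n + 2 - r) => get zero (dB i j) k
    serC (r - 1) b
  let Z₂ ← matResize (r - 1) D.Z
  let T₂ ← tab fun q : Fin (r + 1) => matResize (r - 1) (D.powers q)
  let z₂ ← (ser M (r - 1)).matZero n n
  let S₂ ← (ser M (r - 1)).matPowersDiff Z₂ (get z₂ T₂) r dBL
  let E₂ ← matEvalOne S₂
  tab fun i => tab fun j => .add (E₁ i j) (E₂ i j) .ret

/-- Step v*, for the indices `i, i - 1, …, 1`: it updates the row vectors `∂v` and the
matrix `X`. -/
def stepV {n : ℕ} (Z : Fin n → Fin n → Ser V n) (v : ℕ → Fin n → Ser V n) :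
    ℕ → (ℕ → Fin n → Ser V n) → (Fin n → Fin n → Ser V n) → Prog V (Fin n → Fin n → Ser V n)
  | 0, _, X => pure X
  | i + 1, dv, X => do
      let w ← (ser M n).vecMul (dv (i + 1)) Z
      let x ← (ser M n).vecAdd (dv i) w
      let o ← (ser M n).outer (v i) (dv (i + 1))
      let X' ← (ser M n).matAdd X o
      stepV Z v i (Function.update dv i x) X'

/-- The division-free adjoint algorithm: the determinant algorithm on `Z(z) = C + z (A - C)`,
followed by its differentiation in the reverse order, with power series modulo `z ^ (n + 1)`, with
the lazy evaluation in step iv*, and with a final evaluation at `z = 1`. -/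
def adjointAlg {n : ℕ} (A : Matrix (Fin n) (Fin n) V) : Prog V (Matrix (Fin n) (Fin n) V) := do
  let r := baby n
  let s := giant n
  let D ← detAlg M A
  -- step i*
  let dh ← stepI M D
  -- step ii*
  let z ← (ser M n).zero
  let dH : Fin r → Fin s → Ser V n := fun i j => get z dh (i + j * r)
  let dU ← (ser M n).matMul (fun (l : Fin n) (i : Fin r) => D.v i l) dH
  let dV ← (ser M n).matMul dH (fun (j : Fin s) (l : Fin n) => D.u j l)
  let du : ℕ → Fin n → Ser V n := fun j l => get z (dU l) j
  let dv : ℕ → Fin n → Ser V n := get (fun _ => z) dV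
  -- step iii*
  let dB₀ ← (ser M n).matZero n n
  let dB ← stepIII M D.B D.u (s - 1) du dB₀
  -- step iv*, modified
  let E ← stepIVLazy M D dB
  -- step v*
  let Zn ← matResize n D.Z
  let X₀ ← (ser M n).matZero n n
  let X ← stepV M Zn D.v (r - 1) dv X₀
  -- final evaluation
  let F ← matEvalOne X
  tab fun i => tab fun j => .add (E i j) (F i j) .ret

end Algorithm

end DivFree

/-!
*Multiplication routines.* To multiply polynomials over an arbitrary ring, where no root of unity
is available and `2` or `3` need not be invertible, a formal root of unity `y` is adjoined. In a
ring with a root `y` of the `q ^ k`-th cyclotomic polynomial, for `q = 2` or `q = 3`, multiplication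
by a power of `y` only permutes coefficients, so that a Fourier transform costs additions alone;
its pointwise products are multiplications of the same kind for an exponent of about `k / 2`
(`exists_fft`, `exists_mul_rootOfUnity`). The inverse transform without its division produces
`2 ^ e * f * g` and `3 ^ e' * f * g` (`exists_scaled_product`), and an integer combination of the two
is `f * g` (`exists_product`). These computations are described by the sets of elements that they
produce (`Reach`); applied to generic polynomials they become one straight-line program, valid over
every ring by specialization (`Reach.exists_slp`, `SLP.run_call_map`, `exists_mulRoutine`).

*Correctness.* Every program on truncated series computes the truncation of what its formula says
for power series (`Arith.Models`, `ser_models`), so it suffices to argue over `R⟦X⟧`, with the pencil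
`Z = C + X * (A - C)`. For `X = 0` it is Kaltofen's matrix `C`, whose moments `φ C ^ k ψ` are the
central binomial coefficients `k.choose (k / 2)` (`krylov_kaltofen`). The orthogonal polynomials
of these moments satisfy `p (n + 2) = X * p (n + 1) - p n`, and their own moments are the ballot
numbers, with ones on the diagonal (`moment_kaltofenPoly`). Hence in the Euclidean scheme for the
moments of `Z` every leading coefficient has constant term `±1` and can be inverted by Newton
iteration (`EuclidInv`, `run_serInv`). The scheme ends with a pair `(f, g)` that describes the
inverse of the Hankel matrix `H` (`HankelPair`, `run_detAlg`), and `f` is the characteristic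
polynomial of `Z`, since that polynomial annihilates the moments as well.

The adjugate of `Z` is the derivative of `det Z = det H_A / det H`, where `H_A` is the Hankel matrix
of the shifted moments. The derivative with respect to the `k`-th moment is given by antidiagonal
sums of the inverses of `H_A` and `H` (`HankelPair.adjugate_eq`). These inverses are Bezoutians,
whose antidiagonal sums are the coefficients of `f' g - g' f` (`HankelPair.antiPoly_eq`), and the pair
that belongs to `H_A` follows from `(f, g)` (`HankelPair.shift`). By the product rule, the derivative
of the moment `φ Z ^ (i + j r) ψ` splits into a part for the giant steps, which passes through the
derivative of `Z ^ r`, and a part for the baby steps (`sum_powDeriv_split`, `run_stepIII`,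
`run_stepV`). Finally the entries of the adjugate are polynomials of degree at most `n`, so that
modulo `X ^ (n + 1)` nothing is lost, and the value at `X = 1`, the adjugate of `A`, is the sum of
the coefficients (`coeffSum_adjugate`). The coefficients of the derivative with respect to `Z ^ r`
that are too low to be affected by the truncation may be evaluated at `X = 1` beforehand, and the
others require only a precision of about `r` (`run_stepIVLazy`).

*Cost.* The products of full matrices are therefore all taken at a precision of at most `r`, and
the long series occur only in products of matrices with vectors and of thin matrices. With `b` and
`c` for the costs of operations on short and on long series, the total is
`O((n ^ 3 * b + n ^ 2 * (r + s) * c) * log n)` (`cost_adjointAlg`). As `r` and `s` are `O(√n)`, a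
quasi-linear routine makes both terms `n ^ 3 * √n` up to logarithms
(`cost_adjointAlg_quasiLinear`).
-/

namespace DivFree

/-! ### Non-uniform straight-line complexity -/

section Complexity

variable {A : Type*} [CommRing A]

/-- `a` is the result of one division-free instruction on operands in `E`. -/
def OneStep (E : Set A) (a : A) : Prop :=
  (∃ c : ℤ, a = c) ∨ ∃ x ∈ E, ∃ y ∈ E, a = x + y ∨ a = x - y ∨ a = x * y

/-- `Reach c E F`: starting with the elements of `E`, at most `c` instructions suffice to compute
elements that together with `E` make up `F`. -/
inductive Reach : ℕ → Set A → Set A → Prop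
  | refl (c : ℕ) (E : Set A) : Reach c E E
  | step {c : ℕ} {E F : Set A} (a : A) (ha : OneStep E a) (h : Reach c (insert a E) F) :
      Reach (c + 1) E F

theorem Reach.subset {c : ℕ} {E F : Set A} (h : Reach c E F) : E ⊆ F := by
  induction h with
  | refl => exact subset_rfl
  | step a _ _ ih => exact (Set.subset_insert _ _).trans ih

theorem Reach.mono {c d : ℕ} {E F : Set A} (h : Reach c E F) (hcd : c ≤ d) : Reach d E F := by
  induction h generalizing d with
  | refl => exact .refl _ _
  | step a ha _ ih =>
    obtain ⟨d, rfl⟩ : ∃ d', d = d' + 1 := ⟨d - 1, by omega⟩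
    exact .step a ha (ih (by omega))

theorem Reach.trans {c d : ℕ} {E F G : Set A} (h : Reach c E F) (h' : Reach d F G) :
    Reach (c + d) E G := by
  induction h with
  | refl => exact h'.mono (by omega)
  | step a ha _ ih => exact ((ih h').step a ha).mono (by omega)

theorem Reach.one {E : Set A} {a : A} (ha : OneStep E a) : Reach 1 E (insert a E) :=
  .step a ha (.refl 0 _)

/-- Computing a family of properties, one after the other. -/
theorem Reach.family {Q : ℕ → Set A → Prop} (hQ : ∀ i E F, E ⊆ F → Q i E → Q i F) {c : ℕ} (n : ℕ)
    {E : Set A} (h : ∀ i < n, ∀ E', E ⊆ E' → ∃ F, Reach c E' F ∧ Q i F) :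
    ∃ F, Reach (n * c) E F ∧ ∀ i < n, Q i F := by
  induction n with
  | zero => exact ⟨E, .refl _ _, by simp⟩
  | succ n ih =>
    obtain ⟨F, hF, hQF⟩ := ih fun i hi => h i (by omega)
    obtain ⟨G, hG, hQG⟩ := h n (by omega) F hF.subset
    refine ⟨G, (hF.trans hG).mono (by rw [Nat.succ_mul]), fun i hi => ?_⟩
    rcases Nat.lt_succ_iff_lt_or_eq.mp hi with hi | rfl
    · exact hQ i _ _ hG.subset (hQF i hi)
    · exact hQG

theorem Reach.fintype {ι : Type*} [Fintype ι] {E : Set A} (f : ι → A) {c : ℕ}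
    (h : ∀ i, ∀ E', E ⊆ E' → ∃ F, Reach c E' F ∧ f i ∈ F) :
    ∃ F, Reach (Fintype.card ι * c) E F ∧ ∀ i, f i ∈ F := by
  classical
  let e := Fintype.equivFin ι
  obtain ⟨F, hF, hQ⟩ := Reach.family
    (Q := fun k F => ∀ hk : k < Fintype.card ι, f (e.symm ⟨k, hk⟩) ∈ F)
    (fun i E F hEF h hk => hEF (h hk)) (Fintype.card ι) (E := E) (c := c) (by
      intro i hi E' hE
      obtain ⟨F, hF, hm⟩ := h (e.symm ⟨i, hi⟩) E' hE
      exact ⟨F, hF, fun _ => hm⟩)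
  refine ⟨F, hF, fun i => ?_⟩
  simpa using hQ (e i) (e i).2 (e i).2

/-- Conversion to a first-order program. -/
theorem Reach.exists_slp {A : Type u} [CommRing A] {c : ℕ} {E F : Set A} (h : Reach c E F) {q : ℕ}
    (y : Fin q → A) (hy : ∀ i, y i ∈ F) {m : ℕ} (x : Fin m → A) (hx : E ⊆ Set.range x) :
    ∃ p : SLP q m, p.size ≤ c ∧ (p.call x).run = y := by
  induction h generalizing m with
  | refl c E =>
    choose o ho using fun i => hx (hy i)
    exact ⟨.out o, by simp [SLP.size], by simp only [SLP.call, Prog.run]; exact funext ho⟩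
  | @step c E F a ha h ih =>
    have key := ih hy (Fin.snoc x a : Fin (m + 1) → A) (by
      rintro b (rfl | hb)
      · exact ⟨Fin.last m, by simp⟩
      · obtain ⟨j, rfl⟩ := hx hb
        exact ⟨j.castSucc, by simp⟩)
    obtain ⟨p, hp, hr⟩ := key
    rcases ha with ⟨z, rfl⟩ | ⟨b, hb, d, hd, hh⟩
    · exact ⟨.const z p, by simpa [SLP.size] using hp, by simpa [SLP.call, Prog.run] using hr⟩
    · obtain ⟨i, rfl⟩ := hx hb
      obtain ⟨j, rfl⟩ := hx hd
      rcases hh with rfl | rfl | rfl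
      · exact ⟨.add i j p, by simpa [SLP.size] using hp, by simpa [SLP.call, Prog.run] using hr⟩
      · exact ⟨.sub i j p, by simpa [SLP.size] using hp, by simpa [SLP.call, Prog.run] using hr⟩
      · exact ⟨.mul i j p, by simpa [SLP.size] using hp, by simpa [SLP.call, Prog.run] using hr⟩

/-- Straight-line programs commute with ring homomorphisms. -/
theorem SLP.run_call_map {A : Type*} [CommRing A] {R : Type*} [CommRing R] (φ : A →+* R) {q m : ℕ}
    (p : SLP q m) (x : Fin m → A) (i : Fin q) :
    (p.call (fun j => φ (x j))).run i = φ ((p.call x).run i) := by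
  have hs : ∀ {m : ℕ} (x : Fin m → A) (a : A),
      (Fin.snoc (fun j => φ (x j)) (φ a) : Fin (m + 1) → R) =
        fun j => φ ((Fin.snoc x a : Fin (m + 1) → A) j) := by
    intro m x a
    funext j
    refine Fin.lastCases ?_ (fun j => ?_) j <;> simp
  induction p with
  | out o => simp [SLP.call, Prog.run]
  | const c p ih =>
    simp only [SLP.call, Prog.run]
    rw [← ih, ← hs, map_intCast]
  | add j k p ih =>
    simp only [SLP.call, Prog.run]
    rw [← ih, ← hs, map_add]
  | sub j k p ih =>
    simp only [SLP.call, Prog.run]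
    rw [← ih, ← hs, map_sub]
  | mul j k p ih =>
    simp only [SLP.call, Prog.run]
    rw [← ih, ← hs, map_mul]

end Complexity

/-! ### Linear combinations with computed coefficients -/

section Rep

variable {A : Type*} [CommRing A] {N : Type*} [AddCommGroup N] [Module A N]
  {ι : Type*} [Fintype ι]

/-- `x` is a linear combination of the family `b` with coefficients in `E`. -/
def Rep (E : Set A) (b : ι → N) (x : N) : Prop :=
  ∃ c : ι → A, (∀ i, c i ∈ E) ∧ x = ∑ i, c i • b i

theorem Rep.mono {E F : Set A} {b : ι → N} {x : N} (h : Rep E b x) (hEF : E ⊆ F) : Rep F b x := by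
  obtain ⟨c, hc, rfl⟩ := h
  exact ⟨c, fun i => hEF (hc i), rfl⟩

theorem Rep.reindex {E : Set A} {b : ι → N} {x : N} (h : Rep E b x) {κ : Type*} [Fintype κ]
    {N' : Type*} [AddCommGroup N'] [Module A N'] {b' : κ → N'}
    (σ : ι ≃ κ) (f : N →ₗ[A] N') (hb : ∀ i, f (b i) = b' (σ i)) : Rep E b' (f x) := by
  obtain ⟨c, hc, rfl⟩ := h
  refine ⟨fun k => c (σ.symm k), fun k => hc _, ?_⟩
  rw [map_sum, ← σ.sum_comp]
  simp [hb]

theorem Rep.add {E : Set A} {b : ι → N} {x y : N} (hx : Rep E b x) (hy : Rep E b y) :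
    ∃ F, Reach (Fintype.card ι) E F ∧ Rep F b (x + y) := by
  obtain ⟨c, hc, rfl⟩ := hx
  obtain ⟨d, hd, rfl⟩ := hy
  obtain ⟨F, hF, h⟩ := Reach.fintype (E := E) (fun i => c i + d i) (c := 1) fun i E' hE =>
    ⟨_, .one (.inr ⟨_, hE (hc i), _, hE (hd i), .inl rfl⟩), Set.mem_insert _ _⟩
  exact ⟨F, by simpa using hF, _, h, by simp [add_smul, Finset.sum_add_distrib]⟩

theorem Rep.smul {E : Set A} {b : ι → N} {x : N} (hx : Rep E b x) {a : A} (ha : a ∈ E) :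
    ∃ F, Reach (Fintype.card ι) E F ∧ Rep F b (a • x) := by
  obtain ⟨c, hc, rfl⟩ := hx
  obtain ⟨F, hF, h⟩ := Reach.fintype (E := E) (fun i => a * c i) (c := 1) fun i E' hE =>
    ⟨_, .one (.inr ⟨_, hE ha, _, hE (hc i), .inr (.inr rfl)⟩), Set.mem_insert _ _⟩
  exact ⟨F, by simpa using hF, _, h, by simp [Finset.smul_sum, mul_smul]⟩

theorem Rep.sum {E : Set A} {b : ι → N} {x : ℕ → N} (n : ℕ) (hn : 0 < n)
    (hx : ∀ i < n, Rep E b (x i)) :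
    ∃ F, Reach (n * Fintype.card ι) E F ∧ Rep F b (∑ i ∈ Finset.range n, x i) := by
  obtain ⟨n, rfl⟩ : ∃ m, n = m + 1 := ⟨n - 1, by omega⟩
  induction n with
  | zero => exact ⟨E, .refl _ _, by simpa using hx 0 (by omega)⟩
  | succ n ih =>
    obtain ⟨F, hF, h⟩ := ih (by omega) fun i hi => hx i (by omega)
    obtain ⟨G, hG, h'⟩ := h.add ((hx (n + 1) (by omega)).mono hF.subset)
    exact ⟨G, (hF.trans hG).mono (by ring_nf; rfl), by rwa [Finset.sum_range_succ]⟩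

/-- Computing the sums of several sequences of linear combinations. -/
theorem Rep.sums {E : Set A} {b : ι → N} (m n : ℕ) (hn : 0 < n) {x : ℕ → ℕ → N}
    (hx : ∀ k < m, ∀ i < n, Rep E b (x k i)) :
    ∃ F, Reach (m * (n * Fintype.card ι)) E F ∧
      ∀ k < m, Rep F b (∑ i ∈ Finset.range n, x k i) :=
  Reach.family (Q := fun k F => Rep F b (∑ i ∈ Finset.range n, x k i))
    (fun _ _ _ hEF h => h.mono hEF) m fun k hk _ hE =>
      Rep.sum n hn fun i hi => (hx k hk i hi).mono hE

end Rep

/-! ### Multiplication by a fast Fourier transform over a ring with roots of unity -/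

section FFT

open Polynomial

variable {A : Type*} [CommRing A] {S : Type*} [CommRing S] [Algebra A S]

/-- The powers `1, y, …, y ^ (L - 1)`. -/
def powFamily (y : S) (L : ℕ) : Fin L → S := fun i => y ^ (i : ℕ)

/-- The products `y ^ l * X ^ i` with `i < h` and `l < L`. -/
noncomputable def polyFamily (y : S) (h L : ℕ) : Fin h × Fin L → S[X] :=
  fun p => C (y ^ (p.2 : ℕ)) * X ^ (p.1 : ℕ)

theorem pow_add_mod {L : ℕ} [NeZero L] {y : S} (hy : y ^ L = 1) (t : ℕ) (i : Fin L) :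
    y ^ t * y ^ (i : ℕ) = y ^ ((i + Fin.ofNat L t : Fin L) : ℕ) := by
  rw [Fin.val_add, ← pow_add, ← pow_eq_pow_mod _ hy, Fin.val_ofNat, pow_add _ (i : ℕ),
    ← pow_eq_pow_mod _ hy, ← pow_add, add_comm]

theorem Rep.polyFamily_pow_mul {E : Set A} {y : S} {h L : ℕ} [NeZero L] (hy : y ^ L = 1) {P : S[X]}
    (hP : Rep E (polyFamily y h L) P) (t : ℕ) : Rep E (polyFamily y h L) (C (y ^ t) * P) :=
  hP.reindex ((Equiv.refl _).prodCongr (Equiv.addRight (Fin.ofNat L t)))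
    (LinearMap.mulLeft A (C (y ^ t))) fun i => by
      simp only [polyFamily, LinearMap.mulLeft_apply, Equiv.prodCongr_apply, Equiv.coe_refl,
        Equiv.coe_addRight, Prod.map, id]
      rw [← pow_add_mod hy, C_mul, mul_assoc]

theorem Rep.powFamily_pow_mul {E : Set A} {y : S} {L : ℕ} [NeZero L] (hy : y ^ L = 1) {x : S}
    (hx : Rep E (powFamily y L) x) (t : ℕ) : Rep E (powFamily y L) (y ^ t * x) :=
  hx.reindex (Equiv.addRight (Fin.ofNat L t)) (LinearMap.mulLeft A (y ^ t)) fun i => by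
    simp only [powFamily, LinearMap.mulLeft_apply, Equiv.coe_addRight]
    rw [← pow_add_mod hy]

/-- Splitting a polynomial into blocks. -/
theorem Rep.polyFamily_split {E : Set A} {y : S} {h L q N : ℕ} (hN : N = q * h) {P : S[X]}
    (hP : Rep E (polyFamily y N L) P) :
    ∃ Q : ℕ → S[X], (∀ k < q, Rep E (polyFamily y h L) (Q k)) ∧
      P = ∑ k ∈ Finset.range q, X ^ (h * k) * Q k := by
  subst hN
  obtain ⟨c, hc, rfl⟩ := hP
  refine ⟨fun k => if hk : k < q then
    ∑ p : Fin h × Fin L, c (finProdFinEquiv (⟨k, hk⟩, p.1), p.2) • polyFamily y h L p else 0,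
    fun k hk => ⟨fun p => c (finProdFinEquiv (⟨k, hk⟩, p.1), p.2), fun _ => hc _, by simp [hk]⟩, ?_⟩
  rw [Finset.sum_range, Fintype.sum_prod_type, ← finProdFinEquiv.sum_comp, Fintype.sum_prod_type]
  refine Finset.sum_congr rfl fun k _ => ?_
  simp only [Fin.is_lt, dite_true, Fin.eta]
  rw [Fintype.sum_prod_type, Finset.mul_sum]
  refine Finset.sum_congr rfl fun i _ => ?_
  rw [Finset.mul_sum]
  refine Finset.sum_congr rfl fun l _ => ?_
  simp only [polyFamily, finProdFinEquiv_apply_val, mul_smul_comm]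
  rw [pow_add]
  congr 1
  ring

theorem Rep.polyFamily_merge {E : Set A} {y : S} {h L q N : ℕ} (hN : N = q * h) {Q : ℕ → S[X]}
    (hQ : ∀ k < q, Rep E (polyFamily y h L) (Q k)) :
    Rep E (polyFamily y N L) (∑ k ∈ Finset.range q, X ^ (h * k) * Q k) := by
  subst hN
  choose! c hc hcQ using hQ
  refine ⟨fun p => c (finProdFinEquiv.symm p.1).1 ((finProdFinEquiv.symm p.1).2, p.2),
    fun p => hc _ (Fin.is_lt _) _, ?_⟩
  rw [Finset.sum_range, Fintype.sum_prod_type, ← finProdFinEquiv.sum_comp, Fintype.sum_prod_type]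
  refine Finset.sum_congr rfl fun k _ => ?_
  rw [hcQ k k.2, Fintype.sum_prod_type, Finset.mul_sum]
  refine Finset.sum_congr rfl fun i _ => ?_
  rw [Finset.mul_sum]
  refine Finset.sum_congr rfl fun l _ => ?_
  simp only [polyFamily, finProdFinEquiv_apply_val, mul_smul_comm, Equiv.symm_apply_apply]
  rw [pow_add]
  congr 1
  ring

theorem Rep.polyFamily_one {E : Set A} {y : S} {L : ℕ} {P : S[X]}
    (hP : Rep E (polyFamily y 1 L) P) : ∃ x, P = C x ∧ Rep E (powFamily y L) x := by
  obtain ⟨c, hc, rfl⟩ := hP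
  refine ⟨∑ l, c (0, l) • y ^ (l : ℕ), ?_, ⟨fun l => c (0, l), fun l => hc _, rfl⟩⟩
  rw [Fintype.sum_prod_type, map_sum]
  simp only [Finset.univ_unique, Finset.sum_singleton]
  refine Finset.sum_congr rfl fun l _ => ?_
  simp [polyFamily, Algebra.smul_def, IsScalarTower.algebraMap_apply A S S[X]]

theorem Rep.C_polyFamily_one {E : Set A} {y : S} {L : ℕ} {x : S}
    (hx : Rep E (powFamily y L) x) : Rep E (polyFamily y 1 L) (C x) := by
  obtain ⟨c, hc, rfl⟩ := hx
  refine ⟨fun p => c p.2, fun p => hc _, ?_⟩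
  rw [Fintype.sum_prod_type, map_sum]
  simp only [Finset.univ_unique, Finset.sum_singleton]
  refine Finset.sum_congr rfl fun l _ => ?_
  simp [polyFamily, powFamily, Algebra.smul_def, IsScalarTower.algebraMap_apply A S S[X]]

/-- Interpolation at `q` moduli `X ^ h - a i`, where the `a i` run through the `q`-th roots of one
element: residues `W i` of `Q` are combined to a residue of `q * Q`. No difference of the `a i`
has to be invertible. -/
theorem dvd_interpolation {q h : ℕ} (hq : 0 < q) {a b : ℕ → S} (hab : ∀ i, a i * b i = 1) {c : S}
    (haq : ∀ i, a i ^ q = c)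
    (hbsum : ∀ k, 0 < k → k < q → ∑ i ∈ Finset.range q, b i ^ k = 0) {W : ℕ → S[X]} {Q : S[X]}
    (hW : ∀ i < q, X ^ h - C (a i) ∣ W i - Q) :
    X ^ (q * h) - C c ∣
      ∑ k ∈ Finset.range q, X ^ (h * k) * ∑ i ∈ Finset.range q, C (b i ^ k) * W i
        - (q : S[X]) * Q := by
  have hG : ∀ i, X ^ (q * h) - C c ∣
      (∑ k ∈ Finset.range q, (C (b i) * X ^ h) ^ k) * (X ^ h - C (a i)) := by
    intro i
    have h1 : X ^ h - C (a i) = C (a i) * (C (b i) * X ^ h - 1) := by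
      rw [mul_sub, ← mul_assoc, ← C_mul, hab]; simp
    have h2 : (C (b i) * X ^ h : S[X]) ^ q - 1 = C (b i ^ q) * (X ^ (q * h) - C c) := by
      rw [← haq i, mul_sub, ← C_mul, ← mul_pow, mul_comm (b i), hab, mul_pow, mul_comm q h]
      simp [pow_mul]
    rw [h1, mul_left_comm, geom_sum_mul, h2, ← mul_assoc]
    exact dvd_mul_left _ _
  have hsum : ∑ i ∈ Finset.range q, ∑ k ∈ Finset.range q, (C (b i) * X ^ h) ^ k
      = (q : S[X]) := by
    rw [Finset.sum_comm, Finset.sum_eq_single_of_mem 0 (Finset.mem_range.2 hq)]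
    · simp
    · intro k hk hk0
      simp only [mul_pow, ← Finset.sum_mul, ← C_pow, ← map_sum]
      rw [hbsum k (Nat.pos_of_ne_zero hk0) (Finset.mem_range.1 hk)]
      simp
  have hV : ∑ k ∈ Finset.range q, X ^ (h * k) * ∑ i ∈ Finset.range q, C (b i ^ k) * W i =
      ∑ i ∈ Finset.range q, (∑ k ∈ Finset.range q, (C (b i) * X ^ h) ^ k) * W i := by
    simp only [Finset.mul_sum, Finset.sum_mul]
    rw [Finset.sum_comm]
    refine Finset.sum_congr rfl fun i _ => Finset.sum_congr rfl fun k _ => ?_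
    rw [mul_pow, C_pow]; ring
  have hQ : (q : S[X]) * Q =
      ∑ i ∈ Finset.range q, (∑ k ∈ Finset.range q, (C (b i) * X ^ h) ^ k) * Q := by
    rw [← Finset.sum_mul, hsum]
  rw [hV, hQ, ← Finset.sum_sub_distrib]
  refine Finset.dvd_sum fun i hi => ?_
  rw [← mul_sub]
  obtain ⟨M, hM⟩ := hW i (Finset.mem_range.1 hi)
  rw [hM, ← mul_assoc]
  exact (hG i).mul_right _

/-- For a primitive root of unity of order `2` or `3`, the powers of its inverse have vanishing
sums. -/
theorem sum_inv_root_pow {q : ℕ} (hq : q = 2 ∨ q = 3) {z w : S} (hzw : z * w = 1)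
    (hz : ∑ i ∈ Finset.range q, z ^ i = 0) {k : ℕ} (hk : 0 < k) (hkq : k < q) :
    ∑ i ∈ Finset.range q, (w ^ i) ^ k = 0 := by
  rcases hq with rfl | rfl
  · obtain rfl : k = 1 := by omega
    simp only [Finset.sum_range_succ, Finset.sum_range_zero] at hz ⊢
    linear_combination w * hz - (1 - w * 0) * hzw + hzw * 0
  · simp only [Finset.sum_range_succ, Finset.sum_range_zero] at hz ⊢
    have h1 : w ^ 2 + w + 1 = 0 := by
      linear_combination w ^ 2 * hz - (w + 1 + z * w) * hzw
    interval_cases k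
    · linear_combination h1
    · linear_combination (w ^ 2 - w + 1) * h1

/-- The Fourier transform, its inversion, and the pointwise products between them, as a recursive
multiplication modulo `X ^ (q ^ j) - y ^ (t * q ^ j)`: this modulus is a product of `q` moduli of
the same kind, of degree `q ^ (j - 1)`. Each level of the recursion contributes a factor `q` to
the result. -/
theorem exists_fft {q : ℕ} (hq : q = 2 ∨ q = 3) {y : S} {L T e : ℕ} [NeZero L] (hy : y ^ L = 1)
    (hz : ∑ i ∈ Finset.range q, (y ^ (L / q)) ^ i = 0)
    (leaf : ∀ (E : Set A) (x x' : S), Rep E (powFamily y L) x → Rep E (powFamily y L) x' →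
      ∃ F, Reach T E F ∧ Rep F (powFamily y L) ((q : S) ^ e * (x * x'))) (j : ℕ) (hj : q ^ j ∣ L)
    (E : Set A) (t : ℕ) (P P' : S[X]) (hP : Rep E (polyFamily y (q ^ j) L) P)
    (hP' : Rep E (polyFamily y (q ^ j) L) P') :
    ∃ F, Reach (q ^ j * T + 3 * q * j * q ^ j * L) E F ∧ ∃ W : S[X],
      Rep F (polyFamily y (q ^ j) L) W ∧
        X ^ q ^ j - C (y ^ (t * q ^ j)) ∣ W - (q : S[X]) ^ (e + j) * (P * P') := by
  have hq0 : 0 < q := by omega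
  induction j generalizing E t P P' with
  | zero =>
    rw [pow_zero] at hP hP' ⊢
    obtain ⟨x, rfl, hx⟩ := hP.polyFamily_one
    obtain ⟨x', rfl, hx'⟩ := hP'.polyFamily_one
    obtain ⟨F, hF, hr⟩ := leaf E x x' hx hx'
    exact ⟨F, hF.mono (by simp), C ((q : S) ^ e * (x * x')), hr.C_polyFamily_one, by simp⟩
  | succ j ih =>
    obtain ⟨M, hM⟩ := hj
    set h := q ^ j with hh
    clear_value h
    have hN : q ^ (j + 1) = q * h := by rw [pow_succ, mul_comm, hh]
    have hLq : L / q = M * h := by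
      rw [hM, hN, mul_assoc, Nat.mul_div_cancel_left _ hq0, mul_comm]
    set z := y ^ (L / q) with hzdef
    have hzq : z ^ q = 1 := by
      rw [hzdef, ← pow_mul, Nat.div_mul_cancel ⟨h * M, by rw [hM, hN, mul_assoc]⟩, hy]
    have hyinv : ∀ a : ℕ, y ^ a * y ^ ((L - 1) * a) = 1 := fun a => by
      rw [← pow_add, show a + (L - 1) * a = L * a by
        obtain ⟨l, hl⟩ := Nat.exists_eq_succ_of_ne_zero (NeZero.ne L)
        rw [hl, Nat.succ_sub_one, Nat.succ_eq_add_one]; ring, pow_mul, hy, one_pow]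
    let ti : ℕ → ℕ := fun i => t + i * M
    let a : ℕ → S := fun i => y ^ (ti i * h)
    let b : ℕ → S := fun i => y ^ ((L - 1) * (ti i * h))
    have hab : ∀ i, a i * b i = 1 := fun i => hyinv _
    have ha : ∀ i, a i = y ^ (t * h) * z ^ i := fun i => by
      simp only [a, ti, hzdef, hLq, ← pow_mul, ← pow_add]; ring_nf
    have hb : ∀ i, b i = y ^ ((L - 1) * (t * h)) * (y ^ ((L - 1) * (L / q))) ^ i := fun i => by
      simp only [b, ti, hLq, ← pow_mul, ← pow_add]; ring_nf
    have hbsum : ∀ k, 0 < k → k < q → ∑ i ∈ Finset.range q, b i ^ k = 0 := fun k hk hkq => by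
      simp only [hb, mul_pow, ← Finset.mul_sum]
      rw [sum_inv_root_pow hq (hyinv (L / q)) hz hk hkq, mul_zero]
    have haq : ∀ i, a i ^ q = y ^ (t * q ^ (j + 1)) := fun i => by
      rw [ha, mul_pow, ← pow_mul, ← pow_mul, mul_comm i, pow_mul z, hzq, one_pow, mul_one, hN]
      ring_nf
    obtain ⟨p, hp, rfl⟩ := hP.polyFamily_split hN
    obtain ⟨p', hp', rfl⟩ := hP'.polyFamily_split hN
    have hcard : Fintype.card (Fin h × Fin L) = h * L := by simp
    -- reduction of both factors
    obtain ⟨F₁, hF₁, h₁⟩ := Rep.sums (E := E) (b := polyFamily y h L) q q hq0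
      (x := fun i k => C (a i ^ k) * p k) fun i hi k hk => by
        simp only [a, ← pow_mul]
        exact (hp k hk).polyFamily_pow_mul hy _
    obtain ⟨F₂, hF₂, h₂⟩ := Rep.sums (E := F₁) (b := polyFamily y h L) q q hq0
      (x := fun i k => C (a i ^ k) * p' k) fun i hi k hk => by
        simp only [a, ← pow_mul]
        exact ((hp' k hk).polyFamily_pow_mul hy _).mono hF₁.subset
    have hred : ∀ (p : ℕ → S[X]) (i : ℕ), X ^ h - C (a i) ∣
        ∑ k ∈ Finset.range q, X ^ (h * k) * p k - ∑ k ∈ Finset.range q, C (a i ^ k) * p k := by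
      intro p i
      rw [← Finset.sum_sub_distrib]
      refine Finset.dvd_sum fun k _ => ?_
      rw [← sub_mul, pow_mul, C_pow (a := a i)]
      exact Dvd.dvd.mul_right (sub_dvd_pow_sub_pow (X ^ h : S[X]) (C (a i)) k) _
    have hp₀ := hred p
    have hp₀' := hred p'
    generalize ∑ k ∈ Finset.range q, X ^ (h * k) * p k = P at hp₀ ⊢
    generalize ∑ k ∈ Finset.range q, X ^ (h * k) * p' k = P' at hp₀' ⊢
    -- recursive multiplications
    have hrec : ∀ i < q, ∀ E', F₂ ⊆ E' → ∃ F, Reach (h * T + 3 * q * j * h * L) E' F ∧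
        ∃ W : S[X], Rep F (polyFamily y h L) W ∧ X ^ h - C (a i) ∣
          W - (q : S[X]) ^ (e + j) * (P * P') := by
      intro i hi E' hE
      obtain ⟨F, hF, W, hW, hd⟩ := ih ⟨q * M, by rw [hM, hN]; ring⟩ E' (ti i) _ _
        ((h₁ i hi).mono (hF₂.subset.trans hE)) ((h₂ i hi).mono hE)
      refine ⟨F, hF, W, hW, ?_⟩
      have h3 := dvd_sub hd ((dvd_add ((hp₀ i).mul_right P') ((hp₀' i).mul_left
        (∑ k ∈ Finset.range q, C (a i ^ k) * p k))).mul_left ((q : S[X]) ^ (e + j)))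
      refine h3.trans (dvd_of_eq ?_)
      ring
    obtain ⟨F₃, hF₃, h₃⟩ := Reach.family
      (Q := fun i F => ∃ W : S[X], Rep F (polyFamily y h L) W ∧ X ^ h - C (a i) ∣
        W - (q : S[X]) ^ (e + j) * (P * P'))
      (fun i E F hEF ⟨W, hW, hd⟩ => ⟨W, hW.mono hEF, hd⟩) q hrec
    choose! W hW hWd using h₃
    -- interpolation
    obtain ⟨F₄, hF₄, h₄⟩ := Rep.sums (E := F₃) (b := polyFamily y h L) q q hq0
      (x := fun k i => C (b i ^ k) * W i) fun k hk i hi => by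
        simp only [b, ← pow_mul]
        exact (hW i hi).polyFamily_pow_mul hy _
    refine ⟨F₄, (((hF₁.trans hF₂).trans hF₃).trans hF₄).mono ?_, _,
      Rep.polyFamily_merge hN h₄, ?_⟩
    · rw [hcard, hN]; apply le_of_eq; ring
    · have := dvd_interpolation hq0 hab haq hbsum hWd
      rw [← hN] at this
      convert this using 2
      ring

end FFT

/-! ### Multiplication by means of roots of unity -/

section Recursion

open Polynomial

universe v w

variable {A : Type v} [CommRing A] {S : Type w} [CommRing S] [Algebra A S]

theorem Rep.exists_polyFamily_eval {E : Set A} {y : S} {L m N : ℕ} (hN : N = L * m) {x : S}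
    (hx : Rep E (powFamily y N) x) :
    ∃ P : S[X], Rep E (polyFamily (y ^ m) m L) P ∧ P.eval y = x := by
  subst hN
  obtain ⟨c, hc, rfl⟩ := hx
  refine ⟨_, ⟨fun p => c (finProdFinEquiv (p.2, p.1)), fun _ => hc _, rfl⟩, ?_⟩
  rw [eval_finsetSum, ← finProdFinEquiv.sum_comp, ← (Equiv.prodComm _ _).sum_comp]
  refine Finset.sum_congr rfl fun p _ => ?_
  simp only [Equiv.prodComm_apply, Prod.fst_swap, Prod.snd_swap, polyFamily, powFamily,
    finProdFinEquiv_apply_val, Algebra.smul_def, IsScalarTower.algebraMap_apply A S S[X],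
    algebraMap_eq, eval_mul, eval_C, eval_pow, eval_X]
  ring

theorem Rep.eval_polyFamily {E : Set A} {y : S} {L m N : ℕ} (hN : N = L * m) {P : S[X]}
    (hP : Rep E (polyFamily (y ^ m) m L) P) : Rep E (powFamily y N) (P.eval y) := by
  subst hN
  have := hP.reindex (b' := powFamily y (L * m)) ((Equiv.prodComm _ _).trans finProdFinEquiv)
    ((Polynomial.aeval y : S[X] →ₐ[S] S).toLinearMap.restrictScalars A) fun p => by
      simp only [polyFamily, powFamily, LinearMap.restrictScalars_apply, AlgHom.toLinearMap_apply,
        Equiv.trans_apply, Equiv.prodComm_apply, finProdFinEquiv_apply_val, map_mul, aeval_C,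
        map_pow, aeval_X, Algebra.algebraMap_self, RingHom.id_apply, Prod.fst_swap, Prod.snd_swap]
      ring
  simpa [← Polynomial.coe_aeval_eq_eval] using this

theorem Rep.degree_lt {E : Set A} {y : S} {h L : ℕ} {P : S[X]} (hP : Rep E (polyFamily y h L) P) :
    P.degree < h := by
  obtain ⟨c, -, rfl⟩ := hP
  rw [← mem_degreeLT]
  refine Submodule.sum_mem _ fun p _ => Submodule.smul_of_tower_mem _ _ ?_
  rw [mem_degreeLT]
  exact (degree_C_mul_X_pow_le _ _).trans_lt (by exact_mod_cast p.1.2)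

/-- Multiplication by the definition. -/
theorem Rep.mul_naive {E : Set A} {y : S} {L : ℕ} [NeZero L] (hy : y ^ L = 1) {x x' : S}
    (hx : Rep E (powFamily y L) x) (hx' : Rep E (powFamily y L) x') :
    ∃ F, Reach (L * L + L * L) E F ∧ Rep F (powFamily y L) (x * x') := by
  obtain ⟨c, hc, rfl⟩ := hx'
  obtain ⟨F, hF, h⟩ := Reach.family
    (Q := fun i F => ∀ hi : i < L, Rep F (powFamily y L) (y ^ i * (c ⟨i, hi⟩ • x)))
    (fun i E F hEF h hi => (h hi).mono hEF) L (E := E) (c := L) (by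
      intro i hi E' hE
      obtain ⟨F, hF, h⟩ := (hx.mono hE).smul (hE (hc ⟨i, hi⟩))
      exact ⟨F, hF.mono (by simp), fun _ => h.powFamily_pow_mul hy i⟩)
  obtain ⟨G, hG, h'⟩ := Rep.sum (b := powFamily y L) (E := F)
    (x := fun i => if hi : i < L then y ^ i * (c ⟨i, hi⟩ • x) else 0) L (NeZero.pos L)
    fun i hi => by
      rw [dif_pos hi]; exact h i hi hi
  refine ⟨G, (hF.trans hG).mono (by simp), ?_⟩
  convert h' using 1
  rw [Finset.sum_range, Finset.mul_sum]
  refine Finset.sum_congr rfl fun i _ => ?_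
  simp only [powFamily, Fin.is_lt, dite_true, Fin.eta, Algebra.mul_smul_comm]
  rw [mul_comm]

theorem pow_eq_one_of_geom_sum {q h : ℕ} {y : S}
    (hy : ∑ i ∈ Finset.range q, (y ^ h) ^ i = 0) : y ^ (q * h) = 1 := by
  have := geom_sum_mul (y ^ h) q
  rw [hy, zero_mul, ← pow_mul, mul_comm h] at this
  exact (sub_eq_zero.mp this.symm)

end Recursion

section RootOfUnity

open Polynomial

/-- Fast multiplication in a ring that contains a root `y` of the `q ^ k`-th cyclotomic polynomial:
the factors become polynomials in `y` of degree about `q ^ (k / 2)`, whose coefficients are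
expressions in a power of `y`; these are multiplied by the Fourier transform. -/
theorem exists_mul_rootOfUnity.{v, w} {q : ℕ} (hq : q = 2 ∨ q = 3) (k : ℕ) (hk : 1 ≤ k) :
    ∃ e : ℕ, ∀ (A : Type v) [CommRing A] (S : Type w) [CommRing S] [Algebra A S] (y : S),
      ∑ i ∈ Finset.range q, (y ^ q ^ (k - 1)) ^ i = 0 → ∀ (E : Set A) (x x' : S),
        Rep E (powFamily y (q ^ k)) x → Rep E (powFamily y (q ^ k)) x' →
          ∃ F, Reach (q ^ k * (200 * (k - 2) ^ 3 + 18)) E F ∧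
            Rep F (powFamily y (q ^ k)) ((q : S) ^ e * (x * x')) := by
  have hq0 : 0 < q := by omega
  induction k using Nat.strong_induction_on with
  | _ k ih =>
    rcases Nat.lt_or_ge 2 k with hk2 | hk2
    · set a := (k - 1) / 2 with ha
      have hka : k - a < k := by omega
      obtain ⟨e, he⟩ := ih (k - a) hka (by omega)
      refine ⟨e + (a + 1), fun A _ S _ _ y hy E x x' hx hx' => ?_⟩
      set m := q ^ a with hm
      set L := q ^ (k - a) with hL
      have : NeZero L := ⟨(pow_pos hq0 _).ne'⟩
      have hN : q ^ k = L * m := by rw [hL, hm, ← pow_add]; congr 1; omega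
      have hLq : L / q = q ^ (k - a - 1) := by
        rw [hL, show k - a = k - a - 1 + 1 by omega, pow_succ, Nat.mul_div_cancel _ hq0]; simp
      have hy' : ∑ i ∈ Finset.range q, ((y ^ m) ^ q ^ (k - a - 1)) ^ i = 0 := by
        rw [← hy, ← pow_mul, hm, ← pow_add, show a + (k - a - 1) = k - 1 by omega]
      have hyL : (y ^ m) ^ L = 1 := by
        have := pow_eq_one_of_geom_sum hy'
        rwa [← pow_succ', show k - a - 1 + 1 = k - a by omega] at this
      -- padding with zero coefficients
      have hz : OneStep E (0 : A) := .inl ⟨0, by simp⟩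
      have h0 : Rep (insert 0 E) (polyFamily (y ^ m) m L) (0 : S[X]) :=
        ⟨fun _ => 0, fun _ => Set.mem_insert _ _, by simp⟩
      have hpad : ∀ {P : S[X]}, Rep (insert 0 E) (polyFamily (y ^ m) m L) P →
          Rep (insert 0 E) (polyFamily (y ^ m) (q ^ (a + 1)) L) P := by
        intro P hP
        have := Rep.polyFamily_merge (E := insert 0 E) (y := y ^ m) (L := L) (q := q) (h := m)
          (N := q ^ (a + 1)) (by rw [pow_succ']) (Q := fun k => if k = 0 then P else 0) (by
            intro k _
            split_ifs
            · exact hP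
            · exact h0)
        convert this using 1
        rw [Finset.sum_eq_single_of_mem 0 (Finset.mem_range.2 hq0) (by simp +contextual)]
        simp
      obtain ⟨P, hP, rfl⟩ := hx.exists_polyFamily_eval hN
      obtain ⟨P', hP', rfl⟩ := hx'.exists_polyFamily_eval hN
      replace hP := hP.mono (Set.subset_insert 0 E)
      replace hP' := hP'.mono (Set.subset_insert 0 E)
      obtain ⟨F, hF, W, hW, hd⟩ := exists_fft hq hyL (by rw [hLq]; exact hy')
        (fun E x x' => he A S (y ^ m) hy' E x x') (a + 1)
        (pow_dvd_pow q (by omega)) _ 0 P P' (hpad hP) (hpad hP')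
      have hWeq : W = (q : S[X]) ^ (e + (a + 1)) * (P * P') := by
        rcases subsingleton_or_nontrivial S with hS | hS
        · exact Subsingleton.elim _ _
        by_contra hne
        refine (monic_X_pow_sub_C (y ^ (m * (0 * q ^ (a + 1))))
          (pow_pos hq0 (a + 1)).ne').not_dvd_of_degree_lt (sub_ne_zero.2 hne) ?_
          (by simpa [← pow_mul] using hd)
        rw [degree_X_pow_sub_C (pow_pos hq0 (a + 1))]
        refine (degree_sub_le _ _).trans_lt (max_lt hW.degree_lt ?_)
        rw [← mem_degreeLT, ← Nat.cast_pow, ← nsmul_eq_mul]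
        refine Submodule.smul_of_tower_mem _ _ ?_
        rw [mem_degreeLT]
        have hm0 : 0 < m := pow_pos hq0 a
        have hb : ∀ {P : S[X]}, P.degree < m → P.degree ≤ ((m - 1 : ℕ) : WithBot ℕ) :=
          fun h => (degree_le_iff_coeff_zero _ _).2 fun n hn =>
            (degree_lt_iff_coeff_zero _ _).1 h n (by
              have : m - 1 < n := by exact_mod_cast hn
              omega)
        refine (degree_mul_le_of_le (hb hP.degree_lt) (hb hP'.degree_lt)).trans_lt ?_
        have : m - 1 + (m - 1) < q ^ (a + 1) := by
          rw [pow_succ, ← hm]; rcases hq with rfl | rfl <;> omega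
        exact_mod_cast this
      obtain ⟨w, hw, hWw⟩ := hW.polyFamily_split (q := q) (h := m) (by rw [pow_succ'])
      have hyN : y ^ (q ^ k) = 1 := by
        have := pow_eq_one_of_geom_sum hy
        rwa [← pow_succ', show k - 1 + 1 = k by omega] at this
      have : NeZero (q ^ k) := ⟨(pow_pos hq0 _).ne'⟩
      obtain ⟨G, hG, hs⟩ := Rep.sum (E := F) (b := powFamily y (q ^ k))
        (x := fun i => y ^ (m * i) * (w i).eval y) q hq0 fun i hi =>
          ((hw i hi).eval_polyFamily hN).powFamily_pow_mul hyN _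
      refine ⟨G, ((Reach.one hz).trans (hF.trans hG)).mono ?_, ?_⟩
      · have h1 : q ^ (a + 1) * L = q * q ^ k := by rw [hN, pow_succ, hm]; ring
        have h2 : 8 * (k - a - 2) ^ 3 ≤ (k - 2) ^ 3 := by
          calc 8 * (k - a - 2) ^ 3 = (2 * (k - a - 2)) ^ 3 := by ring
            _ ≤ _ := Nat.pow_le_pow_left (by omega) 3
        have h3 : a + 1 ≤ 2 * (k - 2) ^ 3 := by
          have : k - 2 ≤ (k - 2) ^ 3 := Nat.le_self_pow (by norm_num) _
          omega
        have h4 : 1 ≤ (k - 2) ^ 3 := Nat.one_le_pow _ _ (by omega)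
        have h5 : 0 < q ^ k := pow_pos hq0 k
        rw [Fintype.card_fin]
        generalize (k - 2) ^ 3 = X at *
        generalize (k - a - 2) ^ 3 = Y at *
        calc 1 + (q ^ (a + 1) * (L * (200 * Y + 18)) + 3 * q * (a + 1) * q ^ (a + 1) * L
              + q * q ^ k)
            = 1 + q ^ k * (q * (200 * Y + 18) + 3 * q * q * (a + 1) + q) := by
              have : q ^ (a + 1) * (L * (200 * Y + 18)) + 3 * q * (a + 1) * q ^ (a + 1) * L =
                (q ^ (a + 1) * L) * (200 * Y + 18 + 3 * q * (a + 1)) := by ring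
              rw [this, h1]; ring
          _ ≤ q ^ k * 1 + q ^ k * (3 * (200 * Y + 18) + 3 * 3 * 3 * (a + 1) + 3) := by
              have : q ≤ 3 := by omega
              gcongr
              omega
          _ ≤ _ := by
              rw [← mul_add]
              exact Nat.mul_le_mul_left _ (by omega)
      · convert hs using 1
        rw [show (q : S) ^ (e + (a + 1)) * (eval y P * eval y P') = eval y W by
          rw [hWeq]; simp, hWw, eval_finsetSum]
        simp
    · refine ⟨0, fun A _ S _ _ y hy E x x' hx hx' => ?_⟩
      have hyN : y ^ (q ^ k) = 1 := by
        have := pow_eq_one_of_geom_sum hy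
        rwa [← pow_succ', show k - 1 + 1 = k by omega] at this
      have : NeZero (q ^ k) := ⟨(pow_pos hq0 _).ne'⟩
      obtain ⟨F, hF, h⟩ := hx.mul_naive hyN hx'
      refine ⟨F, hF.mono ?_, by simpa using h⟩
      have : q ^ k ≤ 9 := calc
        q ^ k ≤ 3 ^ k := Nat.pow_le_pow_left (by omega) k
        _ ≤ 3 ^ 2 := Nat.pow_le_pow_right (by norm_num) hk2
      rw [← mul_add]
      exact Nat.mul_le_mul_left _ (by omega)

end RootOfUnity

/-! ### Quasi-linear multiplication routines -/

section Scaled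

open Polynomial

/-- The cost of a product of polynomials of degree at most `d`, up to a power of `q`. -/
def scaledCost (q d : ℕ) : ℕ :=
  1 + q ^ (Nat.clog q (2 * d + 1) + 1) * (200 * (Nat.clog q (2 * d + 1) - 1) ^ 3 + 18)
    + (2 * d + 1)

theorem coeff_geom_sum_mul {A : Type*} [CommRing A] {q h : ℕ} {K : A[X]} (hK : K.degree < h)
    {j i : ℕ} (hj : j < q) (hi : i < h) :
    ((∑ l ∈ Finset.range q, (X ^ h) ^ l) * K).coeff (h * j + i) = K.coeff i := by
  rw [Finset.sum_mul, finsetSum_coeff, Finset.sum_eq_single_of_mem j (Finset.mem_range.2 hj)]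
  · rw [← pow_mul, coeff_X_pow_mul', if_pos (by omega)]
    congr 1; omega
  · intro l _ hl
    rw [← pow_mul, coeff_X_pow_mul']
    split_ifs with hle
    · refine (degree_lt_iff_coeff_zero _ _).1 hK _ ?_
      have h1 : l < j := by
        by_contra hlt
        have : h * (j + 1) ≤ h * l := Nat.mul_le_mul_left _ (by omega)
        rw [mul_add, mul_one] at this
        omega
      have : h * (l + 1) ≤ h * j := Nat.mul_le_mul_left _ (by omega)
      rw [mul_add, mul_one] at this
      omega
    · rfl

/-- Fast multiplication up to a power of `q`: the product is computed modulo a cyclotomic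
polynomial of sufficiently high degree. -/
theorem exists_scaled_product {q : ℕ} (hq : q = 2 ∨ q = 3) (d : ℕ) :
    ∃ e : ℕ, ∀ (A : Type) [CommRing A] [Nontrivial A] (E : Set A) (f g : A[X]),
      f.natDegree ≤ d → g.natDegree ≤ d → (∀ i, i ≤ d → f.coeff i ∈ E) →
        (∀ i, i ≤ d → g.coeff i ∈ E) → ∃ F, Reach (scaledCost q d) E F ∧
          ∀ k < 2 * d + 1, (q : A) ^ e * (f * g).coeff k ∈ F := by
  have hq1 : 1 < q := by omega
  have hq0 : 0 < q := by omega
  set l := Nat.clog q (2 * d + 1) with hl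
  obtain ⟨e, he⟩ := exists_mul_rootOfUnity.{0, 0} hq (l + 1) (by omega)
  refine ⟨e, fun A _ _ E f g hf hg hfE hgE => ?_⟩
  set h := q ^ l with hh
  have hdh : 2 * d + 1 ≤ h := Nat.le_pow_clog hq1 _
  have hh0 : 0 < h := by omega
  set N := q ^ (l + 1)
  have hN : N = q * h := (pow_succ q l).trans (mul_comm _ _)
  set Φ : A[X] := ∑ i ∈ Finset.range q, (X ^ h) ^ i with hΦ
  have hΦm : Φ.Monic := (monic_X_pow h).geom_sum (by simpa using hh0) (by omega)
  have hΦd : Φ.natDegree = (q - 1) * h := by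
    have h1 := congrArg natDegree (geom_sum_mul (X ^ h : A[X]) q)
    rw [← hΦ, hΦm.natDegree_mul (by simpa using monic_X_pow_sub_C (1 : A) hh0.ne'), ← pow_mul,
      show (1 : A[X]) = C 1 by simp, natDegree_X_pow_sub_C, natDegree_X_pow_sub_C] at h1
    rw [Nat.sub_mul, one_mul, mul_comm q]
    omega
  have hroot : ∑ i ∈ Finset.range q, (AdjoinRoot.root Φ ^ q ^ (l + 1 - 1)) ^ i = 0 := by
    have h1 : aeval (AdjoinRoot.root Φ) (∑ i ∈ Finset.range q, (X ^ h : A[X]) ^ i) = 0 :=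
      (AdjoinRoot.aeval_eq Φ).trans AdjoinRoot.mk_self
    rw [Nat.add_sub_cancel, ← hh]
    simpa using h1
  have hz : OneStep E (0 : A) := .inl ⟨0, by simp⟩
  have hrep : ∀ {f : A[X]}, f.natDegree ≤ d → (∀ i, i ≤ d → f.coeff i ∈ E) →
      Rep (insert 0 E) (powFamily (AdjoinRoot.root Φ) N)
        (aeval (AdjoinRoot.root Φ) f) := by
    intro f hf hfE
    refine ⟨fun i => f.coeff i, fun i => ?_, ?_⟩
    · rcases Nat.lt_or_ge d i with hi | hi
      · exact .inl (coeff_eq_zero_of_natDegree_lt (hf.trans_lt hi))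
      · exact .inr (hfE _ hi)
    · have hdN : f.natDegree < N := by
        have : h ≤ q * h := Nat.le_mul_of_pos_left _ hq0
        omega
      rw [aeval_eq_sum_range' hdN, Finset.sum_range]
      rfl
  obtain ⟨F, hF, c, hc, hcf⟩ := he A (AdjoinRoot Φ) (AdjoinRoot.root Φ) hroot (insert 0 E) _ _
    (hrep hf hfE) (hrep hg hgE)
  set P : A[X] := ∑ i : Fin N, c i • X ^ (i : ℕ) with hP
  set R : A[X] := (q : A[X]) ^ e * (f * g) with hR
  have hRc : ∀ k, R.coeff k = (q : A) ^ e * (f * g).coeff k := fun k => by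
    rw [hR, ← Nat.cast_pow, ← nsmul_eq_mul, coeff_smul, nsmul_eq_mul, Nat.cast_pow]
  have hRd : ∀ k, 2 * d + 1 ≤ k → R.coeff k = 0 := fun k hk => by
    rw [hRc, coeff_eq_zero_of_natDegree_lt, mul_zero]
    exact (natDegree_mul_le_of_le hf hg).trans_lt (by omega)
  have hdvd : Φ ∣ P - R := by
    rw [← AdjoinRoot.mk_eq_zero, map_sub, sub_eq_zero, ← AdjoinRoot.aeval_eq,
      ← AdjoinRoot.aeval_eq, hR, map_mul, map_mul, map_pow, map_natCast, hcf, hP, map_sum]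
    simp [powFamily]
  have hPc : ∀ (k : ℕ) (hk : k < N), P.coeff k = c ⟨k, hk⟩ := fun k hk => by
    rw [hP, finsetSum_coeff, Finset.sum_eq_single_of_mem ⟨k, hk⟩ (Finset.mem_univ _)]
    · simp
    · intro i _ hi
      have : k ≠ i := fun h => hi (Fin.ext h.symm)
      simp [coeff_X_pow, this]
  have hPd : ∀ k, N ≤ k → P.coeff k = 0 := fun k hk => by
    rw [hP, finsetSum_coeff]
    refine Finset.sum_eq_zero fun i _ => ?_
    have : k ≠ i := by have := i.2; omega
    simp [coeff_X_pow, this]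
  obtain ⟨K, hK⟩ := hdvd
  have hhN : (q - 1) * h + h = N := by
    rw [hN]; obtain ⟨p, rfl⟩ := Nat.exists_eq_succ_of_ne_zero hq0.ne'; simp; ring
  have hNR : 2 * d + 1 ≤ N := by omega
  have hKd : K.degree < h := by
    by_cases hK0 : K = 0
    · rw [hK0, degree_zero]; exact WithBot.bot_lt_coe _
    rw [← natDegree_lt_iff_degree_lt hK0]
    have h1 : (Φ * K).natDegree < N := by
      rw [natDegree_lt_iff_degree_lt (by rwa [Ne, hΦm.mul_right_eq_zero_iff]),
        degree_lt_iff_coeff_zero, ← hK]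
      intro k hk
      rw [coeff_sub, hPd k hk, hRd k (by omega), sub_zero]
    rw [hΦm.natDegree_mul' hK0, hΦd] at h1
    omega
  have hq2 : h ≤ (q - 1) * h := Nat.le_mul_of_pos_left _ (by omega)
  obtain ⟨G, hG, hs⟩ := Reach.family
    (Q := fun k G => ∀ hk : k < 2 * d + 1, (q : A) ^ e * (f * g).coeff k ∈ G)
    (fun i E F hEF h hk => hEF (h hk)) (2 * d + 1) (E := F) (c := 1) (by
      intro k hk E' hE
      refine ⟨_, .one (.inr ⟨_, hE (hc ⟨k, by omega⟩), _,
        hE (hc ⟨(q - 1) * h + k, by omega⟩), .inr (.inl rfl)⟩), fun _ => .inl ?_⟩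
      rw [← hPc, ← hPc, ← hRc]
      have h1 := congrArg (fun p => coeff p (h * 0 + k)) hK
      have h2 := congrArg (fun p => coeff p (h * (q - 1) + k)) hK
      beta_reduce at h1 h2
      rw [coeff_geom_sum_mul hKd hq0 (by omega), mul_zero, zero_add, coeff_sub] at h1
      rw [coeff_geom_sum_mul hKd (by omega) (by omega), mul_comm h, coeff_sub,
        hRd _ (by omega)] at h2
      linear_combination h2 - h1)
  exact ⟨G, (((Reach.one hz).trans hF).trans hG).mono (by simp [scaledCost, ← hl, N]),
    fun k hk => hs k hk hk⟩

/-- Combining a multiple by a power of `2` and a multiple by a power of `3`, which are coprime. -/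
theorem exists_product (d : ℕ) (A : Type) [CommRing A] [Nontrivial A] (E : Set A) (f g : A[X])
    (hf : f.natDegree ≤ d) (hg : g.natDegree ≤ d) (hfE : ∀ i, i ≤ d → f.coeff i ∈ E)
    (hgE : ∀ i, i ≤ d → g.coeff i ∈ E) :
    ∃ F, Reach (scaledCost 2 d + scaledCost 3 d + 2 + (2 * d + 1) * 3) E F ∧
      ∀ k < 2 * d + 1, (f * g).coeff k ∈ F := by
  obtain ⟨e, he⟩ := exists_scaled_product (.inl rfl) d
  obtain ⟨e', he'⟩ := exists_scaled_product (.inr rfl) d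
  obtain ⟨F, hF, h₂⟩ := he A E f g hf hg hfE hgE
  obtain ⟨G, hG, h₃⟩ := he' A F f g hf hg (fun i hi => hF.subset (hfE i hi))
    fun i hi => hF.subset (hgE i hi)
  obtain ⟨u, v, huv⟩ : IsCoprime ((2 : ℤ) ^ e) (3 ^ e') := IsCoprime.pow (by norm_num)
  have huv' : (u : A) * 2 ^ e + v * 3 ^ e' = 1 := by exact_mod_cast congrArg (Int.cast (R := A)) huv
  have hG₁ : Reach 1 G (insert (u : A) G) := .one (.inl ⟨u, rfl⟩)
  have hG₂ : Reach 1 (insert (u : A) G) (insert (v : A) (insert (u : A) G)) := .one (.inl ⟨v, rfl⟩)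
  obtain ⟨H, hH, hs⟩ := Reach.family
    (Q := fun k G => ∀ hk : k < 2 * d + 1, (f * g).coeff k ∈ G)
    (fun i E F hEF h hk => hEF (h hk)) (2 * d + 1) (E := insert (v : A) (insert (u : A) G))
    (c := 3) (by
      intro k hk E' hE
      have m2 : ((2 : ℕ) : A) ^ e * (f * g).coeff k ∈ E' :=
        hE (.inr (.inr (hG.subset (h₂ k hk))))
      have m3 : ((3 : ℕ) : A) ^ e' * (f * g).coeff k ∈ E' := hE (.inr (.inr (h₃ k hk)))
      have r1 := Reach.one (.inr ⟨_, hE (.inr (.inl rfl)), _, m2, .inr (.inr rfl)⟩)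
      have r2 := Reach.one (.inr ⟨_, r1.subset (hE (.inl rfl)), _, r1.subset m3, .inr (.inr rfl)⟩)
      have r3 := Reach.one (.inr ⟨_, r2.subset (.inl rfl), _, .inl rfl, .inl rfl⟩)
      refine ⟨_, (r1.trans r2).trans r3, fun _ => .inl ?_⟩
      push_cast
      linear_combination -(f * g).coeff k * huv')
  exact ⟨H, (((hF.trans hG).trans (hG₁.trans hG₂)).trans hH).mono (by omega),
    fun k hk => hs k hk hk⟩

theorem natDegree_sum_monomial_le {A : Type*} [CommRing A] {d : ℕ} (a : Fin (d + 1) → A) :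
    (∑ i : Fin (d + 1), monomial (i : ℕ) (a i)).natDegree ≤ d :=
  natDegree_sum_le_of_forall_le _ _ fun i _ =>
    (natDegree_monomial_le _).trans (by omega)

theorem coeff_sum_monomial {A : Type*} [CommRing A] {d : ℕ} (a : Fin (d + 1) → A) (i : ℕ) :
    (∑ i : Fin (d + 1), monomial (i : ℕ) (a i)).coeff i =
      if h : i < d + 1 then a ⟨i, h⟩ else 0 := by
  rw [finsetSum_coeff]
  split_ifs with h
  · rw [Finset.sum_eq_single_of_mem ⟨i, h⟩ (Finset.mem_univ _)]
    · simp
    · intro j _ hj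
      rw [coeff_monomial, if_neg fun hh => hj (Fin.ext hh)]
  · refine Finset.sum_eq_zero fun j _ => ?_
    rw [coeff_monomial, if_neg (by omega)]

/-- The program is constructed over the polynomial ring in the coefficients of both factors, where
it computes the coefficients of the product of generic polynomials. -/
theorem exists_mulRoutine : ∃ M : MulRoutine, MulRoutine.Correct.{u} M ∧
    ∀ d, (M d).size ≤ scaledCost 2 d + scaledCost 3 d + 2 + (2 * d + 1) * 3 := by
  have key : ∀ d : ℕ, ∃ p : SLP (2 * d + 1) ((d + 1) + (d + 1)),
      p.size ≤ scaledCost 2 d + scaledCost 3 d + 2 + (2 * d + 1) * 3 ∧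
        (p.call (MvPolynomial.X : _ → MvPolynomial (Fin ((d + 1) + (d + 1))) ℤ)).run = fun k =>
          ((∑ i : Fin (d + 1), monomial (i : ℕ) (MvPolynomial.X (Fin.castAdd (d + 1) i))) *
            ∑ i : Fin (d + 1), monomial (i : ℕ)
              (MvPolynomial.X (Fin.natAdd (d + 1) i) :
                MvPolynomial (Fin ((d + 1) + (d + 1))) ℤ)).coeff (k : ℕ) := by
    intro d
    obtain ⟨F, hF, h⟩ := exists_product d (MvPolynomial (Fin ((d + 1) + (d + 1))) ℤ)
      (Set.range MvPolynomial.X) _ _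
      (natDegree_sum_monomial_le fun i => MvPolynomial.X (Fin.castAdd (d + 1) i))
      (natDegree_sum_monomial_le fun i => MvPolynomial.X (Fin.natAdd (d + 1) i))
      (fun i hi => by rw [coeff_sum_monomial, dif_pos (by omega)]; exact ⟨_, rfl⟩)
      (fun i hi => by rw [coeff_sum_monomial, dif_pos (by omega)]; exact ⟨_, rfl⟩)
    exact hF.exists_slp _ (fun k => h k k.2) _ subset_rfl
  choose M hM hM' using key
  refine ⟨M, fun R _ d a b k => ?_, hM⟩
  let φ := MvPolynomial.eval₂Hom (Int.castRingHom R) (Fin.append a b)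
  have h1 : Fin.append a b = fun j => φ (MvPolynomial.X j) := by funext j; simp [φ]
  rw [h1, SLP.run_call_map, hM', ← coeff_map, Polynomial.map_mul, Polynomial.map_sum,
    Polynomial.map_sum]
  simp only [Polynomial.map_monomial, φ, MvPolynomial.coe_eval₂Hom, MvPolynomial.eval₂_X,
    Fin.append_left, Fin.append_right]

theorem scaledCost_le {q : ℕ} (hq : q = 2 ∨ q = 3) {d : ℕ} (hd : 2 ≤ d) :
    (scaledCost q d : ℝ) ≤ 1000000 * (d * Real.log d ^ 3) := by
  have hq1 : 1 < q := by omega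
  set l := Nat.clog q (2 * d + 1) with hl
  have hl1 : 1 ≤ l := Nat.clog_pos hq1 (by omega)
  have h1 : q ^ (l - 1) < 2 * d + 1 := Nat.pow_pred_clog_lt_self hq1 (by omega)
  have h2 : q ^ (l + 1) ≤ 9 * (2 * d + 1) := by
    rw [show l + 1 = (l - 1) + 2 by omega, pow_add, mul_comm]
    refine Nat.mul_le_mul ?_ h1.le
    rcases hq with rfl | rfl <;> norm_num
  have hlog2 : (0.69 : ℝ) < Real.log 2 := by have := Real.log_two_gt_d9; linarith
  have hlogd : Real.log 2 ≤ Real.log d := Real.log_le_log (by norm_num) (by exact_mod_cast hd)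
  have h3 : ((l - 1 : ℕ) : ℝ) ≤ 5 * Real.log d := by
    have h4 : 2 ^ (l - 1) ≤ d ^ 3 := by
      calc 2 ^ (l - 1) ≤ q ^ (l - 1) := Nat.pow_le_pow_left (by omega) _
        _ ≤ 2 * d := by omega
        _ ≤ d ^ 3 := by nlinarith [Nat.mul_le_mul hd hd]
    have h5 : ((l - 1 : ℕ) : ℝ) * Real.log 2 ≤ 3 * Real.log d := by
      have := Real.log_le_log (by positivity) (show ((2 : ℝ) ^ (l - 1)) ≤ (d : ℝ) ^ 3 by
        exact_mod_cast h4)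
      rw [Real.log_pow, Real.log_pow] at this
      exact_mod_cast this
    nlinarith [Nat.cast_nonneg (α := ℝ) (l - 1)]
  have h6 : ((l - 1 : ℕ) : ℝ) ^ 3 ≤ 125 * Real.log d ^ 3 := by
    calc ((l - 1 : ℕ) : ℝ) ^ 3 ≤ (5 * Real.log d) ^ 3 := by gcongr
      _ = _ := by ring
  have h7 : (1 : ℝ) ≤ 4 * Real.log d ^ 3 := by
    have : (0.69 : ℝ) ^ 3 ≤ Real.log d ^ 3 := by gcongr; linarith
    norm_num at this ⊢; linarith
  have hd' : (2 : ℝ) ≤ d := by exact_mod_cast hd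
  have h8 : ((q ^ (l + 1) : ℕ) : ℝ) ≤ 9 * (2 * d + 1) := by exact_mod_cast h2
  have : (scaledCost q d : ℝ) =
      1 + ((q ^ (l + 1) : ℕ) : ℝ) * (200 * ((l - 1 : ℕ) : ℝ) ^ 3 + 18) + (2 * d + 1) := by
    rw [scaledCost, ← hl]; push_cast; ring
  rw [this]
  have h9 : (200 * ((l - 1 : ℕ) : ℝ) ^ 3 + 18) ≤ 25072 * Real.log d ^ 3 := by linarith
  calc (1 : ℝ) + ((q ^ (l + 1) : ℕ) : ℝ) * (200 * ((l - 1 : ℕ) : ℝ) ^ 3 + 18) + (2 * d + 1)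
      ≤ 1 + (9 * (2 * d + 1)) * (25072 * Real.log d ^ 3) + (2 * d + 1) := by gcongr
    _ ≤ d * (4 * Real.log d ^ 3) + (9 * (3 * d)) * (25072 * Real.log d ^ 3)
        + 3 * d * (4 * Real.log d ^ 3) := by
      have h10 : (0 : ℝ) ≤ 25072 * Real.log d ^ 3 := by linarith
      have : (9 * (2 * (d : ℝ) + 1)) * (25072 * Real.log d ^ 3) ≤
          (9 * (3 * d)) * (25072 * Real.log d ^ 3) :=
        mul_le_mul_of_nonneg_right (by linarith) h10
      nlinarith
    _ ≤ _ := by nlinarith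

theorem exists_quasiLinear_mulRoutine :
    ∃ M : MulRoutine, MulRoutine.Correct.{u} M ∧ M.QuasiLinear := by
  obtain ⟨M, hM, hs⟩ := exists_mulRoutine.{u}
  refine ⟨M, hM, 2000100, 3, by norm_num, by norm_num, fun d hd => ?_⟩
  have h1 := scaledCost_le (.inl rfl) hd
  have h2 := scaledCost_le (.inr rfl) hd
  have h3 : ((M d).size : ℝ) ≤ scaledCost 2 d + scaledCost 3 d + 2 + (2 * d + 1) * 3 := by
    exact_mod_cast hs d
  have hlog2 : (0.69 : ℝ) < Real.log 2 := by have := Real.log_two_gt_d9; linarith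
  have hlogd : Real.log 2 ≤ Real.log d := Real.log_le_log (by norm_num) (by exact_mod_cast hd)
  have h7 : (1 : ℝ) ≤ 4 * Real.log d ^ 3 := by
    have : (0.69 : ℝ) ^ 3 ≤ Real.log d ^ 3 := by gcongr; linarith
    norm_num at this ⊢; linarith
  have hd' : (2 : ℝ) ≤ d := by exact_mod_cast hd
  rw [show (3 : ℝ) = ((3 : ℕ) : ℝ) by norm_num, Real.rpow_natCast]
  nlinarith

end Scaled

/-! ### Results of the generic programs -/

section Run

universe v

variable {R : Type u} [CommRing R] {α β : Type u}

namespace Prog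

@[simp] theorem run_pure (a : α) : (pure a : Prog R α).run = a := rfl

@[simp] theorem run_bind (p : Prog R α) (f : α → Prog R β) : (p >>= f).run = (f p.run).run := by
  change (p.bind f).run = _
  induction p with
  | ret a => rfl
  | const c k ih => exact ih _
  | add x y k ih => exact ih _
  | sub x y k ih => exact ih _
  | mul x y k ih => exact ih _

end Prog

@[simp] theorem run_tab {m : ℕ} (f : Fin m → Prog R α) : (tab f).run = fun i => (f i).run := by
  induction m with
  | zero => exact funext fun i => i.elim0
  | succ m ih =>
    simp only [tab, Prog.run_bind, Prog.run_pure, ih]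
    funext i
    refine Fin.cases ?_ (fun i => ?_) i <;> simp

theorem run_iterates (f : α → Prog R α) (a : α) {m k : ℕ} (hk : k ≤ m) :
    (iterates f a m).run k = (fun x => (f x).run)^[k] a := by
  induction m generalizing k with
  | zero =>
    obtain rfl : k = 0 := by omega
    rfl
  | succ m ih =>
    simp only [iterates, Prog.run_bind, Prog.run_pure]
    rcases Nat.lt_succ_iff_lt_or_eq.mp (Nat.lt_succ_of_le hk) with h | rfl
    · rw [Function.update_of_ne (by omega), ih (by omega)]
    · rw [Function.update_self, ih le_rfl, Function.iterate_succ_apply']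

/-- The derivative of the `r`-th power of `M` in the direction `X`. -/
def powDeriv {Q : Type*} [CommRing Q] {n : ℕ} (M : Matrix (Fin n) (Fin n) Q) (r : ℕ)
    (X : Matrix (Fin n) (Fin n) Q) : Matrix (Fin n) (Fin n) Q :=
  ∑ k ∈ Finset.range r, M ^ (r - 1 - k) * X * M ^ k

theorem powDeriv_two_mul {Q : Type*} [CommRing Q] {n : ℕ} (M : Matrix (Fin n) (Fin n) Q) (m : ℕ)
    (X : Matrix (Fin n) (Fin n) Q) :
    powDeriv M (m + m) X = powDeriv M m (M ^ m * X + X * M ^ m) := by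
  simp only [powDeriv]
  rw [Finset.sum_range_add, ← Finset.sum_add_distrib]
  refine Finset.sum_congr rfl fun k hk => ?_
  rw [Finset.mem_range] at hk
  rw [mul_add, add_mul, show m + m - 1 - k = m - 1 - k + m by omega,
    show m + m - 1 - (m + k) = m - 1 - k by omega, pow_add, pow_add]
  simp only [mul_assoc]

theorem powDeriv_succ {Q : Type*} [CommRing Q] {n : ℕ} (M : Matrix (Fin n) (Fin n) Q) (m : ℕ)
    (X : Matrix (Fin n) (Fin n) Q) :
    powDeriv M (m + 1) X = powDeriv M m (M * X) + X * M ^ m := by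
  simp only [powDeriv]
  rw [Finset.sum_range_succ]
  congr 1
  · refine Finset.sum_congr rfl fun k hk => ?_
    rw [Finset.mem_range] at hk
    rw [show m + 1 - 1 - k = m - 1 - k + 1 by omega, pow_succ]
    simp only [mul_assoc]
  · simp

namespace Arith

variable {S : Type u} {Q : Type v} [CommRing Q]

/-- The programs `K` carry out the arithmetic of the ring `Q`, whose elements are represented
through the map `τ`. -/
structure Models (K : Arith R S) (τ : Q → S) : Prop where
  zero : K.zero.run = τ 0
  one : K.one.run = τ 1
  add (a b : Q) : (K.add (τ a) (τ b)).run = τ (a + b)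
  sub (a b : Q) : (K.sub (τ a) (τ b)).run = τ (a - b)
  mul (a b : Q) : (K.mul (τ a) (τ b)).run = τ (a * b)

variable {K : Arith R S} {τ : Q → S}

namespace Models

theorem sum (h : K.Models τ) {m : ℕ} (f : Fin m → Q) :
    (K.sum fun i => τ (f i)).run = τ (∑ i, f i) := by
  induction m with
  | zero => simpa [Arith.sum] using h.zero
  | succ m ih =>
    simp only [Arith.sum, Prog.run_bind, Fin.sum_univ_castSucc]
    rw [ih fun i => f i.castSucc, h.add]

theorem dot (h : K.Models τ) {m : ℕ} (x y : Fin m → Q) :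
    (K.dot (fun i => τ (x i)) fun i => τ (y i)).run = τ (∑ i, x i * y i) := by
  simp only [Arith.dot, Prog.run_bind, run_tab, h.mul]
  exact h.sum _

theorem vecAdd (h : K.Models τ) {m : ℕ} (x y : Fin m → Q) :
    (K.vecAdd (fun i => τ (x i)) fun i => τ (y i)).run = fun i => τ ((x + y) i) := by
  simp only [Arith.vecAdd, run_tab, h.add, Pi.add_apply]

theorem vecMul (h : K.Models τ) {a b : ℕ} (x : Fin a → Q) (M : Matrix (Fin a) (Fin b) Q) :
    (K.vecMul (fun i => τ (x i)) fun i j => τ (M i j)).run =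
      fun j => τ (Matrix.vecMul x M j) := by
  simp only [Arith.vecMul, run_tab]
  exact funext fun j => h.dot x fun i => M i j

theorem mulVec (h : K.Models τ) {a b : ℕ} (M : Matrix (Fin a) (Fin b) Q) (x : Fin b → Q) :
    (K.mulVec (fun i j => τ (M i j)) fun i => τ (x i)).run =
      fun i => τ (Matrix.mulVec M x i) := by
  simp only [Arith.mulVec, run_tab]
  exact funext fun i => h.dot (M i) x

theorem outer (h : K.Models τ) {a b : ℕ} (x : Fin a → Q) (y : Fin b → Q) :
    (K.outer (fun i => τ (x i)) fun j => τ (y j)).run =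
      fun i j => τ (Matrix.vecMulVec x y i j) := by
  simp only [Arith.outer, run_tab, h.mul, Matrix.vecMulVec_apply]

theorem matAdd (h : K.Models τ) {a b : ℕ} (M N : Matrix (Fin a) (Fin b) Q) :
    (K.matAdd (fun i j => τ (M i j)) fun i j => τ (N i j)).run =
      fun i j => τ ((M + N) i j) := by
  simp only [Arith.matAdd, run_tab, Matrix.add_apply]
  exact funext fun i => h.vecAdd (M i) (N i)

theorem matMul (h : K.Models τ) {a b c : ℕ} (M : Matrix (Fin a) (Fin b) Q)
    (N : Matrix (Fin b) (Fin c) Q) :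
    (K.matMul (fun i j => τ (M i j)) fun i j => τ (N i j)).run =
      fun i j => τ ((M * N) i j) := by
  simp only [Arith.matMul, run_tab, Matrix.mul_apply_eq_vecMul]
  exact funext fun i => h.vecMul (M i) N

theorem matZero (h : K.Models τ) (a b : ℕ) :
    (K.matZero a b).run = fun i j => τ ((0 : Matrix (Fin a) (Fin b) Q) i j) := by
  simp only [Arith.matZero, run_tab, h.zero, Matrix.zero_apply]

theorem matOne (h : K.Models τ) (a : ℕ) :
    (K.matOne a).run = fun i j => τ ((1 : Matrix (Fin a) (Fin a) Q) i j) := by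
  simp only [Arith.matOne, run_tab]
  funext i j
  split_ifs with hij
  · rw [hij, Matrix.one_apply_eq, h.one]
  · rw [Matrix.one_apply_ne hij, h.zero]

variable {n : ℕ}

/-- The table of repeated squaring holds correct powers at the indices that halving reaches. -/
theorem matPowers (h : K.Models τ) (M : Matrix (Fin n) (Fin n) Q) (r k : ℕ) :
    (K.matPowers (fun i j => τ (M i j)) r).run (r / 2 ^ k) =
      fun i j => τ ((M ^ (r / 2 ^ k)) i j) := by
  induction r using Nat.strong_induction_on generalizing k with
  | _ r ih =>
    rw [Arith.matPowers]
    split_ifs with hr h2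
    · subst hr
      simp only [Prog.run_bind, Prog.run_pure, h.matOne, Nat.zero_div, pow_zero]
    all_goals
      have hlt : r / 2 < r := by omega
      have h0 := ih (r / 2) hlt 0
      rw [pow_zero, Nat.div_one] at h0
      simp only [Prog.run_bind, h0, h.matMul]
      have key : ∀ P : Fin n → Fin n → S, (P = fun i j => τ ((M ^ r) i j)) →
          Function.update (K.matPowers (fun i j => τ (M i j)) (r / 2)).run r P (r / 2 ^ k) =
            fun i j => τ ((M ^ (r / 2 ^ k)) i j) := by
        rintro P rfl
        rcases k with _ | k
        · simp
        · have hdiv : r / 2 ^ (k + 1) = r / 2 / 2 ^ k := by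
            rw [pow_succ', Nat.div_div_eq_div_mul]
          have : r / 2 / 2 ^ k ≤ r / 2 := Nat.div_le_self _ _
          rw [hdiv, Function.update_of_ne (by omega), ih _ hlt]
    · simp only [Prog.run_pure]
      refine key _ ?_
      rw [← pow_add, show r / 2 + r / 2 = r by omega]
    · simp only [Prog.run_pure]
      refine key _ ?_
      rw [← pow_add, ← pow_succ, show r / 2 + r / 2 + 1 = r by omega]

end Models

theorem Models.matPowersDiff (h : K.Models τ) {n : ℕ} (M : Matrix (Fin n) (Fin n) Q)
    (T : ℕ → Fin n → Fin n → S) (r : ℕ)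
    (hT : ∀ k, T (r / 2 ^ k) = fun i j => τ ((M ^ (r / 2 ^ k)) i j))
    (X : Matrix (Fin n) (Fin n) Q) :
    (K.matPowersDiff (fun i j => τ (M i j)) T r fun i j => τ (X i j)).run =
      fun i j => τ (powDeriv M r X i j) := by
  induction r using Nat.strong_induction_on generalizing X with
  | _ r ih =>
    rw [Arith.matPowersDiff]
    split_ifs with hr h2
    · subst hr
      simp only [h.matZero, powDeriv, Finset.range_zero, Finset.sum_empty]
    all_goals
      have hT1 := hT 1
      rw [pow_one] at hT1
      have hT' : ∀ k, T (r / 2 / 2 ^ k) = fun i j => τ ((M ^ (r / 2 / 2 ^ k)) i j) := fun k => by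
        have := hT (k + 1)
        rwa [pow_succ', ← Nat.div_div_eq_div_mul] at this
    · simp only [Prog.run_bind, hT1, h.matMul, h.matAdd]
      rw [ih (r / 2) (by omega) hT', ← powDeriv_two_mul, show r / 2 + r / 2 = r by omega]
    · simp only [Prog.run_bind, hT1, h.matMul, h.matAdd]
      rw [ih (r / 2) (by omega) hT', ← powDeriv_two_mul, h.matAdd, ← pow_add, add_comm (X * _),
        ← powDeriv_succ, show r / 2 + r / 2 + 1 = r by omega]

end Arith
end Run

/-! ### Truncated power series -/

section Jets

open PowerSeries

variable {R : Type u} [CommRing R]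

/-- The coefficients of a power series up to degree `d`. -/
noncomputable def jet (d : ℕ) (p : R⟦X⟧) : Ser R d := fun k => coeff k p

@[simp] theorem jet_apply (d : ℕ) (p : R⟦X⟧) (k : Fin (d + 1)) : jet d p k = coeff k p := rfl

theorem jet_congr {d : ℕ} {p q : R⟦X⟧} (h : X ^ (d + 1) ∣ p - q) : jet d p = jet d q := by
  funext k
  rw [X_pow_dvd_iff] at h
  simpa [sub_eq_zero] using h k k.2

@[simp] theorem run_lit (c : ℤ) : (lit c : Prog R R).run = c := rfl

theorem run_serC (d : ℕ) (c : R) : (serC d c).run = jet d (C c) := by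
  simp only [serC, Prog.run_bind, Prog.run_pure, run_lit, Int.cast_zero]
  funext k
  refine Fin.cases ?_ (fun k => ?_) k <;> simp [coeff_C]

theorem run_serLit (d : ℕ) (c : ℤ) : (serLit d c : Prog R _).run = jet d (c : R⟦X⟧) := by
  simp only [serLit, Prog.run_bind, run_serC, run_lit]
  congr 1
  simp

/-- The programs for truncated power series carry out the arithmetic of power series. -/
theorem ser_models {M : MulRoutine} (hM : MulRoutine.Correct.{u} M) (d : ℕ) :
    (ser M d : Arith R (Ser R d)).Models (jet d) where
  zero := by simpa [ser] using run_serLit (R := R) d 0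
  one := by simpa [ser] using run_serLit (R := R) d 1
  add a b := by
    simp only [ser, run_tab]
    funext k
    simp [Prog.run]
  sub a b := by
    simp only [ser, run_tab]
    funext k
    simp [Prog.run]
  mul a b := by
    simp only [ser, Prog.run_bind, Prog.run_pure]
    funext k
    rw [hM, jet_apply, PowerSeries.coeff_mul, Polynomial.coeff_mul]
    refine Finset.sum_congr rfl fun p hp => ?_
    have := Finset.HasAntidiagonal.mem_antidiagonal.1 hp
    have := k.2
    rw [coeff_sum_monomial, coeff_sum_monomial, dif_pos (by omega), dif_pos (by omega)]
    rfl

theorem run_serScale {d : ℕ} (c : ℤ) (p : R⟦X⟧) :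
    (serScale c (jet d p)).run = jet d ((c : R⟦X⟧) * p) := by
  simp only [serScale, Prog.run_bind, run_tab, run_lit, Prog.run]
  funext k
  rw [← map_intCast (C (R := R)), jet_apply, jet_apply, coeff_C_mul]

theorem run_serResize {d e : ℕ} {p : R⟦X⟧} (h : e ≤ d ∨ ∀ k, d < k → coeff k p = 0) :
    (serResize e (jet d p)).run = jet e p := by
  simp only [serResize, Prog.run_bind, Prog.run_pure, run_lit]
  funext k
  simp only [get, jet_apply, Int.cast_zero]
  split_ifs with hk
  · rfl
  · rcases h with h | h
    · have := k.2; omega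
    · exact (h _ (by omega)).symm

theorem run_matResize {d e a b : ℕ} {P : Matrix (Fin a) (Fin b) R⟦X⟧}
    (h : e ≤ d ∨ ∀ i j k, d < k → coeff k (P i j) = 0) :
    (matResize e fun i j => jet d (P i j)).run = fun i j => jet e (P i j) := by
  simp only [matResize, run_tab]
  funext i j
  exact run_serResize (h.imp_right fun h => h i j)

@[simp] theorem run_cellSum {m : ℕ} (f : Fin m → R) : (cellSum f).run = ∑ i, f i := by
  induction m with
  | zero => simp [cellSum]
  | succ m ih => simp [cellSum, ih, Prog.run, Fin.sum_univ_castSucc]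

theorem run_matEvalOne {d a b : ℕ} (P : Fin a → Fin b → Ser R d) :
    (matEvalOne P).run = fun i j => ∑ k, P i j k := by
  simp only [matEvalOne, run_tab, run_cellSum]

/-! ### Inversion -/

/-- A power series has a constant coefficient that is its own inverse. -/
def InvConst (p : R⟦X⟧) : Prop := constantCoeff p * constantCoeff p = 1

theorem InvConst.isUnit {p : R⟦X⟧} (h : InvConst p) : IsUnit p :=
  isUnit_iff_constantCoeff.2 (IsUnit.of_mul_eq_one _ h)

theorem InvConst.mul_inverse {p : R⟦X⟧} (h : InvConst p) : p * Ring.inverse p = 1 :=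
  Ring.mul_inverse_cancel _ h.isUnit

theorem InvConst.constantCoeff_inverse {p : R⟦X⟧} (h : InvConst p) :
    constantCoeff (Ring.inverse p) = constantCoeff p := by
  have h1 := congrArg constantCoeff h.mul_inverse
  rw [map_mul, map_one] at h1
  unfold InvConst at h
  linear_combination constantCoeff p * h1 - constantCoeff (Ring.inverse p) * h

/-- The error `1 - p * b` of Newton's iteration is squared in each step. -/
theorem run_serInv {M : MulRoutine} (hM : MulRoutine.Correct.{u} M) {d : ℕ} {p : R⟦X⟧}
    (h : InvConst p) : (serInv M (jet d p)).run = jet d (Ring.inverse p) := by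
  have hm := ser_models (R := R) hM d
  simp only [serInv, Prog.run_bind, Prog.run_pure]
  rw [run_iterates _ _ le_rfl, run_serLit, run_serC]
  have key : ∀ k : ℕ, ∃ b : R⟦X⟧, 1 - p * b = (1 - p * C (constantCoeff p)) ^ 2 ^ k ∧
      (fun b => ((do
        let p ← (ser M d).mul (jet d p) b
        let e ← (ser M d).sub (jet d ((2 : ℤ) : R⟦X⟧)) p
        (ser M d).mul b e) : Prog R _).run)^[k] (jet d (C (jet d p 0))) = jet d b := by
    intro k
    induction k with
    | zero => exact ⟨C (constantCoeff p), by simp, by simp⟩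
    | succ k ih =>
      obtain ⟨b, hb, hr⟩ := ih
      refine ⟨b * (2 - p * b), ?_, ?_⟩
      · rw [pow_succ 2, pow_mul, ← hb]; ring
      · rw [Function.iterate_succ_apply', hr]
        simp only [Prog.run_bind, hm.mul, hm.sub]
        norm_num
  obtain ⟨b, hb, hr⟩ := key (Nat.clog 2 (d + 1))
  refine Eq.trans hr ?_
  refine jet_congr ?_
  have h1 : b - Ring.inverse p = -Ring.inverse p * (1 - p * b) := by
    linear_combination -b * h.mul_inverse
  rw [h1, hb]
  refine Dvd.dvd.mul_left ?_ _
  refine (pow_dvd_pow _ (Nat.le_pow_clog (by norm_num) (d + 1))).trans (pow_dvd_pow_of_dvd ?_ _)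
  rw [X_dvd_iff, map_sub, map_mul, constantCoeff_C, map_one, h, sub_self]

/-! ### Kaltofen's pencil -/

/-- The matrix `Z = C + z (A - C)` with polynomial entries. -/
noncomputable def polyPencil {n : ℕ} (A : Matrix (Fin n) (Fin n) R) :
    Matrix (Fin n) (Fin n) (Polynomial R) :=
  fun i j => Polynomial.C ((kaltofenC n i j : ℤ) : R) +
    Polynomial.C (A i j - (kaltofenC n i j : ℤ)) * Polynomial.X

/-- The matrix `Z = C + z (A - C)` with power series entries. -/
noncomputable def serPencil {n : ℕ} (A : Matrix (Fin n) (Fin n) R) :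
    Matrix (Fin n) (Fin n) R⟦X⟧ :=
  (polyPencil A).map (Polynomial.coeToPowerSeries.ringHom (R := R))

theorem run_pencil (d : ℕ) {n : ℕ} (A : Matrix (Fin n) (Fin n) R) :
    (pencil d A).run = fun i j => jet d (serPencil A i j) := by
  simp only [pencil, Prog.run_bind, Prog.run_pure, run_tab, run_lit, Prog.run]
  funext i j k
  simp only [serPencil, polyPencil, jet_apply, Matrix.map_apply,
    Polynomial.coeToPowerSeries.ringHom_apply, Polynomial.coeff_coe, Polynomial.coeff_add,
    Polynomial.coeff_C, Polynomial.coeff_C_mul_X, Int.cast_zero]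
  split_ifs with h0 h1 <;> first | omega | simp

end Jets

/-! ### Hankel matrices and their inverses -/

section Hankel

open Polynomial Matrix

variable {Q : Type*} [CommRing Q] {n : ℕ} {h : ℕ → Q}

/-- The linear functional on polynomials with the moments `h 0, h 1, …`. -/
noncomputable def moment (h : ℕ → Q) : Q[X] →ₗ[Q] Q :=
  lsum fun k => LinearMap.toSpanSingleton Q Q (h k)

theorem moment_monomial (h : ℕ → Q) (k : ℕ) (a : Q) : moment h (monomial k a) = a * h k := by
  simp [moment, lsum_apply]

theorem moment_X_pow (h : ℕ → Q) (k : ℕ) : moment h (X ^ k) = h k := by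
  rw [← monomial_one_right_eq_X_pow, moment_monomial, one_mul]

theorem moment_C_mul (h : ℕ → Q) (a : Q) (p : Q[X]) : moment h (C a * p) = a * moment h p := by
  rw [← smul_eq_C_mul, map_smul, smul_eq_mul]

theorem moment_eq_sum (h : ℕ → Q) {p : Q[X]} {m : ℕ} (hp : p.degree < m) :
    moment h p = ∑ i : Fin m, p.coeff i * h i := by
  rcases Nat.eq_zero_or_pos m with rfl | hm
  · have : p = 0 := by
      rw [← degree_eq_bot]
      exact Nat.WithBot.lt_zero_iff.1 (by exact_mod_cast hp)
    simp [this]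
  have hpn : p.natDegree < m := by
    rcases eq_or_ne p 0 with rfl | h0
    · simpa using hm
    · exact (natDegree_lt_iff_degree_lt h0).2 hp
  conv_lhs => rw [p.as_sum_range' m hpn]
  rw [map_sum, Finset.sum_range]
  simp [moment_monomial]

theorem moment_X_mul (h : ℕ → Q) (p : Q[X]) :
    moment h (X * p) = moment (fun k => h (k + 1)) p := by
  induction p using Polynomial.induction_on' with
  | add p q hp hq => rw [mul_add, map_add, map_add, hp, hq]
  | monomial k a => rw [X_mul_monomial, moment_monomial, moment_monomial]

/-- The Hankel matrix of a sequence. -/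
def hankel (n : ℕ) (h : ℕ → Q) : Matrix (Fin n) (Fin n) Q := of fun i j => h (i + j)

/-- The polynomials `f` and `g` describe the inverse of the Hankel matrix of `h`: the monic
polynomial `f` of degree `n` is orthogonal to all polynomials of lower degree, and the
coefficients of `g` form the last column of the inverse. -/
structure HankelPair (n : ℕ) (h : ℕ → Q) (f g : Q[X]) : Prop where
  monic : f.Monic
  natDegree : f.natDegree = n
  degree_lt : g.degree < n
  moment_f : ∀ i < n, moment h (X ^ i * f) = 0
  moment_g : ∀ i < n, moment h (X ^ i * g) = if i + 1 = n then 1 else 0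

/-- The polynomial with given coefficients. -/
noncomputable def vecPoly (v : Fin n → Q) : Q[X] := ∑ i : Fin n, monomial (i : ℕ) (v i)

theorem coeff_vecPoly (v : Fin n → Q) (i : ℕ) :
    (vecPoly v).coeff i = if hi : i < n then v ⟨i, hi⟩ else 0 := by
  rw [vecPoly, finsetSum_coeff]
  split_ifs with hi
  · rw [Finset.sum_eq_single_of_mem ⟨i, hi⟩ (Finset.mem_univ _)]
    · simp
    · intro j _ hj
      rw [coeff_monomial, if_neg fun hh => hj (Fin.ext hh)]
  · refine Finset.sum_eq_zero fun j _ => ?_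
    rw [coeff_monomial, if_neg (by omega)]

theorem degree_vecPoly_lt (v : Fin n → Q) : (vecPoly v).degree < n :=
  (degree_lt_iff_coeff_zero _ _).2 fun i hi => by rw [coeff_vecPoly, dif_neg (by omega)]

theorem hankel_mulVec (v : Fin n → Q) (i : Fin n) :
    (hankel n h *ᵥ v) i = moment h (X ^ (i : ℕ) * vecPoly v) := by
  rw [vecPoly, Finset.mul_sum, map_sum, mulVec, dotProduct]
  refine Finset.sum_congr rfl fun j _ => ?_
  rw [X_pow_mul_monomial, moment_monomial, hankel, of_apply, mul_comm, add_comm]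

theorem vecPoly_coeff {p : Q[X]} (hp : p.degree < n) :
    vecPoly (fun i : Fin n => p.coeff i) = p := by
  ext i
  rw [coeff_vecPoly]
  split_ifs with hi
  · rfl
  · exact ((degree_lt_iff_coeff_zero _ _).1 hp i (by omega)).symm

omit [CommRing Q] in
theorem hankel_transpose : (hankel n h)ᵀ = hankel n h := by
  ext i j; simp [hankel, add_comm]

namespace HankelPair

variable {f g : Q[X]} (hp : HankelPair n h f g)

include hp

theorem coeff_self : f.coeff n = 1 := by
  have := hp.monic.coeff_natDegree; rwa [hp.natDegree] at this

theorem coeff_of_lt {i : ℕ} (hi : n < i) : f.coeff i = 0 :=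
  coeff_eq_zero_of_natDegree_lt (by rwa [hp.natDegree])

/-- Multiplication by `X` shifts the moments; this turns the last column of the inverse into all
of its columns. -/
theorem isUnit : IsUnit (hankel n h) := by
  have key : ∀ m < n, ∃ q : Q[X], q.degree < n ∧
      ∀ i < n, moment h (X ^ i * q) = if i = n - 1 - m then 1 else 0 := by
    intro m
    induction m with
    | zero =>
      intro hm
      refine ⟨g, hp.degree_lt, fun i hi => ?_⟩
      rw [hp.moment_g i hi]
      exact if_congr (by omega) rfl rfl
    | succ m ih =>
      intro hm
      obtain ⟨q, hq, hqm⟩ := ih (by omega)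
      set q' := X * q - C (q.coeff (n - 1)) * f with hq'
      have hmom : ∀ i < n, moment h (X ^ i * q') = moment h (X ^ (i + 1) * q) := fun i hi => by
        rw [hq', mul_sub, map_sub, mul_left_comm _ (C _), moment_C_mul, hp.moment_f i hi, mul_zero,
          sub_zero, pow_succ, mul_assoc]
      have hdeg : q'.degree < n := by
        rw [degree_lt_iff_coeff_zero] at hq ⊢
        intro i hi
        obtain ⟨i, rfl⟩ : ∃ k, i = k + 1 := ⟨i - 1, by omega⟩
        rw [hq', coeff_sub, coeff_X_mul, coeff_C_mul]
        rcases hi.eq_or_lt with hi | hi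
        · rw [← hi, hp.coeff_self, show n - 1 = i by omega, mul_one, sub_self]
        · rw [hq i (by omega), hp.coeff_of_lt hi, mul_zero, sub_zero]
      refine ⟨q' - C (moment h (X ^ (n - 1) * q')) * g, ?_, fun i hi => ?_⟩
      · rw [← mem_degreeLT] at hdeg ⊢
        refine Submodule.sub_mem _ hdeg ?_
        rw [← smul_eq_C_mul]
        exact Submodule.smul_mem _ _ (mem_degreeLT.2 hp.degree_lt)
      · rw [mul_sub, map_sub, mul_left_comm, moment_C_mul, hp.moment_g i hi]
        split_ifs with h1 h2 h2
        · omega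
        · rw [show n - 1 = i by omega, mul_one, sub_self]
        · rw [hmom i hi, hqm _ (by omega), if_pos (by omega), mul_zero, sub_zero]
        · rw [hmom i hi, hqm _ (by omega), if_neg (by omega), mul_zero, sub_zero]
  rw [← mulVec_surjective_iff_isUnit]
  choose! q hq hqm using key
  intro v
  refine ⟨∑ j : Fin n, v j • fun i : Fin n => (q (n - 1 - j)).coeff i, funext fun i => ?_⟩
  rw [mulVec_sum, Finset.sum_apply]
  have : ∀ j : Fin n, (hankel n h *ᵥ (v j • fun i : Fin n => (q (n - 1 - j)).coeff i)) i =
      v j * if i = j then 1 else 0 := fun j => by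
    have := j.2
    rw [mulVec_smul, Pi.smul_apply, hankel_mulVec, vecPoly_coeff (hq _ (by omega)),
      hqm _ (by omega) i i.2, smul_eq_mul]
    congr 1
    exact if_congr (by rw [Fin.ext_iff]; omega) rfl rfl
  simp [this]

/-- A polynomial of degree less than `n` is determined by its first `n` moments, because the Hankel
matrix is invertible. -/
theorem eq_of_moment {p q : Q[X]} (hpd : p.degree < n) (hqd : q.degree < n)
    (hpq : ∀ i < n, moment h (X ^ i * p) = moment h (X ^ i * q)) : p = q := by
  have h1 : (fun i : Fin n => p.coeff i) = fun i : Fin n => q.coeff i := by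
    refine mulVec_injective_of_isUnit hp.isUnit (funext fun i => ?_)
    rw [hankel_mulVec, hankel_mulVec, vecPoly_coeff hpd, vecPoly_coeff hqd, hpq i i.2]
  rw [← vecPoly_coeff hpd, ← vecPoly_coeff hqd, h1]

end HankelPair

/-- The polynomial whose coefficients are the sums of the anti-diagonals of a matrix. -/
noncomputable def antiPoly (N : Matrix (Fin n) (Fin n) Q) : Q[X] :=
  ∑ i : Fin n, ∑ j : Fin n, monomial (i + j : ℕ) (N i j)

theorem moment_antiPoly (N : Matrix (Fin n) (Fin n) Q) (h : ℕ → Q) :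
    moment h (antiPoly N) = ∑ i : Fin n, ∑ j : Fin n, N i j * h (i + j) := by
  simp [antiPoly, moment_monomial]

theorem degree_antiPoly_lt (N : Matrix (Fin n) (Fin n) Q) :
    (antiPoly N).degree < (2 * n - 1 : ℕ) := by
  rw [← mem_degreeLT]
  refine Submodule.sum_mem _ fun i _ => Submodule.sum_mem _ fun j _ => ?_
  rw [mem_degreeLT]
  exact (degree_monomial_le _ _).trans_lt (by exact_mod_cast (by omega))

namespace HankelPair

variable {f g : Q[X]} (hp : HankelPair n h f g)

include hp

/-- The columns `β j` of the inverse, as polynomials, satisfy a two-term recurrence: `X * β j` and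
`β (j - 1)` differ by multiples of `f` and `g`. -/
theorem displacement {N : Matrix (Fin n) (Fin n) Q} (hN : hankel n h * N = 1) (β : ℕ → Q[X])
    (hβ : ∀ j, β j = if hj : j < n then vecPoly fun i => N i ⟨j, hj⟩ else 0) (j : ℕ) (hj : j ≤ n) :
    X * β j - C (g.coeff j) * f = (if j = 0 then 0 else β (j - 1)) - C (f.coeff j) * g := by
  have hβd : ∀ j, (β j).degree < n := fun j => by
    rw [hβ]
    split_ifs
    · exact degree_vecPoly_lt _
    · rw [degree_zero]; exact WithBot.bot_lt_coe _
  have hβm : ∀ j < n, ∀ i < n, moment h (X ^ i * β j) = if i = j then 1 else 0 := by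
    intro j hj i hi
    have := congrFun (congrFun hN ⟨i, hi⟩) ⟨j, hj⟩
    rw [hβ, dif_pos hj, ← hankel_mulVec _ ⟨i, hi⟩]
    rw [one_apply] at this
    exact this.trans (if_congr Fin.ext_iff rfl rfl)
  have hNsymm : Nᵀ = N := by
    have h1 : Nᵀ * hankel n h = 1 := by
      have := congrArg transpose hN
      rwa [transpose_mul, hankel_transpose, transpose_one] at this
    calc Nᵀ = Nᵀ * (hankel n h * N) := by rw [hN, mul_one]
      _ = N := by rw [← mul_assoc, h1, one_mul]
  have hcn := hp.coeff_self
  have hgd := hp.degree_lt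
  have htop : ∀ j < n, (β j).coeff (n - 1) = g.coeff j := by
    intro j hj
    have h1 : g = β (n - 1) := hp.eq_of_moment hgd (hβd _) fun i hi => by
      rw [hp.moment_g i hi, hβm _ (by omega) i hi]
      exact if_congr (by omega) rfl rfl
    rw [h1, hβ, hβ, dif_pos hj, dif_pos (by omega), coeff_vecPoly, coeff_vecPoly,
      dif_pos hj, dif_pos (by omega)]
    exact congrFun (congrFun hNsymm ⟨j, hj⟩) ⟨n - 1, by omega⟩
  rcases hj.eq_or_lt with rfl | hj
  · have h1 : g.coeff j = 0 := (degree_lt_iff_coeff_zero _ _).1 hgd _ le_rfl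
    rw [h1, hβ, dif_neg (lt_irrefl _), hcn]
    simp only [mul_zero, map_zero, zero_mul, sub_zero, map_one, one_mul]
    split_ifs with h0
    · subst h0
      have : g = 0 := by
        rw [← degree_eq_bot]
        exact Nat.WithBot.lt_zero_iff.1 (by exact_mod_cast hgd)
      rw [this, sub_zero]
    · symm
      rw [sub_eq_zero]
      refine hp.eq_of_moment (hβd _) hgd fun i hi => ?_
      rw [hp.moment_g i hi, hβm _ (by omega) i hi]
      exact if_congr (by omega) rfl rfl
  · refine hp.eq_of_moment ?_ ?_ fun i hi => ?_
    · have h1 := (degree_lt_iff_coeff_zero _ _).1 (hβd j)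
      rw [degree_lt_iff_coeff_zero]
      intro i hi
      obtain ⟨i, rfl⟩ : ∃ k, i = k + 1 := ⟨i - 1, by omega⟩
      rw [coeff_sub, coeff_X_mul, coeff_C_mul]
      rcases hi.eq_or_lt with hi | hi
      · rw [← hi, hcn, ← htop j hj, show n - 1 = i by omega, mul_one, sub_self]
      · rw [h1 i (by omega), hp.coeff_of_lt hi, mul_zero, sub_zero]
    · rw [← mem_degreeLT]
      refine Submodule.sub_mem _ ?_ ?_
      · split_ifs
        · exact Submodule.zero_mem _
        · exact mem_degreeLT.2 (hβd _)
      · rw [← smul_eq_C_mul]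
        exact Submodule.smul_mem _ _ (mem_degreeLT.2 hgd)
    · have hR : moment h (X ^ i * if j = 0 then 0 else β (j - 1)) =
          if i + 1 = j then 1 else 0 := by
        split_ifs with h1 h2 h2
        · omega
        · simp
        · rw [hβm _ (by omega) i hi, if_pos (by omega)]
        · rw [hβm _ (by omega) i hi, if_neg (by omega)]
      rw [mul_sub, mul_sub, map_sub, map_sub, hR, mul_left_comm _ (C _), mul_left_comm _ (C _),
        moment_C_mul, moment_C_mul, hp.moment_f i hi, hp.moment_g i hi, mul_zero, sub_zero,
        ← mul_assoc, ← pow_succ]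
      split_ifs with h1 h2 h2
      · omega
      · rw [hβm _ hj _ (by omega), if_pos h1]; simp
      · -- the power `X ^ n` is `f` minus terms of lower degree
        have hXn : (X : Q[X]) ^ (i + 1) = f - vecPoly fun l : Fin n => f.coeff l := by
          ext k
          rw [coeff_X_pow, coeff_sub, coeff_vecPoly, h2]
          split_ifs with h3 h4 h4
          · omega
          · rw [h3, hcn, sub_zero]
          · rw [sub_self]
          · rw [coeff_eq_zero_of_natDegree_lt (by rw [hp.natDegree]; omega), sub_zero]
        have hf0 : moment h (f * β j) = 0 := by
          rw [hβ, dif_pos hj, vecPoly, Finset.mul_sum, map_sum]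
          refine Finset.sum_eq_zero fun k _ => ?_
          rw [← C_mul_X_pow_eq_monomial, mul_left_comm, moment_C_mul, mul_comm f,
            hp.moment_f k k.2, mul_zero]
        have hv : moment h ((vecPoly fun l : Fin n => f.coeff l) * β j) = f.coeff j := by
          rw [vecPoly, Finset.sum_mul, map_sum]
          have : ∀ l : Fin n, moment h (monomial (l : ℕ) (f.coeff l) * β j) =
              f.coeff l * if l = ⟨j, hj⟩ then 1 else 0 := fun l => by
            rw [← C_mul_X_pow_eq_monomial, mul_assoc, moment_C_mul, hβm j hj l l.2]
            congr 1
            exact if_congr (by rw [Fin.ext_iff]) rfl rfl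
          simp [this]
        rw [hXn, sub_mul, map_sub, hf0, hv]
        simp
      · rw [hβm _ hj _ (by omega), if_neg h1]; simp

/-- The anti-diagonal sums of the inverse of a Hankel matrix: the inverse is the Bezoutian
`(f(x) g(y) - g(x) f(y)) / (x - y)`, which becomes `f' g - g' f` for `y = x`. -/
theorem antiPoly_eq {N : Matrix (Fin n) (Fin n) Q} (hN : hankel n h * N = 1) :
    antiPoly N = derivative f * g - derivative g * f := by
  obtain ⟨β, hβ⟩ : ∃ β : ℕ → Q[X], ∀ j, β j =
      if hj : j < n then vecPoly fun i => N i ⟨j, hj⟩ else 0 := ⟨_, fun _ => rfl⟩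
  have hd := hp.displacement hN β hβ
  have h1 : antiPoly N = ∑ j ∈ Finset.range n, X ^ j * β j := by
    rw [antiPoly, Finset.sum_comm, Finset.sum_range]
    refine Finset.sum_congr rfl fun j _ => ?_
    rw [hβ, dif_pos j.2, vecPoly, Finset.mul_sum]
    refine Finset.sum_congr rfl fun i _ => ?_
    rw [X_pow_mul_monomial]
  have hder : ∀ p : Q[X], p.natDegree ≤ n → derivative p =
      ∑ j ∈ Finset.range n, (j + 1 : Q[X]) * X ^ j * C (p.coeff (j + 1)) := by
    intro p hpn
    conv_lhs => rw [p.as_sum_range' (n + 1) (by omega)]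
    rw [derivative_sum, Finset.sum_range_succ']
    simp only [derivative_monomial, Nat.add_sub_cancel]
    simp only [Nat.cast_zero, mul_zero, map_zero, add_zero]
    refine Finset.sum_congr rfl fun j _ => ?_
    rw [← C_mul_X_pow_eq_monomial, C_mul]
    simp only [map_natCast]
    push_cast
    ring
  have hgn : g.natDegree ≤ n := natDegree_le_of_degree_le hp.degree_lt.le
  rw [h1, hder f hp.natDegree.le, hder g hgn, Finset.sum_mul, Finset.sum_mul,
    ← Finset.sum_sub_distrib]
  have h2 : ∀ j ∈ Finset.range n,
      ((j : Q[X]) + 1) * X ^ j * C (f.coeff (j + 1)) * g -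
          ((j : Q[X]) + 1) * X ^ j * C (g.coeff (j + 1)) * f =
        ((j : Q[X]) + 1) * (X ^ j * β j) - ((j : Q[X]) + 1) * (X ^ (j + 1) * β (j + 1)) := by
    intro j hj
    have := hd (j + 1) (by have := Finset.mem_range.1 hj; omega)
    rw [if_neg (by omega), Nat.add_sub_cancel] at this
    linear_combination (((j : Q[X]) + 1) * X ^ j) * this
  rw [Finset.sum_congr rfl h2]
  have hn0 : β n = 0 := by rw [hβ, dif_neg (lt_irrefl _)]
  have h3 : ∀ m : ℕ, ∑ j ∈ Finset.range m,
      (((j : Q[X]) + 1) * (X ^ j * β j) - ((j : Q[X]) + 1) * (X ^ (j + 1) * β (j + 1))) =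
        (∑ j ∈ Finset.range m, X ^ j * β j) - (m : Q[X]) * (X ^ m * β m) := by
    intro m
    induction m with
    | zero => simp
    | succ m ih => rw [Finset.sum_range_succ, Finset.sum_range_succ, ih]; push_cast; ring
  rw [h3, hn0]
  simp

/-- The pair for the shifted Hankel matrix. -/
theorem shift {c : Q} (hc : g.coeff 0 = c * f.coeff 0) (hn : moment h (X ^ n * f) = 0) :
    HankelPair n (fun k => h (k + 1)) f (divX (g - C c * f)) where
  monic := hp.monic
  natDegree := hp.natDegree
  degree_lt := by
    rw [degree_lt_iff_coeff_zero]
    intro i hi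
    rw [coeff_divX, coeff_sub, coeff_C_mul,
      (degree_lt_iff_coeff_zero _ _).1 hp.degree_lt _ (by omega),
      coeff_eq_zero_of_natDegree_lt (by rw [hp.natDegree]; omega), mul_zero, sub_zero]
  moment_f i hi := by
    rw [← moment_X_mul, ← mul_assoc, ← pow_succ']
    rcases (show i + 1 ≤ n by omega).eq_or_lt with h1 | h1
    · rw [h1, hn]
    · exact hp.moment_f _ h1
  moment_g i hi := by
    have h1 : X * divX (g - C c * f) = g - C c * f := by
      have := divX_mul_X_add (g - C c * f)
      rw [coeff_sub, coeff_C_mul, hc, sub_self, map_zero, add_zero] at this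
      rw [mul_comm, this]
    rw [← moment_X_mul, mul_left_comm, h1, mul_sub, map_sub, mul_left_comm, moment_C_mul,
      hp.moment_f i hi, hp.moment_g i hi, mul_zero, sub_zero]

end HankelPair

end Hankel

/-! ### The derivative of the determinant -/

section Adjoint

open Matrix

variable {Q : Type*} [CommRing Q] {n : ℕ}

theorem powDeriv_zero (M X : Matrix (Fin n) (Fin n) Q) : powDeriv M 0 X = 0 := by
  simp [powDeriv]

theorem powDeriv_one (M X : Matrix (Fin n) (Fin n) Q) : powDeriv M 1 X = X := by
  simp [powDeriv]

/-- The product rule for `M ^ (a + b) = M ^ a * M ^ b`. -/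
theorem powDeriv_add_exp (M : Matrix (Fin n) (Fin n) Q) (a b : ℕ) (X : Matrix (Fin n) (Fin n) Q) :
    powDeriv M (a + b) X = M ^ a * powDeriv M b X + powDeriv M a X * M ^ b := by
  simp only [powDeriv]
  rw [add_comm a b, Finset.sum_range_add, Finset.mul_sum, Finset.sum_mul]
  congr 1
  · refine Finset.sum_congr rfl fun k hk => ?_
    rw [Finset.mem_range] at hk
    rw [show b + a - 1 - k = a + (b - 1 - k) by omega, pow_add]
    simp only [mul_assoc]
  · refine Finset.sum_congr rfl fun k _ => ?_
    rw [show b + a - 1 - (b + k) = a - 1 - k by omega, add_comm b, pow_add]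
    simp only [mul_assoc]

theorem powDeriv_add (M : Matrix (Fin n) (Fin n) Q) (r : ℕ) (X Y : Matrix (Fin n) (Fin n) Q) :
    powDeriv M r (X + Y) = powDeriv M r X + powDeriv M r Y := by
  simp only [powDeriv, mul_add, add_mul, Finset.sum_add_distrib]

theorem powDeriv_smul (M : Matrix (Fin n) (Fin n) Q) (r : ℕ) (c : Q)
    (X : Matrix (Fin n) (Fin n) Q) : powDeriv M r (c • X) = c • powDeriv M r X := by
  simp only [powDeriv, Finset.smul_sum, mul_smul_comm, smul_mul_assoc]

theorem powDeriv_sum (M : Matrix (Fin n) (Fin n) Q) (r : ℕ) {ι : Type*} (s : Finset ι)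
    (X : ι → Matrix (Fin n) (Fin n) Q) :
    powDeriv M r (∑ i ∈ s, X i) = ∑ i ∈ s, powDeriv M r (X i) := by
  simp only [powDeriv, Finset.mul_sum, Finset.sum_mul]
  exact Finset.sum_comm

theorem powDeriv_mul_right {M N : Matrix (Fin n) (Fin n) Q} (h : Commute M N) (r : ℕ)
    (X : Matrix (Fin n) (Fin n) Q) : powDeriv M r (X * N) = powDeriv M r X * N := by
  simp only [powDeriv, Finset.sum_mul]
  refine Finset.sum_congr rfl fun k _ => ?_
  have := (h.pow_left k).eq
  simp only [mul_assoc, this]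

theorem powDeriv_mul_left {M N : Matrix (Fin n) (Fin n) Q} (h : Commute M N) (r : ℕ)
    (X : Matrix (Fin n) (Fin n) Q) : powDeriv M r (N * X) = N * powDeriv M r X := by
  simp only [powDeriv, Finset.mul_sum]
  refine Finset.sum_congr rfl fun k _ => ?_
  have := (h.pow_left (r - 1 - k)).eq
  simp only [← mul_assoc, this]

/-- The chain rule for `M ^ (r * t) = (M ^ r) ^ t`. -/
theorem powDeriv_mul_exp (M : Matrix (Fin n) (Fin n) Q) (r t : ℕ) (X : Matrix (Fin n) (Fin n) Q) :
    powDeriv M (r * t) X = powDeriv M r (powDeriv (M ^ r) t X) := by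
  induction t with
  | zero => simp [powDeriv]
  | succ t ih =>
    rw [mul_add, mul_one, add_comm, powDeriv_add_exp, add_comm t, powDeriv_add_exp, powDeriv_add,
      ih, powDeriv_one, pow_one, powDeriv_mul_left (Commute.self_pow M r), pow_mul,
      powDeriv_mul_right ((Commute.self_pow M r).pow_right t)]

/-- `powDeriv M r` is its own adjoint with respect to the trace form. -/
theorem trace_powDeriv_mul (M X W : Matrix (Fin n) (Fin n) Q) (r : ℕ) :
    trace (powDeriv M r X * W) = trace (X * powDeriv M r W) := by
  simp only [powDeriv, Finset.sum_mul, Finset.mul_sum, trace_sum]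
  rw [← Finset.sum_range_reflect]
  refine Finset.sum_congr rfl fun k hk => ?_
  rw [Finset.mem_range] at hk
  rw [show r - 1 - (r - 1 - k) = k by omega, mul_assoc, mul_assoc, trace_mul_comm]
  simp only [mul_assoc]

/-- The moments `φ Z ^ k ψ`. -/
def krylov (Z : Matrix (Fin n) (Fin n) Q) (φ ψ : Fin n → Q) (k : ℕ) : Q := φ ⬝ᵥ (Z ^ k *ᵥ ψ)

theorem trace_powDeriv_vecMulVec (Z W : Matrix (Fin n) (Fin n) Q) (φ ψ : Fin n → Q) (k : ℕ) :
    trace (powDeriv Z k (vecMulVec ψ φ) * W) = φ ⬝ᵥ (powDeriv Z k W *ᵥ ψ) := by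
  rw [trace_powDeriv_mul, vecMulVec_mul, trace_vecMulVec, dotProduct_mulVec, dotProduct_comm]

variable {Z : Matrix (Fin n) (Fin n) Q} {φ ψ : Fin n → Q}

theorem moment_krylov (p : Polynomial Q) :
    moment (krylov Z φ ψ) p = φ ⬝ᵥ (Polynomial.aeval Z p *ᵥ ψ) := by
  induction p using Polynomial.induction_on' with
  | add p q hp hq => rw [map_add, hp, hq, map_add, add_mulVec, dotProduct_add]
  | monomial k a =>
    rw [moment_monomial, Polynomial.aeval_monomial, ← Algebra.smul_def, smul_mulVec,
      dotProduct_smul, smul_eq_mul, krylov]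

variable {f g : Polynomial Q} (hp : HankelPair n (krylov Z φ ψ) f g)

include hp

/-- The minimum polynomial of the moments is the characteristic polynomial. -/
theorem HankelPair.eq_charpoly : f = Z.charpoly := by
  nontriviality Q
  have h1 : f - Z.charpoly = 0 := hp.eq_of_moment (by
      have hd : f.degree = n := by
        rw [Polynomial.degree_eq_natDegree hp.monic.ne_zero, hp.natDegree]
      refine (Polynomial.degree_sub_lt_left ?_ hp.monic.ne_zero ?_).trans_eq hd
      · rw [hd, charpoly_degree_eq_dim, Fintype.card_fin]
      · rw [hp.monic.leadingCoeff, Z.charpoly_monic.leadingCoeff])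
    (by rw [Polynomial.degree_zero]; exact WithBot.bot_lt_coe _) fun i hi => by
      rw [mul_sub, map_sub, hp.moment_f i hi, moment_krylov, map_mul, aeval_self_charpoly]
      simp
  exact sub_eq_zero.1 h1

theorem HankelPair.moment_f_all (p : Polynomial Q) : moment (krylov Z φ ψ) (p * f) = 0 := by
  rw [hp.eq_charpoly, moment_krylov, map_mul, aeval_self_charpoly]
  simp

theorem HankelPair.det_eq : Z.det = (-1) ^ n * f.coeff 0 := by
  rw [hp.eq_charpoly, det_eq_sign_charpoly_coeff, Fintype.card_fin]

/-- The derivative of `det Z = det H_A / det H`, where `H` and `H_A` are the Hankel matrices of the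
moments and of the shifted moments. With the matrices `L` and `K` of the vectors `φ Z ^ i` and
`Z ^ j ψ`, these are `L * K` and `L * Z * K`, and the logarithmic derivatives of `L` and `K`
cancel. -/
theorem HankelPair.adjugate_eq (hZ : IsUnit Z.det) {N N' : Matrix (Fin n) (Fin n) Q}
    (hN : hankel n (krylov Z φ ψ) * N = 1)
    (hN' : hankel n (fun k => krylov Z φ ψ (k + 1)) * N' = 1) :
    Z.adjugate = ∑ k ∈ Finset.range (2 * n),
      (((if k = 0 then 0 else (antiPoly N').coeff (k - 1)) - (antiPoly N).coeff k) * Z.det) •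
        powDeriv Z k (vecMulVec ψ φ) := by
  set L : Matrix (Fin n) (Fin n) Q := of fun i => φ ᵥ* Z ^ (i : ℕ) with hL
  set K : Matrix (Fin n) (Fin n) Q := of fun i j => (Z ^ (j : ℕ) *ᵥ ψ) i with hK
  have hmul : ∀ (V : Matrix (Fin n) (Fin n) Q) (i j : Fin n),
      (L * V * K) i j = φ ⬝ᵥ ((Z ^ (i : ℕ) * V * Z ^ (j : ℕ)) *ᵥ ψ) := by
    intro V i j
    rw [mul_assoc (Z ^ (i : ℕ)), ← mulVec_mulVec, dotProduct_mulVec, mul_assoc,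
      mul_apply_eq_vecMul, ← vecMul_vecMul]
    simp only [← mulVec_mulVec]
    rw [dotProduct_mulVec]
    rfl
  have hH : hankel n (krylov Z φ ψ) = L * K := by
    ext i j
    have := hmul 1 i j
    rw [mul_one, mul_one, ← pow_add] at this
    rw [this]; rfl
  have hH' : hankel n (fun k => krylov Z φ ψ (k + 1)) = L * Z * K := by
    ext i j
    rw [hmul, ← pow_succ, ← pow_add, show (i : ℕ) + 1 + j = i + j + 1 by ring]
    rfl
  -- the inverses of `L`, `Z` and `K`
  have hdet : IsUnit (L.det * K.det) := by
    rw [← det_mul, ← hH, ← isUnit_iff_isUnit_det]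
    exact hp.isUnit
  have hLu : IsUnit L.det := isUnit_of_mul_isUnit_left hdet
  have hKu : IsUnit K.det := isUnit_of_mul_isUnit_right hdet
  have hNe : N = K⁻¹ * L⁻¹ := by
    rw [← Matrix.mul_inv_rev, ← hH]
    exact (inv_eq_right_inv hN).symm
  have hNe' : N' = K⁻¹ * Z⁻¹ * L⁻¹ := by
    rw [mul_assoc, ← Matrix.mul_inv_rev, ← Matrix.mul_inv_rev, ← hH']
    exact (inv_eq_right_inv hN').symm
  rw [ext_iff_trace_mul_right]
  intro W
  -- the derivatives in the direction `W`
  set D : ℕ → Q := fun k => φ ⬝ᵥ (powDeriv Z k W *ᵥ ψ) with hD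
  set DL : Matrix (Fin n) (Fin n) Q := of fun i => φ ᵥ* powDeriv Z (i : ℕ) W with hDL
  set DK : Matrix (Fin n) (Fin n) Q := of fun i j => (powDeriv Z (j : ℕ) W *ᵥ ψ) i with hDK
  have hLDK : ∀ (V : Matrix (Fin n) (Fin n) Q) (i j : Fin n),
      (L * V * DK) i j = φ ⬝ᵥ ((Z ^ (i : ℕ) * V * powDeriv Z (j : ℕ) W) *ᵥ ψ) := by
    intro V i j
    rw [mul_assoc (Z ^ (i : ℕ)), ← mulVec_mulVec, dotProduct_mulVec, mul_assoc,
      mul_apply_eq_vecMul, ← vecMul_vecMul]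
    simp only [← mulVec_mulVec]
    rw [dotProduct_mulVec]
    rfl
  have hDLK : ∀ (V : Matrix (Fin n) (Fin n) Q) (i j : Fin n),
      (DL * V * K) i j = φ ⬝ᵥ ((powDeriv Z (i : ℕ) W * V * Z ^ (j : ℕ)) *ᵥ ψ) := by
    intro V i j
    rw [mul_assoc (powDeriv Z (i : ℕ) W), ← mulVec_mulVec, dotProduct_mulVec, mul_assoc,
      mul_apply_eq_vecMul, ← vecMul_vecMul]
    simp only [← mulVec_mulVec]
    rw [dotProduct_mulVec]
    rfl
  have hDH : hankel n D = L * DK + DL * K := by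
    ext i j
    have h1 := hLDK 1 i j
    have h2 := hDLK 1 i j
    rw [mul_one, mul_one] at h1 h2
    rw [Matrix.add_apply, h1, h2, ← dotProduct_add, ← add_mulVec, ← powDeriv_add_exp]
    rfl
  have hDH' : hankel n (fun k => D (k + 1)) = L * Z * DK + L * W * K + DL * Z * K := by
    ext i j
    rw [Matrix.add_apply, Matrix.add_apply, hLDK, hmul, hDLK, ← dotProduct_add,
      ← dotProduct_add, ← add_mulVec, ← add_mulVec]
    have : powDeriv Z ((i : ℕ) + j + 1) W = Z ^ (i : ℕ) * Z * powDeriv Z (j : ℕ) W +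
        Z ^ (i : ℕ) * W * Z ^ (j : ℕ) + powDeriv Z (i : ℕ) W * Z * Z ^ (j : ℕ) := by
      rw [show (i : ℕ) + j + 1 = i + (1 + j) by ring, powDeriv_add_exp, powDeriv_add_exp,
        powDeriv_one, pow_add, pow_one, mul_add]
      simp only [mul_assoc]
    rw [← this]; rfl
  have htr : ∀ (N : Matrix (Fin n) (Fin n) Q) (d : ℕ → Q),
      moment d (antiPoly N) = trace (N * hankel n d) := by
    intro N d
    rw [moment_antiPoly, trace]
    refine Finset.sum_congr rfl fun i _ => ?_
    rw [diag_apply, mul_apply]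
    refine Finset.sum_congr rfl fun j _ => ?_
    rw [hankel, of_apply, add_comm (j : ℕ)]
  have key : trace (N' * hankel n (fun k => D (k + 1))) - trace (N * hankel n D) =
      trace (Z⁻¹ * W) := by
    have hLi := nonsing_inv_mul _ hLu
    have hKi := mul_nonsing_inv _ hKu
    have hZi := nonsing_inv_mul _ hZ
    have hZi' := mul_nonsing_inv _ hZ
    rw [hDH, hDH', hNe, hNe']
    simp only [mul_add, trace_add]
    have e1 : K⁻¹ * Z⁻¹ * L⁻¹ * (L * Z * DK) = K⁻¹ * DK := by
      calc K⁻¹ * Z⁻¹ * L⁻¹ * (L * Z * DK) = K⁻¹ * (Z⁻¹ * ((L⁻¹ * L) * Z)) * DK := by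
            simp only [mul_assoc]
        _ = _ := by rw [hLi, one_mul, hZi, mul_one]
    have e2 : trace (K⁻¹ * Z⁻¹ * L⁻¹ * (L * W * K)) = trace (Z⁻¹ * W) := by
      calc trace (K⁻¹ * Z⁻¹ * L⁻¹ * (L * W * K))
          = trace (K⁻¹ * (Z⁻¹ * ((L⁻¹ * L) * W) * K)) := by simp only [mul_assoc]
        _ = trace (Z⁻¹ * W * (K * K⁻¹)) := by
            rw [hLi, one_mul, trace_mul_comm]; simp only [mul_assoc]
        _ = _ := by rw [hKi, mul_one]
    have e3 : trace (K⁻¹ * Z⁻¹ * L⁻¹ * (DL * Z * K)) = trace (L⁻¹ * DL) := by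
      calc trace (K⁻¹ * Z⁻¹ * L⁻¹ * (DL * Z * K))
          = trace (K⁻¹ * (Z⁻¹ * (L⁻¹ * DL * Z * K))) := by simp only [mul_assoc]
        _ = trace (Z⁻¹ * (L⁻¹ * DL * Z * (K * K⁻¹))) := by
            rw [trace_mul_comm]; simp only [mul_assoc]
        _ = trace (L⁻¹ * DL * (Z * Z⁻¹)) := by
            rw [hKi, mul_one, trace_mul_comm]; simp only [mul_assoc]
        _ = _ := by rw [hZi', mul_one]
    have e4 : K⁻¹ * L⁻¹ * (L * DK) = K⁻¹ * DK := by
      calc K⁻¹ * L⁻¹ * (L * DK) = K⁻¹ * ((L⁻¹ * L) * DK) := by simp only [mul_assoc]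
        _ = _ := by rw [hLi, one_mul]
    have e5 : trace (K⁻¹ * L⁻¹ * (DL * K)) = trace (L⁻¹ * DL) := by
      calc trace (K⁻¹ * L⁻¹ * (DL * K)) = trace (K⁻¹ * (L⁻¹ * DL * K)) := by
            simp only [mul_assoc]
        _ = trace (L⁻¹ * DL * (K * K⁻¹)) := by rw [trace_mul_comm]; simp only [mul_assoc]
        _ = _ := by rw [hKi, mul_one]
    rw [e1, e2, e3, e4, e5]
    ring
  have hadj : Z.adjugate = Z.det • Z⁻¹ := by
    rw [inv_def, smul_smul, Ring.mul_inverse_cancel _ hZ, one_smul]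
  rw [hadj, smul_mul, trace_smul, ← key, ← htr, ← htr, Finset.sum_mul, trace_sum]
  simp only [smul_mul, trace_smul, trace_powDeriv_vecMulVec, smul_eq_mul]
  have hsum : ∀ (N : Matrix (Fin n) (Fin n) Q) (d : ℕ → Q) (m : ℕ), 2 * n - 1 ≤ m →
      moment d (antiPoly N) = ∑ k ∈ Finset.range m, (antiPoly N).coeff k * d k := by
    intro N d m hm
    rw [Finset.sum_range]
    exact moment_eq_sum d ((degree_antiPoly_lt N).trans_le (by exact_mod_cast hm))
  rw [hsum N D (2 * n) (by omega), hsum N' _ (2 * n - 1) le_rfl]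
  rcases Nat.eq_zero_or_pos n with hn | hn
  · subst hn; simp
  obtain ⟨m, hm⟩ : ∃ m, 2 * n = m + 1 := ⟨2 * n - 1, by omega⟩
  rw [hm, Nat.add_sub_cancel, Finset.sum_range_succ', Finset.sum_range_succ']
  simp only [if_true, Nat.succ_ne_zero, if_false, Nat.add_sub_cancel, hD]
  rw [mul_sub, mul_add, Finset.mul_sum, Finset.mul_sum, sub_add_eq_sub_sub,
    ← Finset.sum_sub_distrib, zero_sub, sub_eq_add_neg]
  congr 1
  · exact Finset.sum_congr rfl fun k _ => by ring
  · ring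

end Adjoint

/-! ### Kaltofen's matrix -/

section Kaltofen

open Matrix

/-- The number of walks with `k` steps on the natural numbers from `0` to `i`, where a step moves
up or down by one, or stays at `0`. -/
def ballot (i k : ℕ) : ℕ := if i ≤ k then k.choose ((k - i) / 2) else 0

theorem ballot_zero (k : ℕ) : ballot 0 k = k.choose (k / 2) := by simp [ballot]

theorem ballot_self (k : ℕ) : ballot k k = 1 := by simp [ballot]

theorem ballot_of_lt {i k : ℕ} (h : k < i) : ballot i k = 0 := if_neg (by omega)

theorem ballot_succ_self (k : ℕ) : ballot k (k + 1) = 1 := by simp [ballot]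

theorem ballot_succ_succ (i k : ℕ) : ballot (i + 1) (k + 1) = ballot i k + ballot (i + 2) k := by
  unfold ballot
  by_cases h : i ≤ k
  · rw [if_pos h, if_pos (by omega), Nat.add_sub_add_right]
    split_ifs with h2
    · rw [show (k - i) / 2 = (k - (i + 2)) / 2 + 1 by omega, Nat.choose_succ_succ, add_comm]
    · rw [show (k - i) / 2 = 0 by omega]; simp
  · rw [if_neg h, if_neg (by omega), if_neg (by omega)]

theorem ballot_zero_succ (k : ℕ) : ballot 0 (k + 1) = ballot 0 k + ballot 1 k := by
  rw [ballot_zero, ballot_zero]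
  rcases Nat.even_or_odd' k with ⟨m, rfl | rfl⟩
  · rcases m with _ | m
    · simp [ballot]
    · rw [ballot, if_pos (by omega), show (2 * (m + 1) + 1) / 2 = m + 1 by omega,
        show 2 * (m + 1) / 2 = m + 1 by omega, show (2 * (m + 1) - 1) / 2 = m by omega,
        Nat.choose_succ_succ, add_comm]
  · rw [ballot, if_pos (by omega), show (2 * m + 1 + 1) / 2 = m + 1 by omega,
      show (2 * m + 1) / 2 = m by omega, show (2 * m + 1 - 1) / 2 = m by omega,
      Nat.choose_succ_succ, Nat.choose_symm_half]

/-- The orthogonal polynomials for the moments `k.choose (k / 2)`. -/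
noncomputable def kaltofenPoly : ℕ → Polynomial ℤ
  | 0 => 1
  | 1 => Polynomial.X - 1
  | n + 2 => Polynomial.X * kaltofenPoly (n + 1) - kaltofenPoly n

/-- The moments of the orthogonal polynomials are the ballot numbers; they vanish for `k < i`. -/
theorem moment_kaltofenPoly (i k : ℕ) :
    moment (fun k => (ballot 0 k : ℤ)) (Polynomial.X ^ k * kaltofenPoly i) = ballot i k := by
  induction i using Nat.twoStepInduction generalizing k with
  | zero => rw [kaltofenPoly, mul_one, moment_X_pow]
  | one =>
    rw [kaltofenPoly, mul_sub, ← pow_succ, mul_one, map_sub, moment_X_pow, moment_X_pow,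
      ballot_zero_succ]
    push_cast; ring
  | more i ih₁ ih₂ =>
    rw [kaltofenPoly, mul_sub, ← mul_assoc, ← pow_succ, map_sub, ih₁, ih₂, ballot_succ_succ]
    push_cast; ring

theorem coeff_kaltofenPoly (n j : ℕ) : (kaltofenPoly n).coeff j =
    if j ≤ n then (-1) ^ ((n - j + 1) / 2) * (((n + j) / 2).choose j : ℤ) else 0 := by
  induction n using Nat.twoStepInduction generalizing j with
  | zero =>
    rw [kaltofenPoly, Polynomial.coeff_one]
    rcases j with _ | j <;> simp
  | one =>
    rw [kaltofenPoly, Polynomial.coeff_sub, Polynomial.coeff_X, Polynomial.coeff_one]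
    rcases j with _ | _ | j <;> simp
  | more n ih₁ ih₂ =>
    rw [kaltofenPoly, Polynomial.coeff_sub, ih₁]
    rcases j with _ | j
    · rw [Polynomial.coeff_X_mul_zero, if_pos (by omega), if_pos (by omega),
        show (n + 2 - 0 + 1) / 2 = (n - 0 + 1) / 2 + 1 by omega, pow_succ]
      simp
    · rw [Polynomial.coeff_X_mul, ih₂]
      rcases Nat.lt_or_ge n (j + 1) with h | h
      · rw [if_neg (show ¬ j + 1 ≤ n by omega)]
        split_ifs with h1 h2 h2
        · rcases (show j = n ∨ j = n + 1 by omega) with rfl | rfl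
          · rw [show (j + 2 - (j + 1) + 1) / 2 = 1 by omega, show (j + 1 - j + 1) / 2 = 1 by omega,
              show (j + 2 + (j + 1)) / 2 = j + 1 by omega, show (j + 1 + j) / 2 = j by omega]
            simp
          · rw [show (n + 2 - (n + 1 + 1) + 1) / 2 = 0 by omega,
              show (n + 1 - (n + 1) + 1) / 2 = 0 by omega,
              show (n + 2 + (n + 1 + 1)) / 2 = n + 2 by omega,
              show (n + 1 + (n + 1)) / 2 = n + 1 by omega]
            simp
        · omega
        · omega
        · simp
      · rw [if_pos h, if_pos (by omega), if_pos (by omega),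
          show (n + 2 + (j + 1)) / 2 = (n + (j + 1)) / 2 + 1 by omega, Nat.choose_succ_succ,
          show (n + 2 - (j + 1) + 1) / 2 = (n - (j + 1) + 1) / 2 + 1 by omega,
          show (n + 1 - j + 1) / 2 = (n - (j + 1) + 1) / 2 + 1 by omega,
          show (n + 1 + j) / 2 = (n + (j + 1)) / 2 by omega, pow_succ]
        push_cast; ring

theorem natDegree_kaltofenPoly (n : ℕ) : (kaltofenPoly n).natDegree = n :=
  Polynomial.natDegree_eq_of_le_of_coeff_ne_zero
    (Polynomial.natDegree_le_iff_coeff_eq_zero.2 fun j hj => by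
      rw [coeff_kaltofenPoly, if_neg (by omega)])
    (by rw [coeff_kaltofenPoly, if_pos le_rfl, show (n + n) / 2 = n by omega]; simp)

theorem monic_kaltofenPoly (n : ℕ) : (kaltofenPoly n).Monic := by
  rw [Polynomial.Monic, Polynomial.leadingCoeff, natDegree_kaltofenPoly, coeff_kaltofenPoly,
    if_pos le_rfl, show (n + n) / 2 = n by omega]
  simp

theorem hankelPair_kaltofenPoly {n : ℕ} (hn : 1 ≤ n) :
    HankelPair n (fun k => (ballot 0 k : ℤ)) (kaltofenPoly n) (kaltofenPoly (n - 1)) where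
  monic := monic_kaltofenPoly n
  natDegree := natDegree_kaltofenPoly n
  degree_lt := by
    rw [Polynomial.degree_eq_natDegree (monic_kaltofenPoly _).ne_zero, natDegree_kaltofenPoly]
    exact_mod_cast (by omega)
  moment_f i hi := by rw [moment_kaltofenPoly, ballot_of_lt hi, Nat.cast_zero]
  moment_g i hi := by
    rw [moment_kaltofenPoly]
    split_ifs with h
    · rw [← h, Nat.add_sub_cancel, ballot_self, Nat.cast_one]
    · rw [ballot_of_lt (by omega), Nat.cast_zero]

theorem moment_congr {Q : Type*} [CommRing Q] {h h' : ℕ → Q} {p : Polynomial Q} {m : ℕ}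
    (hp : p.degree < m) (hh : ∀ k < m, h k = h' k) : moment h p = moment h' p := by
  rw [moment_eq_sum h hp, moment_eq_sum h' hp]
  exact Finset.sum_congr rfl fun i _ => by rw [hh i i.2]

theorem HankelPair.congr {Q : Type*} [CommRing Q] {n : ℕ} {h h' : ℕ → Q} {f g : Polynomial Q}
    (hp : HankelPair n h f g) (hh : ∀ k < 2 * n, h k = h' k) : HankelPair n h' f g := by
  have hd : ∀ (p : Polynomial Q) (i : ℕ), i < n → p.degree ≤ n →
      (Polynomial.X ^ i * p).degree < ((2 * n : ℕ) : WithBot ℕ) := fun p i hi hpn => by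
    refine (Polynomial.degree_mul_le_of_le (Polynomial.degree_X_pow_le i) hpn).trans_lt ?_
    exact_mod_cast (by omega)
  have hf : f.degree ≤ n := Polynomial.degree_le_of_natDegree_le hp.natDegree.le
  exact ⟨hp.monic, hp.natDegree, hp.degree_lt,
    fun i hi => by rw [← hp.moment_f i hi, moment_congr (hd f i hi hf) hh],
    fun i hi => by rw [← hp.moment_g i hi, moment_congr (hd g i hi hp.degree_lt.le) hh]⟩

/-- The recurrence with the coefficients in the last row of Kaltofen's matrix. -/
theorem sum_kaltofenCoeff {n k : ℕ} (hk : k < n) :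
    ∑ j : Fin n, kaltofenCoeff n j * (ballot 0 (k + j) : ℤ) = ballot 0 (k + n) := by
  have h1 := moment_kaltofenPoly n k
  have hd : (Polynomial.X ^ k * kaltofenPoly n).degree < ((k + (n + 1) : ℕ) : WithBot ℕ) := by
    refine (Polynomial.degree_mul_le_of_le (Polynomial.degree_X_pow_le k)
      (Polynomial.degree_le_of_natDegree_le (natDegree_kaltofenPoly n).le)).trans_lt ?_
    exact_mod_cast (by omega)
  have h2 : ∑ i ∈ Finset.range (n + 1),
      (kaltofenPoly n).coeff i * (ballot 0 (k + i) : ℤ) = 0 := by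
    rw [moment_eq_sum _ hd, ballot_of_lt hk, Nat.cast_zero] at h1
    rw [← h1, ← Finset.sum_range (n := k + (n + 1)) (fun i : ℕ =>
      (Polynomial.X ^ k * kaltofenPoly n : Polynomial ℤ).coeff i * (ballot 0 i : ℤ)),
    Finset.sum_range_add _ k (n + 1)]
    have h3 : ∑ i ∈ Finset.range k,
        (Polynomial.X ^ k * kaltofenPoly n : Polynomial ℤ).coeff i * (ballot 0 i : ℤ) = 0 :=
      Finset.sum_eq_zero fun i hi => by
        rw [Polynomial.coeff_X_pow_mul', if_neg (by have := Finset.mem_range.1 hi; omega), zero_mul]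
    rw [h3, zero_add]
    refine Finset.sum_congr rfl fun i _ => ?_
    rw [add_comm k i, Polynomial.coeff_X_pow_mul]
  rw [Finset.sum_range_succ, coeff_kaltofenPoly, if_pos le_rfl,
    show (n + n) / 2 = n by omega, Finset.sum_range] at h2
  simp only [Nat.sub_self, zero_add, Nat.reduceDiv, pow_zero, Nat.choose_self, Nat.cast_one,
    one_mul, mul_one] at h2
  rw [← sub_eq_zero, ← neg_eq_zero, neg_sub, sub_eq_add_neg, ← Finset.sum_neg_distrib, add_comm,
    ← h2]
  congr 1
  refine Finset.sum_congr rfl fun j _ => ?_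
  have := j.2
  rw [coeff_kaltofenPoly, if_pos (by omega), kaltofenCoeff,
    show (n - (j : ℕ) + 1) / 2 = (n - j - 1) / 2 + 1 by omega, pow_succ]
  ring

/-- Multiplication by Kaltofen's matrix shifts the window of central binomial coefficients by one:
its last row continues the sequence. -/
theorem kaltofenC_pow_mulVec {n k : ℕ} (hk : k ≤ n) :
    (of (kaltofenC n) ^ k *ᵥ kaltofenPsi n) = fun i : Fin n => (ballot 0 (k + i) : ℤ) := by
  induction k with
  | zero =>
    funext i
    rw [pow_zero, one_mulVec, zero_add, ballot_zero, kaltofenPsi]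
  | succ k ih =>
    funext i
    rw [pow_succ', ← mulVec_mulVec, ih (by omega), mulVec, dotProduct]
    simp only [of_apply, kaltofenC]
    by_cases hi : (i : ℕ) + 1 < n
    · simp only [if_pos hi]
      rw [Finset.sum_eq_single_of_mem ⟨i + 1, hi⟩ (Finset.mem_univ _)]
      · simp only [if_true, one_mul]
        congr 2; ring
      · intro j _ hj
        rw [if_neg fun h => hj (Fin.ext h), zero_mul]
    · simp only [if_neg hi]
      rw [sum_kaltofenCoeff (by omega)]
      have := i.2
      congr 2; omega

theorem vecMul_kaltofenC_pow {n k : ℕ} (hk : k < n) :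
    (kaltofenPhi n ᵥ* of (kaltofenC n) ^ k) = Pi.single ⟨k, hk⟩ 1 := by
  induction k with
  | zero =>
    funext i
    rw [pow_zero, vecMul_one, kaltofenPhi, Pi.single_apply]
    exact if_congr (by rw [Fin.ext_iff]) rfl rfl
  | succ k ih =>
    funext i
    rw [pow_succ, ← vecMul_vecMul, ih (by omega), single_one_vecMul, row_apply, of_apply,
      kaltofenC, if_pos hk, Pi.single_apply]
    exact if_congr (by rw [Fin.ext_iff]) rfl rfl

theorem krylov_kaltofen {n k : ℕ} (hk : k < 2 * n) :
    krylov (of (kaltofenC n)) (kaltofenPhi n) (kaltofenPsi n) k = ballot 0 k := by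
  obtain ⟨i, j, hi, hj, rfl⟩ : ∃ i j, i < n ∧ j ≤ n ∧ k = i + j := by
    rcases Nat.lt_or_ge k n with h | h
    · exact ⟨k, 0, h, by omega, rfl⟩
    · exact ⟨k - n, n, by omega, le_rfl, by omega⟩
  rw [krylov, pow_add, ← mulVec_mulVec, dotProduct_mulVec, vecMul_kaltofenC_pow hi,
    single_one_dotProduct, kaltofenC_pow_mulVec hj, add_comm]

theorem krylov_map {Q Q' : Type*} [CommRing Q] [CommRing Q'] (F : Q →+* Q') {n : ℕ}
    (Z : Matrix (Fin n) (Fin n) Q) (φ ψ : Fin n → Q) (k : ℕ) :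
    F (krylov Z φ ψ k) = krylov (Z.map F) (F ∘ φ) (F ∘ ψ) k := by
  rw [krylov, krylov, RingHom.map_dotProduct, ← RingHom.mapMatrix_apply, ← map_pow]
  congr 1
  funext i
  exact RingHom.map_mulVec F _ _ i

theorem charpoly_kaltofenC {n : ℕ} (hn : 1 ≤ n) :
    (of (kaltofenC n)).charpoly = kaltofenPoly n :=
  (((hankelPair_kaltofenPoly hn).congr fun _ hk =>
    (krylov_kaltofen hk).symm).eq_charpoly (φ := kaltofenPhi n) (ψ := kaltofenPsi n)).symm

theorem coeff_zero_kaltofenPoly_sq (n : ℕ) :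
    (kaltofenPoly n).coeff 0 * (kaltofenPoly n).coeff 0 = 1 := by
  rw [coeff_kaltofenPoly, if_pos (Nat.zero_le _), Nat.choose_zero_right, Nat.cast_one, mul_one,
    ← mul_pow]
  simp

end Kaltofen

section Pencil

open PowerSeries Matrix

variable {R : Type u} [CommRing R] {n : ℕ}

/-- The row vector `φ` over the power series. -/
noncomputable def serPhi (R : Type u) [CommRing R] (n : ℕ) : Fin n → R⟦X⟧ :=
  fun i => (kaltofenPhi n i : ℤ)

/-- The column vector `ψ` over the power series. -/
noncomputable def serPsi (R : Type u) [CommRing R] (n : ℕ) : Fin n → R⟦X⟧ :=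
  fun i => (kaltofenPsi n i : ℤ)

theorem serPencil_map (A : Matrix (Fin n) (Fin n) R) :
    (serPencil A).map (constantCoeff (R := R)) = (of (kaltofenC n)).map (Int.castRingHom R) := by
  ext i j
  simp [serPencil, polyPencil]

theorem constantCoeff_krylov (A : Matrix (Fin n) (Fin n) R) {k : ℕ} (hk : k < 2 * n) :
    constantCoeff (krylov (serPencil A) (serPhi R n) (serPsi R n) k) = (ballot 0 k : R) := by
  rw [krylov_map, serPencil_map]
  have h1 := congrArg (Int.castRingHom R) (krylov_kaltofen hk)
  rw [krylov_map] at h1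
  have e1 : constantCoeff (R := R) ∘ serPhi R n = Int.castRingHom R ∘ kaltofenPhi n := by
    funext i; simp [serPhi]
  have e2 : constantCoeff (R := R) ∘ serPsi R n = Int.castRingHom R ∘ kaltofenPsi n := by
    funext i; simp [serPsi]
  rw [e1, e2, h1]
  simp

theorem invConst_charpoly (A : Matrix (Fin n) (Fin n) R) (hn : 1 ≤ n) :
    InvConst ((serPencil A).charpoly.coeff 0) := by
  have h1 : constantCoeff ((serPencil A).charpoly.coeff 0) =
      (((kaltofenPoly n).coeff 0 : ℤ) : R) := by
    rw [← Polynomial.coeff_map, ← charpoly_map, serPencil_map, charpoly_map, charpoly_kaltofenC hn,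
      Polynomial.coeff_map]
    rfl
  rw [InvConst, h1]
  exact_mod_cast congrArg (Int.cast (R := R)) (coeff_zero_kaltofenPoly_sq n)

end Pencil

/-! ### The extended Euclidean scheme -/

section Euclid

open Polynomial

variable {R : Type u} [CommRing R] {n : ℕ} {M : MulRoutine} {d : ℕ}

theorem run_polyReduce (hM : MulRoutine.Correct.{u} M) {L : ℕ} (q₁ q₀ : PowerSeries R)
    (p c : (PowerSeries R)[X])
    (hL : ∀ k, L ≤ k → (p - (C q₁ * X + C q₀) * c).coeff k = 0) :
    (polyReduce M L (jet d q₁) (jet d q₀) (fun k => jet d (p.coeff k))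
      fun k => jet d (c.coeff k)).run =
      fun k => jet d ((p - (C q₁ * X + C q₀) * c).coeff k) := by
  have hm := ser_models (R := R) hM d
  have hc : ∀ i : ℕ, (if i = 0 then jet d 0 else jet d (c.coeff (i - 1))) =
      jet d ((X * c).coeff i) := by
    intro i
    rcases i with _ | i <;> simp
  simp only [polyReduce, Prog.run_bind, Prog.run_pure, run_tab, hm.zero, hc, hm.mul, hm.sub]
  funext k
  rw [get]
  split_ifs with hk
  · congr 1
    rw [coeff_sub, add_mul, coeff_add, mul_assoc, coeff_C_mul, coeff_C_mul]
    ring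
  · rw [hL k (by omega)]

/-- The polynomial `h₀ x ^ (2 n - 1) + … + h_{2 n - 1}`. -/
noncomputable def reversePoly {Q : Type*} [CommRing Q] (n : ℕ) (h : ℕ → Q) : Q[X] :=
  vecPoly fun k : Fin (2 * n) => h (2 * n - 1 - k)

/-- High coefficients of multiples of the reversed polynomial are moments. -/
theorem coeff_mul_reversePoly {Q : Type*} [CommRing Q] (h : ℕ → Q) {t : Q[X]}
    (ht : ∀ k, n < k → t.coeff k = 0) {i : ℕ} (hi : i < n) :
    (t * reversePoly n h).coeff (2 * n - 1 - i) = moment h (X ^ i * t) := by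
  have htd : t.natDegree < n + 1 := Nat.lt_succ_of_le (natDegree_le_iff_coeff_eq_zero.2 ht)
  rw [t.as_sum_range' (n + 1) htd, Finset.sum_mul, Finset.mul_sum, finsetSum_coeff, map_sum]
  refine Finset.sum_congr rfl fun j hj => ?_
  have := Finset.mem_range.1 hj
  rw [X_pow_mul_monomial, moment_monomial, ← C_mul_X_pow_eq_monomial, mul_assoc, coeff_C_mul,
    coeff_X_pow_mul', if_pos (by omega), reversePoly, coeff_vecPoly, dif_pos (by omega)]
  congr 2
  simp only
  omega

/-- The invariants of the extended Euclidean scheme on `x ^ (2 n)` and the reversed polynomial `r₀`,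
after `i` steps. The remainders `rp` and `rc` are congruent to `tp * r₀` and `tc * r₀` modulo
`x ^ (2 n)`. The constant coefficients (for `z = 0`) of the leading coefficients of the remainders
are ballot numbers up to a sign; this makes the sequence normal. -/
structure EuclidInv (n : ℕ) (h : ℕ → PowerSeries R) (i : ℕ)
    (rp rc tp tc : (PowerSeries R)[X]) : Prop where
  rp_zero : ∀ k, 2 * n - i < k → rp.coeff k = 0
  rc_zero : ∀ k, 2 * n - i ≤ k → rc.coeff k = 0
  tp_zero : ∀ k, i ≤ k → tp.coeff k = 0
  tc_zero : ∀ k, i < k → tc.coeff k = 0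
  dvd_prev : X ^ (2 * n) ∣ rp - tp * reversePoly n h
  dvd_cur : X ^ (2 * n) ∣ rc - tc * reversePoly n h
  lead : (rp.coeff (2 * n - i) * tc.coeff i) * (rp.coeff (2 * n - i) * tc.coeff i) = 1
  const_cur : ∃ ε : R, ε * ε = 1 ∧ ∀ k, i ≤ k → k + i ≤ 2 * n - 1 →
    PowerSeries.constantCoeff (rc.coeff (2 * n - 1 - k)) = ε * ballot i k
  const_prev : (i = 0 ∧ rp = X ^ (2 * n)) ∨ ∃ i', i = i' + 1 ∧ ∃ ε : R, ε * ε = 1 ∧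
    ∀ k, i' ≤ k → k + i' ≤ 2 * n - 1 →
      PowerSeries.constantCoeff (rp.coeff (2 * n - 1 - k)) = ε * ballot i' k

theorem euclidInv_zero (hn : 1 ≤ n) {h : ℕ → PowerSeries R}
    (hc : ∀ k < 2 * n, PowerSeries.constantCoeff (h k) = (ballot 0 k : R)) :
    EuclidInv n h 0 (X ^ (2 * n)) (reversePoly n h) 0 1 where
  rp_zero k hk := by rw [coeff_X_pow, if_neg (by omega)]
  rc_zero k hk := by rw [reversePoly, coeff_vecPoly, dif_neg (by omega)]
  tp_zero k _ := coeff_zero k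
  tc_zero k hk := by rw [coeff_one, if_neg (by omega)]
  dvd_prev := by simp
  dvd_cur := by simp
  lead := by simp [coeff_X_pow]
  const_cur := ⟨1, by simp, fun k _ hk => by
    rw [reversePoly, coeff_vecPoly, dif_pos (by omega), one_mul, ← hc k (by omega)]
    congr 2
    simp only
    omega⟩
  const_prev := .inl ⟨rfl, rfl⟩

namespace EuclidInv

variable {h : ℕ → PowerSeries R} {i : ℕ} {rp rc tp tc : (PowerSeries R)[X]}

theorem invConst_cur (hI : EuclidInv n h i rp rc tp tc) (hi : i < n) :
    InvConst (rc.coeff (2 * n - 1 - i)) := by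
  obtain ⟨ε, hε, hk⟩ := hI.const_cur
  rw [InvConst, hk i le_rfl (by omega), ballot_self]
  simpa using hε

theorem invConst_prev (hI : EuclidInv n h i rp rc tp tc) (hi : i ≤ n) :
    InvConst (rp.coeff (2 * n - i)) := by
  rcases hI.const_prev with ⟨rfl, rfl⟩ | ⟨i', rfl, ε, hε, hk⟩
  · simp [InvConst, coeff_X_pow]
  · rw [InvConst, show 2 * n - (i' + 1) = 2 * n - 1 - i' by omega, hk i' le_rfl (by omega),
      ballot_self]
    simpa using hε

theorem invConst_lead (hI : EuclidInv n h i rp rc tp tc) (hi : i ≤ n) :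
    InvConst (tc.coeff i) := by
  have h1 := congrArg PowerSeries.constantCoeff hI.lead
  have h2 := hI.invConst_prev hi
  rw [InvConst] at h2 ⊢
  simp only [map_mul, map_one] at h1
  linear_combination h1 - (PowerSeries.constantCoeff (tc.coeff i) *
    PowerSeries.constantCoeff (tc.coeff i)) * h2

/-- One division step. -/
theorem step (hI : EuclidInv n h i rp rc tp tc) (hi : i < n) {v q₁ q₀ : PowerSeries R}
    (hv : v = Ring.inverse (rc.coeff (2 * n - 1 - i)))
    (hq₁ : q₁ = rp.coeff (2 * n - 1 - i + 1) * v)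
    (hq₀ : q₀ = (rp.coeff (2 * n - 1 - i) - q₁ * rc.coeff (2 * n - 1 - i - 1)) * v) :
    EuclidInv n h (i + 1) rc (rp - (C q₁ * X + C q₀) * rc) tc (tp - (C q₁ * X + C q₀) * tc) := by
  have hinv := hI.invConst_cur hi
  have hcv : rc.coeff (2 * n - 1 - i) * v = 1 := by rw [hv]; exact hinv.mul_inverse
  have hcoeff : ∀ (p c : (PowerSeries R)[X]) (k : ℕ), (p - (C q₁ * X + C q₀) * c).coeff (k + 1) =
      p.coeff (k + 1) - q₁ * c.coeff k - q₀ * c.coeff (k + 1) := fun p c k => by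
    rw [coeff_sub, add_mul, coeff_add, mul_assoc, coeff_C_mul, coeff_C_mul, coeff_X_mul]
    ring
  obtain ⟨e, he⟩ : ∃ e, 2 * n - 1 - i = e + 1 := ⟨2 * n - 2 - i, by omega⟩
  rw [he] at hcv hq₁ hq₀ hv
  rw [Nat.add_sub_cancel] at hq₀
  refine ⟨fun k hk => hI.rc_zero k (by omega), fun k hk => ?_, fun k hk => hI.tc_zero k hk,
    fun k hk => ?_, hI.dvd_cur, ?_, ?_, ?_, .inr ⟨i, rfl, hI.const_cur⟩⟩
  · obtain ⟨k, rfl⟩ : ∃ k', k = k' + 1 := ⟨k - 1, by omega⟩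
    rw [hcoeff]
    rcases (show e ≤ k by omega).eq_or_lt with rfl | h1
    · linear_combination -(rp.coeff (e + 1) - q₁ * rc.coeff e) * hcv -
        rc.coeff (e + 1) * hq₀
    · rcases (show e + 1 ≤ k by omega).eq_or_lt with rfl | h2
      · rw [hI.rc_zero (e + 1 + 1) (by omega)]
        linear_combination -rp.coeff (e + 1 + 1) * hcv - rc.coeff (e + 1) * hq₁
      · rw [hI.rp_zero _ (by omega), hI.rc_zero _ (by omega), hI.rc_zero _ (by omega)]
        ring
  · obtain ⟨k, rfl⟩ : ∃ k', k = k' + 1 := ⟨k - 1, by omega⟩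
    rw [hcoeff, hI.tp_zero _ (by omega), hI.tc_zero _ (by omega), hI.tc_zero _ (by omega)]
    ring
  · have h1 := dvd_sub hI.dvd_prev (hI.dvd_cur.mul_left (C q₁ * X + C q₀))
    refine h1.trans (dvd_of_eq ?_)
    ring
  · have hl := hI.lead
    rw [show 2 * n - (i + 1) = e + 1 by omega, hcoeff, hI.tp_zero _ (by omega),
      hI.tc_zero (i + 1) (by omega)]
    rw [show 2 * n - i = e + 1 + 1 by omega] at hl
    have h2 : rc.coeff (e + 1) * q₁ = rp.coeff (e + 1 + 1) := by
      linear_combination rc.coeff (e + 1) * hq₁ + rp.coeff (e + 1 + 1) * hcv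
    rw [← hl]
    linear_combination (tc.coeff i) ^ 2 * (rc.coeff (e + 1) * q₁ + rp.coeff (e + 1 + 1)) * h2
  · -- the constant coefficients of the quotient
    obtain ⟨ε, hε, hk⟩ := hI.const_cur
    have hvε : PowerSeries.constantCoeff v = ε := by
      rw [hv, ← he, hinv.constantCoeff_inverse, hk i le_rfl (by omega), ballot_self]
      simp
    have h1 : PowerSeries.constantCoeff (rc.coeff e) = ε := by
      rw [show e = 2 * n - 1 - (i + 1) by omega, hk _ (by omega) (by omega), ballot_succ_self]
      simp
    have e₁ := congrArg PowerSeries.constantCoeff hq₁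
    have e₀ := congrArg PowerSeries.constantCoeff hq₀
    simp only [map_mul, map_sub, hvε, h1] at e₁ e₀
    rcases hI.const_prev with ⟨rfl, rfl⟩ | ⟨i', rfl, ε', hε', hk'⟩
    · rw [coeff_X_pow, if_pos (by omega)] at e₁
      rw [coeff_X_pow, if_neg (by omega)] at e₀
      simp only [map_one, map_zero, one_mul, zero_sub] at e₁ e₀
      refine ⟨-1, by ring, fun k hk1 hk2 => ?_⟩
      obtain ⟨l, hl⟩ : ∃ l, 2 * n - 1 - k = l + 1 := ⟨2 * n - 2 - k, by omega⟩
      have a1 := hk k (by omega) (by omega)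
      have a2 := hk (k + 1) (by omega) (by omega)
      rw [hl] at a1
      rw [show 2 * n - 1 - (k + 1) = l by omega] at a2
      rw [hl, hcoeff, coeff_X_pow, if_neg (by omega)]
      simp only [map_sub, map_mul, map_zero, a1, a2, e₁, e₀, ballot_zero_succ]
      push_cast
      linear_combination (-(ballot 1 k : R) + ε ^ 2 * ballot 0 k) * hε
    · have b1 := hk' i' le_rfl (by omega)
      have b2 := hk' (i' + 1) (by omega) (by omega)
      rw [show 2 * n - 1 - i' = e + 1 + 1 by omega, ballot_self] at b1
      rw [show 2 * n - 1 - (i' + 1) = e + 1 by omega, ballot_succ_self] at b2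
      rw [b1] at e₁
      rw [b2, e₁] at e₀
      simp only [Nat.cast_one, mul_one] at e₁ e₀
      have e₀' : PowerSeries.constantCoeff q₀ = 0 := by
        rw [e₀]; linear_combination -ε' * ε * hε
      refine ⟨-ε', by linear_combination hε', fun k hk1 hk2 => ?_⟩
      obtain ⟨l, hl⟩ : ∃ l, 2 * n - 1 - k = l + 1 := ⟨2 * n - 2 - k, by omega⟩
      have a1 := hk' k (by omega) (by omega)
      have a2 := hk (k + 1) (by omega) (by omega)
      rw [hl] at a1
      rw [show 2 * n - 1 - (k + 1) = l by omega, ballot_succ_succ] at a2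
      rw [hl, hcoeff]
      simp only [map_sub, map_mul, a1, a2, e₁, e₀']
      push_cast
      linear_combination -ε' * ((ballot i' k : R) + ballot (i' + 2) k) * hε

/-- The result of the Euclidean scheme. -/
theorem hankelPair [Nontrivial R] (hI : EuclidInv n h n rp rc tp tc) (hn : 1 ≤ n) :
    HankelPair n h (tc * C (Ring.inverse (tc.coeff n))) (tp * C (Ring.inverse (rp.coeff n))) := by
  have h1 := (hI.invConst_lead le_rfl).mul_inverse
  have h2 := hI.invConst_prev le_rfl
  rw [show 2 * n - n = n by omega] at h2
  have h2 := h2.mul_inverse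
  have hnat : (tc * C (Ring.inverse (tc.coeff n))).natDegree = n :=
    natDegree_eq_of_le_of_coeff_ne_zero
      (natDegree_le_iff_coeff_eq_zero.2 fun k hk => by
        rw [coeff_mul_C, hI.tc_zero k hk, zero_mul]) (by rw [coeff_mul_C, h1]; exact one_ne_zero)
  refine ⟨by rw [Monic, leadingCoeff, hnat, coeff_mul_C, h1], hnat,
    (degree_lt_iff_coeff_zero _ _).2 fun k hk => by
      rw [coeff_mul_C, hI.tp_zero k hk, zero_mul], fun i hi => ?_, fun i hi => ?_⟩
  · have h3 := X_pow_dvd_iff.1 hI.dvd_cur (2 * n - 1 - i) (by omega)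
    rw [coeff_sub, coeff_mul_reversePoly h hI.tc_zero hi, hI.rc_zero _ (by omega), zero_sub,
      neg_eq_zero] at h3
    rw [← mul_assoc, mul_comm, moment_C_mul, h3, mul_zero]
  · have h3 := X_pow_dvd_iff.1 hI.dvd_prev (2 * n - 1 - i) (by omega)
    rw [coeff_sub, coeff_mul_reversePoly h (fun k hk => hI.tp_zero k (by omega)) hi,
      sub_eq_zero] at h3
    rw [← mul_assoc, mul_comm, moment_C_mul, ← h3]
    split_ifs with hin
    · rw [show 2 * n - 1 - i = n by omega, mul_comm, h2]
    · rw [hI.rp_zero (2 * n - 1 - i) (by omega), mul_zero]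

end EuclidInv

theorem run_euclid (hM : MulRoutine.Correct.{u} M) (hn : 1 ≤ n) {h : ℕ → PowerSeries R}
    (hc : ∀ k < 2 * n, PowerSeries.constantCoeff (h k) = (ballot 0 k : R))
    {h' : ℕ → Ser R d} (hh : ∀ k < 2 * n, h' k = jet d (h k)) {i : ℕ} (hi : i ≤ n) :
    ∃ rp rc tp tc : (PowerSeries R)[X], EuclidInv n h i rp rc tp tc ∧
      (euclid M n h' i).run = ⟨fun k => jet d (rp.coeff k), fun k => jet d (rc.coeff k),
        fun k => jet d (tp.coeff k), fun k => jet d (tc.coeff k)⟩ := by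
  have hm := ser_models (R := R) hM d
  induction i with
  | zero =>
    refine ⟨_, _, _, _, euclidInv_zero hn hc, ?_⟩
    simp only [euclid, Prog.run_bind, Prog.run_pure, hm.zero, hm.one]
    congr 1 <;> funext k
    · rw [coeff_X_pow]
      split_ifs <;> rfl
    · rw [reversePoly, coeff_vecPoly]
      split_ifs with hk
      · exact hh _ (by omega)
      · rfl
    · rw [coeff_one]
      split_ifs <;> rfl
  | succ i ih =>
    obtain ⟨rp, rc, tp, tc, hI, hr⟩ := ih (by omega)
    have hs := hI.step (by omega) rfl rfl rfl
    refine ⟨_, _, _, _, hs, ?_⟩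
    simp only [euclid, euclidStep, Prog.run_bind, Prog.run_pure, hr,
      run_serInv hM (hI.invConst_cur (by omega)), hm.mul, hm.sub]
    rw [run_polyReduce hM _ _ _ _ fun k hk => hs.rc_zero k (by omega),
      run_polyReduce hM _ _ _ _ fun k hk => hs.tc_zero k (by omega)]

theorem run_minPolyAndColumn [Nontrivial R] (hM : MulRoutine.Correct.{u} M) (hn : 1 ≤ n)
    {h : ℕ → PowerSeries R}
    (hc : ∀ k < 2 * n, PowerSeries.constantCoeff (h k) = (ballot 0 k : R))
    {h' : ℕ → Ser R d} (hh : ∀ k < 2 * n, h' k = jet d (h k)) :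
    ∃ f g : (PowerSeries R)[X], HankelPair n h f g ∧
      (minPolyAndColumn M n h').run = (fun k => jet d (f.coeff k), fun k => jet d (g.coeff k)) := by
  have hm := ser_models (R := R) hM d
  obtain ⟨rp, rc, tp, tc, hI, hr⟩ := run_euclid (d := d) hM hn hc hh le_rfl
  have hI2 := hI.invConst_prev le_rfl
  rw [show 2 * n - n = n by omega] at hI2
  refine ⟨_, _, hI.hankelPair hn, ?_⟩
  simp only [minPolyAndColumn, Prog.run_bind, Prog.run_pure, run_tab, hr, hm.zero,
    run_serInv hM (hI.invConst_lead le_rfl), run_serInv hM hI2, hm.mul, coeff_mul_C]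
  congr 1 <;> funext k
  · rw [get]
    split_ifs with hk
    · rfl
    · rw [hI.tc_zero k (by omega), zero_mul]
  · rw [get]
    split_ifs with hk
    · rfl
    · rw [hI.tp_zero k (by omega), zero_mul]

end Euclid

/-! ### The derivatives of the moments -/

section StepI

open Polynomial

variable {R : Type u} [CommRing R] {n : ℕ} {M : MulRoutine} {d : ℕ}

theorem run_wronskian (hM : MulRoutine.Correct.{u} M) (n : ℕ) (p q v w : (PowerSeries R)[X]) :
    (wronskian M n (fun k => jet d (p.coeff k)) (fun k => jet d (q.coeff k))
      (fun k => jet d (v.coeff k)) fun k => jet d (w.coeff k)).run =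
      fun k : Fin n => jet d ((derivative p * q - derivative v * w).coeff k) := by
  have hm := ser_models (R := R) hM d
  have hder : ∀ (p : (PowerSeries R)[X]) (i : ℕ),
      (((i : ℤ) + 1 : ℤ) : PowerSeries R) * p.coeff (i + 1) = (derivative p).coeff i :=
    fun p i => by rw [coeff_derivative, mul_comm]; push_cast; rfl
  simp only [wronskian, Prog.run_bind, run_tab, run_serScale, hder]
  funext k
  have hdot : ∀ p q : (PowerSeries R)[X],
      ((ser M d).dot (fun i : Fin (k + 1) => jet d (p.coeff i))
        fun i => jet d (q.coeff (k - i))).run = jet d ((p * q).coeff k) := fun p q => by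
    rw [hm.dot, coeff_mul,
      Finset.Nat.sum_antidiagonal_eq_sum_range_succ (fun i j => p.coeff i * q.coeff j),
      Finset.sum_range]
  rw [hdot, hdot, hm.sub, coeff_sub]

/-- The reflection `x ^ n p(1 / x)` turns the polynomial `f' g - g' f` into its negative. -/
theorem coeff_wronskian_reflect {Q : Type*} [CommRing Q] {f g : Q[X]} (hf : f.natDegree ≤ n)
    (hg : g.natDegree ≤ n) {k : ℕ} (hk : k + 2 ≤ 2 * n) :
    (derivative (reflect n g) * reflect n f - derivative (reflect n f) * reflect n g).coeff
      (2 * n - 2 - k) = (derivative f * g - derivative g * f).coeff k := by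
  have hder : ∀ p : Q[X], p.natDegree ≤ n →
      X * derivative (reflect n p) = (n : Q[X]) * reflect n p - reflect n (X * derivative p) := by
    intro p hp
    have hX : ∀ (q : Q[X]) (i : ℕ), (X * derivative q).coeff i = i * q.coeff i := by
      intro q i
      rcases i with _ | i
      · simp
      · rw [coeff_X_mul, coeff_derivative]; push_cast; ring
    ext i
    rw [hX, coeff_sub, ← C_eq_natCast, coeff_C_mul, coeff_reflect, coeff_reflect, hX]
    rcases le_or_gt i n with hi | hi
    · rw [revAt_le hi, Nat.cast_sub hi]; ring
    · rw [revAt_eq_self_of_lt (by omega), coeff_eq_zero_of_natDegree_lt (by omega)]; ring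
  have hd : ∀ p : Q[X], p.natDegree ≤ n → (X * derivative p).natDegree ≤ n := by
    intro p hp
    rcases Nat.eq_zero_or_pos p.natDegree with h0 | h0
    · rw [eq_C_of_natDegree_eq_zero h0]; simp
    · refine natDegree_mul_le.trans ((add_le_add natDegree_X_le (natDegree_derivative_le p)).trans
        ?_)
      omega
  have h1 : X * (derivative (reflect n g) * reflect n f - derivative (reflect n f) * reflect n g) =
      reflect (n + n) (X * (derivative f * g - derivative g * f)) := by
    rw [mul_sub, ← mul_assoc, ← mul_assoc, hder _ hf, hder _ hg, mul_sub, ← mul_assoc, ← mul_assoc,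
      reflect_sub, reflect_mul _ _ (hd f hf) hg, reflect_mul _ _ (hd g hg) hf]
    ring
  have h2 := congrArg (fun p => p.coeff (2 * n - 2 - k + 1)) h1
  simp only [coeff_X_mul, coeff_reflect] at h2
  rw [h2, revAt_le (by omega), show n + n - (2 * n - 2 - k + 1) = k + 1 by omega, coeff_X_mul]

theorem run_antiDiagonalSums (hM : MulRoutine.Correct.{u} M) (hn : 1 ≤ n) {h : ℕ → PowerSeries R}
    {f g : (PowerSeries R)[X]} (hp : HankelPair n h f g)
    {N : Matrix (Fin n) (Fin n) (PowerSeries R)} (hN : hankel n h * N = 1) :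
    (antiDiagonalSums M n (fun k => jet d (f.coeff k)) fun k => jet d (g.coeff k)).run =
      fun k => jet d ((antiPoly N).coeff k) := by
  have hm := ser_models (R := R) hM d
  have hg : g.natDegree ≤ n := natDegree_le_of_degree_le hp.degree_lt.le
  have hrev : ∀ p : (PowerSeries R)[X], p.natDegree ≤ n →
      (fun i => if i ≤ n then jet d (p.coeff (n - i)) else jet d 0) =
        fun i => jet d ((reflect n p).coeff i) := by
    intro p hp
    funext i
    rw [coeff_reflect]
    split_ifs with hi
    · rw [revAt_le hi]
    · rw [revAt_eq_self_of_lt (by omega), coeff_eq_zero_of_natDegree_lt (by omega)]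
  simp only [antiDiagonalSums, Prog.run_bind, Prog.run_pure, hm.zero, hrev f hp.natDegree.le,
    hrev g hg, run_wronskian hM]
  funext k
  rw [get, get]
  have hdeg := (degree_lt_iff_coeff_zero _ _).1 (degree_antiPoly_lt N)
  rw [hp.antiPoly_eq hN] at hdeg ⊢
  split_ifs with h1 h2 h3
  · rfl
  · rw [coeff_wronskian_reflect hp.natDegree.le hg (by omega)]
  · omega
  · rw [hdeg k (by omega)]

theorem run_shiftedColumn (hM : MulRoutine.Correct.{u} M) {h : ℕ → PowerSeries R}
    {f g : (PowerSeries R)[X]} (hp : HankelPair n h f g) (hf : InvConst (f.coeff 0)) :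
    (shiftedColumn M n (fun k => jet d (f.coeff k)) fun k => jet d (g.coeff k)).run =
      fun k => jet d ((divX (g - C (g.coeff 0 * Ring.inverse (f.coeff 0)) * f)).coeff k) := by
  have hm := ser_models (R := R) hM d
  simp only [shiftedColumn, Prog.run_bind, Prog.run_pure, run_tab, hm.zero, run_serInv hM hf,
    hm.mul, hm.sub, coeff_divX, coeff_sub, coeff_C_mul]
  funext k
  rw [get]
  split_ifs with hk
  · rfl
  · rw [(degree_lt_iff_coeff_zero _ _).1 hp.degree_lt _ (by omega),
      hp.coeff_of_lt (i := k + 1) (by omega)]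
    simp

end StepI

/-! ### The determinant algorithm -/

section Sizes

theorem one_le_giant {n : ℕ} (hn : 1 ≤ n) : 1 ≤ giant n := by
  have := Nat.sqrt_pos.2 hn
  unfold giant
  split_ifs <;> omega

theorem two_mul_le_baby_mul_giant {n : ℕ} (hn : 1 ≤ n) : 2 * n ≤ baby n * giant n := by
  have := le_smul_ceilDiv (show 0 < giant n from one_le_giant hn) (b := 2 * n)
  rwa [smul_eq_mul, mul_comm (giant n)] at this

theorem giant_le {n : ℕ} (hn : 1 ≤ n) : giant n ≤ n := by
  have h1 := Nat.sqrt_le_self n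
  unfold giant
  split_ifs with h
  · exact h1
  · rcases hn.eq_or_lt with rfl | hn
    · simp at h
    · have := Nat.sqrt_lt_self hn; omega

theorem two_le_baby {n : ℕ} (hn : 1 ≤ n) : 2 ≤ baby n := by
  have h1 := two_mul_le_baby_mul_giant hn
  have h2 := giant_le hn
  by_contra h
  have : baby n * giant n ≤ 1 * n := Nat.mul_le_mul (by omega) h2
  omega

theorem baby_le {n : ℕ} (hn : 1 ≤ n) : baby n ≤ n + 1 := by
  have hs := one_le_giant hn
  rw [baby, ceilDiv_le_iff_le_smul hs, smul_eq_mul]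
  rcases hn.eq_or_lt with rfl | hn
  · omega
  · have h2 : 2 ≤ giant n := by
      unfold giant
      split_ifs with h
      · by_contra h3
        have : Nat.sqrt n ≤ 1 := by omega
        have : Nat.sqrt n ^ 2 ≤ 1 ^ 2 := Nat.pow_le_pow_left this 2
        omega
      · have := Nat.sqrt_pos.2 (show 0 < n by omega)
        omega
    nlinarith

end Sizes

section Determinant

open PowerSeries Matrix

variable {R : Type u} [CommRing R] {n : ℕ} {M : MulRoutine}

theorem natDegree_matrix_mul_le {a b c : ℕ} {P : Matrix (Fin a) (Fin b) (Polynomial R)}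
    {Q : Matrix (Fin b) (Fin c) (Polynomial R)} {p q : ℕ} (hP : ∀ i j, (P i j).natDegree ≤ p)
    (hQ : ∀ i j, (Q i j).natDegree ≤ q) (i : Fin a) (j : Fin c) :
    ((P * Q) i j).natDegree ≤ p + q := by
  rw [mul_apply]
  exact Polynomial.natDegree_sum_le_of_forall_le _ _ fun k _ =>
    Polynomial.natDegree_mul_le.trans (add_le_add (hP _ _) (hQ _ _))

theorem natDegree_polyPencil_pow_le (A : Matrix (Fin n) (Fin n) R) (q : ℕ) (i j : Fin n) :
    ((polyPencil A ^ q) i j).natDegree ≤ q := by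
  induction q generalizing i j with
  | zero =>
    rw [pow_zero, one_apply]
    split_ifs <;> simp
  | succ q ih =>
    rw [pow_succ]
    refine natDegree_matrix_mul_le ih (fun i j => ?_) i j
    refine (Polynomial.natDegree_add_le _ _).trans (max_le ?_ ?_)
    · simp
    · exact (Polynomial.natDegree_C_mul_le _ _).trans Polynomial.natDegree_X_le

theorem serPencil_pow (A : Matrix (Fin n) (Fin n) R) (q : ℕ) :
    serPencil A ^ q = (polyPencil A ^ q).map (Polynomial.coeToPowerSeries.ringHom (R := R)) :=
  (map_pow (RingHom.mapMatrix Polynomial.coeToPowerSeries.ringHom) (polyPencil A) q).symm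

theorem coeff_serPencil_pow (A : Matrix (Fin n) (Fin n) R) {q k : ℕ} (h : q < k) (i j : Fin n) :
    coeff k ((serPencil A ^ q) i j) = 0 := by
  rw [serPencil_pow, map_apply, Polynomial.coeToPowerSeries.ringHom_apply, Polynomial.coeff_coe]
  exact Polynomial.coeff_eq_zero_of_natDegree_lt ((natDegree_polyPencil_pow_le A q i j).trans_lt h)

theorem coeff_serPencil_pow_mulVec (A : Matrix (Fin n) (Fin n) R) {q k : ℕ} (h : q < k)
    (i : Fin n) : coeff k ((serPencil A ^ q *ᵥ serPsi R n) i) = 0 := by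
  rw [mulVec, dotProduct, map_sum]
  refine Finset.sum_eq_zero fun j _ => ?_
  rw [serPsi, ← map_intCast (C (R := R)), coeff_mul_C, coeff_serPencil_pow A h, zero_mul]

/-- The data that the determinant algorithm leaves are the truncations of the corresponding power
series. -/
structure DetSpec (A : Matrix (Fin n) (Fin n) R) (f g : Polynomial R⟦X⟧) (D : DetData R n) :
    Prop where
  Z : D.Z = fun i j => jet (baby n) (serPencil A i j)
  powers : ∀ k, D.powers (baby n / 2 ^ k) =
    fun i j => jet (baby n) ((serPencil A ^ (baby n / 2 ^ k)) i j)
  B : D.B = fun i j => jet n ((serPencil A ^ baby n) i j)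
  v : ∀ i < baby n, D.v i = fun l => jet n ((serPencil A ^ i *ᵥ serPsi R n) l)
  u : ∀ j < giant n, D.u j = fun l => jet n ((serPhi R n ᵥ* (serPencil A ^ baby n) ^ j) l)
  f : D.f = fun k => jet n (f.coeff k)
  g : D.g = fun k => jet n (g.coeff k)
  det : D.det = jet n (serPencil A).det

/-- The moments of the pencil have a Hankel pair, and the determinant algorithm computes it. -/
theorem run_detAlg [Nontrivial R] (hM : MulRoutine.Correct.{u} M) (hn : 1 ≤ n)
    (A : Matrix (Fin n) (Fin n) R) :
    ∃ f g : Polynomial R⟦X⟧,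
      HankelPair n (krylov (serPencil A) (serPhi R n) (serPsi R n)) f g ∧
        DetSpec A f g (detAlg M A).run := by
  have hr := two_le_baby hn
  have hs := one_le_giant hn
  set Z := serPencil A with hZ
  have hmr := ser_models (R := R) hM (baby n)
  have hmn := ser_models (R := R) hM n
  have hψ : ∀ i : Fin n, ((kaltofenPsi n i : ℤ) : R⟦X⟧) = serPsi R n i := fun i => rfl
  have hφ : ∀ i : Fin n, ((kaltofenPhi n i : ℤ) : R⟦X⟧) = serPhi R n i := fun i => rfl
  have hv : ∀ i < baby n, (iterates (fun x => (ser M (baby n)).mulVec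
      (fun i j => jet (baby n) (Z i j)) x) (fun l => jet (baby n) (serPsi R n l))
      (baby n - 1)).run i = fun l => jet (baby n) ((Z ^ i *ᵥ serPsi R n) l) := by
    intro i hi
    rw [run_iterates _ _ (by omega)]
    clear hi
    induction i with
    | zero => simp
    | succ i ih => rw [Function.iterate_succ_apply', ih, hmr.mulVec, mulVec_mulVec, ← pow_succ']
  have hu : ∀ j < giant n, (iterates (fun x => (ser M n).vecMul x
      (fun i j => jet n ((Z ^ baby n) i j))) (fun l => jet n (serPhi R n l))
      (giant n - 1)).run j = fun l => jet n ((serPhi R n ᵥ* (Z ^ baby n) ^ j) l) := by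
    intro j hj
    rw [run_iterates _ _ (by omega)]
    clear hj
    induction j with
    | zero => simp
    | succ i ih => rw [Function.iterate_succ_apply', ih, hmn.vecMul, vecMul_vecMul, ← pow_succ]
  have hp := hmr.matPowers Z (baby n)
  have hB : (matResize n (((ser M (baby n)).matPowers (fun i j => jet (baby n) (Z i j))
      (baby n)).run (baby n))).run = fun i j => jet n ((Z ^ baby n) i j) := by
    have hp0 := hp 0
    rw [pow_zero, Nat.div_one] at hp0
    rw [hp0, run_matResize (.inr fun i j k hk => coeff_serPencil_pow A hk i j)]
  have hV : (matResize n fun i : Fin (baby n) => (iterates (fun x => (ser M (baby n)).mulVec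
      (fun i j => jet (baby n) (Z i j)) x) (fun l => jet (baby n) (serPsi R n l))
      (baby n - 1)).run i).run =
        fun (i : Fin (baby n)) l => jet n ((Z ^ (i : ℕ) *ᵥ serPsi R n) l) := by
    have h1 : (fun i : Fin (baby n) => (iterates (fun x => (ser M (baby n)).mulVec
        (fun i j => jet (baby n) (Z i j)) x) (fun l => jet (baby n) (serPsi R n l))
        (baby n - 1)).run (i : ℕ)) = fun i l => jet (baby n)
          (of (fun i : Fin (baby n) => Z ^ (i : ℕ) *ᵥ serPsi R n) i l) :=
      funext fun i => hv i i.2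
    rw [h1]
    exact run_matResize (P := of fun i : Fin (baby n) => Z ^ (i : ℕ) *ᵥ serPsi R n)
      (.inr fun i l k hk => coeff_serPencil_pow_mulVec A (i.2.trans hk) l)
  have hVget : ∀ i < baby n, get (fun _ => jet n 0)
      (fun (i : Fin (baby n)) l => jet n ((Z ^ (i : ℕ) *ᵥ serPsi R n) l)) i =
        fun l => jet n ((Z ^ i *ᵥ serPsi R n) l) := fun i hi => by rw [get, dif_pos hi]
  obtain ⟨f, g, hfg, hrun⟩ := run_minPolyAndColumn (d := n) hM hn
    (h := krylov Z (serPhi R n) (serPsi R n)) (fun k hk => constantCoeff_krylov A hk)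
    (h' := fun k => get (jet n 0) (get (fun _ => jet n 0)
      (fun (i : Fin (baby n)) (j : Fin (giant n)) => ((ser M n).dot
        ((iterates (fun x => (ser M n).vecMul x (fun i j => jet n ((Z ^ baby n) i j)))
          (fun l => jet n (serPhi R n l)) (giant n - 1)).run j)
        (get (fun _ => jet n 0)
          (fun (i : Fin (baby n)) l => jet n ((Z ^ (i : ℕ) *ᵥ serPsi R n) l)) i)).run)
        (k % baby n)) (k / baby n)) (by
    intro k hk
    have h1 : k % baby n < baby n := Nat.mod_lt _ (by omega)
    have h2 : k / baby n < giant n :=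
      Nat.div_lt_of_lt_mul (hk.trans_le (two_mul_le_baby_mul_giant hn))
    rw [get, dif_pos h2, get, dif_pos h1, hVget _ h1, hu _ h2, hmn.dot]
    congr 1
    change (serPhi R n ᵥ* (Z ^ baby n) ^ (k / baby n)) ⬝ᵥ (Z ^ (k % baby n) *ᵥ serPsi R n) = _
    rw [← dotProduct_mulVec, mulVec_mulVec, ← pow_mul, ← pow_add, Nat.div_add_mod, krylov])
  refine ⟨f, g, hfg, ?_⟩
  simp only [detAlg, Prog.run_bind, run_tab, run_pencil, run_serLit, hmn.zero, hψ, hφ, ← hZ, hB,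
    hV, hrun]
  have hdet := hfg.det_eq
  split_ifs with h2
  · simp only [Prog.run_bind, Prog.run_pure]
    refine ⟨rfl, hp, rfl, hVget, hu, rfl, rfl, ?_⟩
    rw [hdet, Even.neg_one_pow (Nat.even_iff.2 h2), one_mul]
  · simp only [Prog.run_bind, Prog.run_pure, hmn.sub]
    refine ⟨rfl, hp, rfl, hVget, hu, rfl, rfl, ?_⟩
    rw [hdet, Odd.neg_one_pow (Nat.odd_iff.2 (by omega)), neg_one_mul, zero_sub]

end Determinant

/-! ### Differentiation of the baby steps and giant steps -/

section Steps

open PowerSeries Matrix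

variable {R : Type u} [CommRing R] {n : ℕ} {M : MulRoutine}

theorem run_stepI (hM : MulRoutine.Correct.{u} M) (hn : 1 ≤ n) (A : Matrix (Fin n) (Fin n) R)
    {f g : Polynomial R⟦X⟧}
    (hp : HankelPair n (krylov (serPencil A) (serPhi R n) (serPsi R n)) f g) {D : DetData R n}
    (hD : DetSpec A f g D) :
    ∃ w : ℕ → R⟦X⟧, (stepI M D).run = (fun k : Fin (2 * n) => jet n (w k)) ∧
      (serPencil A).adjugate = ∑ k ∈ Finset.range (2 * n),
        w k • powDeriv (serPencil A) k (vecMulVec (serPsi R n) (serPhi R n)) := by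
  have hm := ser_models (R := R) hM n
  have hf : InvConst (f.coeff 0) := by rw [hp.eq_charpoly]; exact invConst_charpoly A hn
  have hZ : IsUnit (serPencil A).det := by
    rw [hp.det_eq]
    exact ((isUnit_one.neg).pow n).mul hf.isUnit
  have hs := hp.shift (c := g.coeff 0 * Ring.inverse (f.coeff 0))
    (by rw [mul_assoc, mul_comm (Ring.inverse _), hf.mul_inverse, mul_one]) (hp.moment_f_all _)
  obtain ⟨N, hN⟩ := hp.isUnit.exists_right_inv
  obtain ⟨N', hN'⟩ := hs.isUnit.exists_right_inv
  refine ⟨_, ?_, hp.adjugate_eq hZ hN hN'⟩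
  simp only [stepI, Prog.run_bind, run_tab, hm.zero, hD.f, hD.g, run_shiftedColumn hM hp hf,
    run_antiDiagonalSums hM hn hp hN, run_antiDiagonalSums hM hn hs hN', hD.det]
  funext k
  have : (if (k : ℕ) = 0 then jet n 0 else jet n ((antiPoly N').coeff (k - 1))) =
      jet n (if (k : ℕ) = 0 then 0 else (antiPoly N').coeff (k - 1)) := by split_ifs <;> rfl
  rw [this, hm.sub, hm.mul]

/-- The loop over the giant steps differentiates `φ * B ^ t` with respect to `B`. -/
theorem run_stepIII (hM : MulRoutine.Correct.{u} M) (B : Matrix (Fin n) (Fin n) R⟦X⟧)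
    (φ : Fin n → R⟦X⟧) {u : ℕ → Fin n → Ser R n} {j : ℕ}
    (hu : ∀ i < j, u i = fun l => jet n ((φ ᵥ* B ^ i) l)) (U : ℕ → Fin n → R⟦X⟧)
    {du : ℕ → Fin n → Ser R n} (hdu : ∀ i ≤ j, du i = fun l => jet n (U i l))
    (X : Matrix (Fin n) (Fin n) R⟦X⟧) :
    (stepIII M (fun i k => jet n (B i k)) u j du fun i k => jet n (X i k)).run =
      fun i k => jet n ((X + ∑ t ∈ Finset.range (j + 1), powDeriv B t (vecMulVec (U t) φ)) i
        k) := by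
  have hm := ser_models (R := R) hM n
  induction j generalizing U du X with
  | zero => simp [stepIII, powDeriv_zero]
  | succ j ih =>
    simp only [stepIII, Prog.run_bind]
    rw [hdu (j + 1) le_rfl, hdu j (by omega), hu j (by omega), hm.mulVec, hm.vecAdd, hm.outer,
      hm.matAdd, ih (fun i hi => hu i (by omega)) (Function.update U j (U j + B *ᵥ U (j + 1)))]
    · rw [Finset.sum_range_succ, Finset.sum_range_succ _ (j + 1), Finset.sum_range_succ,
        Function.update_self, add_vecMulVec, powDeriv_add, powDeriv_succ, mul_vecMulVec,
        vecMulVec_mul]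
      have : ∀ t ∈ Finset.range j, powDeriv B t
          (vecMulVec (Function.update U j (U j + B *ᵥ U (j + 1)) t) φ) =
            powDeriv B t (vecMulVec (U t) φ) := fun t ht => by
        rw [Function.update_of_ne (Finset.mem_range.1 ht).ne]
      rw [Finset.sum_congr rfl this]
      funext i k
      refine congrArg (jet n) (congrFun (congrFun ?_ i) k)
      abel
    · intro i hi
      rcases hi.eq_or_lt with rfl | hi
      · rw [Function.update_self, Function.update_self]
      · rw [Function.update_of_ne hi.ne, Function.update_of_ne hi.ne, hdu i (by omega)]

/-- The loop over the baby steps differentiates `Z ^ t * ψ` with respect to `Z`. -/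
theorem run_stepV (hM : MulRoutine.Correct.{u} M) (Z : Matrix (Fin n) (Fin n) R⟦X⟧)
    (ψ : Fin n → R⟦X⟧) {v : ℕ → Fin n → Ser R n} {j : ℕ}
    (hv : ∀ i < j, v i = fun l => jet n ((Z ^ i *ᵥ ψ) l)) (V : ℕ → Fin n → R⟦X⟧)
    {dv : ℕ → Fin n → Ser R n} (hdv : ∀ i ≤ j, dv i = fun l => jet n (V i l))
    (X : Matrix (Fin n) (Fin n) R⟦X⟧) :
    (stepV M (fun i k => jet n (Z i k)) v j dv fun i k => jet n (X i k)).run =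
      fun i k => jet n ((X + ∑ t ∈ Finset.range (j + 1), powDeriv Z t (vecMulVec ψ (V t))) i
        k) := by
  have hm := ser_models (R := R) hM n
  induction j generalizing V dv X with
  | zero => simp [stepV, powDeriv_zero]
  | succ j ih =>
    simp only [stepV, Prog.run_bind]
    rw [hdv (j + 1) le_rfl, hdv j (by omega), hv j (by omega), hm.vecMul, hm.vecAdd, hm.outer,
      hm.matAdd, ih (fun i hi => hv i (by omega)) (Function.update V j (V j + V (j + 1) ᵥ* Z))]
    · rw [Finset.sum_range_succ, Finset.sum_range_succ _ (j + 1), Finset.sum_range_succ,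
        Function.update_self, vecMulVec_add, powDeriv_add, powDeriv_add_exp, powDeriv_one,
        ← vecMulVec_mul, powDeriv_mul_right (Commute.refl Z), pow_one, mul_vecMulVec]
      have : ∀ t ∈ Finset.range j, powDeriv Z t
          (vecMulVec ψ (Function.update V j (V j + V (j + 1) ᵥ* Z) t)) =
            powDeriv Z t (vecMulVec ψ (V t)) := fun t ht => by
        rw [Function.update_of_ne (Finset.mem_range.1 ht).ne]
      rw [Finset.sum_congr rfl this]
      funext i k
      refine congrArg (jet n) (congrFun (congrFun ?_ i) k)
      abel
    · intro i hi
      rcases hi.eq_or_lt with rfl | hi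
      · rw [Function.update_self, Function.update_self]
      · rw [Function.update_of_ne hi.ne, Function.update_of_ne hi.ne, hdv i (by omega)]

end Steps

section Splitting

open Matrix

variable {Q : Type*} [CommRing Q] {n : ℕ}

theorem sum_range_mul_range {α : Type*} [AddCommMonoid α] (F : ℕ → α) (r s : ℕ) :
    ∑ t ∈ Finset.range s, ∑ i ∈ Finset.range r, F (i + t * r) =
      ∑ k ∈ Finset.range (s * r), F k := by
  induction s with
  | zero => simp
  | succ s ih =>
    rw [Finset.sum_range_succ, ih, Nat.succ_mul, Finset.sum_range_add]
    simp only [add_comm]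

theorem sum_smul_vecMulVec {ι : Type*} (s : Finset ι) (c : ι → Q) (x : ι → Fin n → Q)
    (y : Fin n → Q) : vecMulVec (∑ i ∈ s, c i • x i) y = ∑ i ∈ s, c i • vecMulVec (x i) y := by
  ext a b
  simp [vecMulVec_apply, Matrix.sum_apply, Finset.sum_mul, mul_assoc]

theorem vecMulVec_sum_smul {ι : Type*} (s : Finset ι) (c : ι → Q) (x : Fin n → Q)
    (y : ι → Fin n → Q) : vecMulVec x (∑ i ∈ s, c i • y i) = ∑ i ∈ s, c i • vecMulVec x (y i) := by
  ext a b
  simp only [vecMulVec_apply, Matrix.sum_apply, Finset.sum_apply, Finset.mul_sum, Pi.smul_apply,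
    Matrix.smul_apply, smul_eq_mul]
  exact Finset.sum_congr rfl fun i _ => by ring

/-- The moments with the indices `k = i + t * r` are `(φ * B ^ t) * (Z ^ i * ψ)` with `B = Z ^ r`;
by the product rule their derivatives split into contributions of the baby steps `i` and of the
giant steps `t`. -/
theorem sum_powDeriv_split (Z : Matrix (Fin n) (Fin n) Q) (φ ψ : Fin n → Q) (w : ℕ → Q)
    (r s : ℕ) :
    ∑ k ∈ Finset.range (s * r), w k • powDeriv Z k (vecMulVec ψ φ) =
      powDeriv Z r (∑ t ∈ Finset.range s, powDeriv (Z ^ r) t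
        (vecMulVec (∑ i ∈ Finset.range r, w (i + t * r) • (Z ^ i *ᵥ ψ)) φ)) +
      ∑ i ∈ Finset.range r, powDeriv Z i
        (vecMulVec ψ (∑ t ∈ Finset.range s, w (i + t * r) • (φ ᵥ* (Z ^ r) ^ t))) := by
  rw [← sum_range_mul_range, powDeriv_sum]
  simp only [sum_smul_vecMulVec, vecMulVec_sum_smul, powDeriv_sum, powDeriv_smul,
    ← powDeriv_mul_exp]
  rw [Finset.sum_comm (s := Finset.range r), ← Finset.sum_add_distrib]
  refine Finset.sum_congr rfl fun t _ => ?_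
  rw [← Finset.sum_add_distrib]
  refine Finset.sum_congr rfl fun i _ => ?_
  rw [← smul_add, mul_comm t r, powDeriv_add_exp, ← mul_vecMulVec, ← vecMulVec_mul,
    powDeriv_mul_left (Commute.self_pow Z i), ← pow_mul,
    powDeriv_mul_right (Commute.self_pow Z (r * t))]

end Splitting

/-! ### The lazy evaluation -/

section Lazy

open PowerSeries Matrix

variable {R : Type u} [CommRing R] {n : ℕ} {M : MulRoutine}

theorem polyPencil_eval_one (A : Matrix (Fin n) (Fin n) R) :
    (polyPencil A).map (Polynomial.evalRingHom (1 : R)) = A := by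
  ext i j
  simp [polyPencil]

theorem map_powDeriv {Q Q' : Type*} [CommRing Q] [CommRing Q'] (F : Q →+* Q')
    (Z X : Matrix (Fin n) (Fin n) Q) (r : ℕ) :
    (powDeriv Z r X).map F = powDeriv (Z.map F) r (X.map F) := by
  have h : ∀ Y : Matrix (Fin n) (Fin n) Q, Y.map F = F.mapMatrix Y := fun _ => rfl
  simp only [h, powDeriv, map_sum, map_mul, map_pow]

/-- The sum of the coefficients up to degree `d`. For a polynomial of degree at most `d` this is the
value at `1`. -/
noncomputable def coeffSum (d : ℕ) : R⟦X⟧ →+ R where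
  toFun p := ∑ k : Fin (d + 1), coeff k p
  map_zero' := by simp
  map_add' p q := by simp [Finset.sum_add_distrib]

theorem coeffSum_apply (d : ℕ) (p : R⟦X⟧) : coeffSum d p = ∑ k : Fin (d + 1), coeff k p := rfl

theorem coeffSum_coe {d : ℕ} {p : Polynomial R} (hp : p.natDegree ≤ d) :
    coeffSum d (p : R⟦X⟧) = p.eval 1 := by
  rw [coeffSum_apply, Polynomial.eval_eq_sum_range' (Nat.lt_succ_of_le hp), Finset.sum_range]
  simp

theorem coeffSum_X_pow_mul (d m : ℕ) (p : R⟦X⟧) : coeffSum (d + m) (X ^ m * p) = coeffSum d p := by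
  rw [coeffSum_apply, coeffSum_apply, Fin.sum_univ_eq_sum_range (fun k => coeff k (X ^ m * p)),
    Fin.sum_univ_eq_sum_range (fun k => coeff k p), show d + m + 1 = m + (d + 1) by omega,
    Finset.sum_range_add, Finset.sum_eq_zero, zero_add]
  · exact Finset.sum_congr rfl fun k _ => by rw [add_comm m k, coeff_X_pow_mul]
  · intro k hk
    rw [coeff_X_pow_mul', if_neg (by have := Finset.mem_range.1 hk; omega)]

theorem natDegree_powDeriv_le (A : Matrix (Fin n) (Fin n) R) {r e : ℕ} (hr : 1 ≤ r)
    {X : Matrix (Fin n) (Fin n) (Polynomial R)} (hX : ∀ i j, (X i j).natDegree ≤ e)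
    (i j : Fin n) : (powDeriv (polyPencil A) r X i j).natDegree ≤ r - 1 + e := by
  rw [powDeriv, Matrix.sum_apply]
  refine Polynomial.natDegree_sum_le_of_forall_le _ _ fun k hk => ?_
  have := Finset.mem_range.1 hk
  refine (natDegree_matrix_mul_le (natDegree_matrix_mul_le (natDegree_polyPencil_pow_le A _) hX)
    (natDegree_polyPencil_pow_le A k) i j).trans ?_
  omega

/-- Evaluation of the derivative of a power at a polynomial matrix. -/
theorem coeffSum_powDeriv (A : Matrix (Fin n) (Fin n) R) {r e d : ℕ} (hr : 1 ≤ r)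
    {X : Matrix (Fin n) (Fin n) (Polynomial R)} (hX : ∀ i j, (X i j).natDegree ≤ e)
    (hd : r - 1 + e ≤ d) (i j : Fin n) :
    coeffSum d (powDeriv (serPencil A) r
      (X.map (Polynomial.coeToPowerSeries.ringHom (R := R))) i j) =
        powDeriv A r (X.map (Polynomial.evalRingHom 1)) i j := by
  rw [serPencil, ← map_powDeriv, map_apply, Polynomial.coeToPowerSeries.ringHom_apply,
    coeffSum_coe ((natDegree_powDeriv_le A hr hX i j).trans hd)]
  conv_rhs => rw [← polyPencil_eval_one A, ← map_powDeriv]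
  rfl

theorem coeffSum_adjugate (A : Matrix (Fin n) (Fin n) R) (i j : Fin n) :
    coeffSum n ((serPencil A).adjugate i j) = A.adjugate i j := by
  have h1 : ((polyPencil A).adjugate i j).natDegree ≤ n := by
    rw [adjugate_apply]
    set C : Matrix (Fin n) (Fin n) R := of fun i j => ((kaltofenC n i j : ℤ) : R) with hC
    have : (polyPencil A).updateRow j (Pi.single i 1) =
        ((Polynomial.X : Polynomial R) • ((A - C).updateRow j 0).map Polynomial.C +
          (C.updateRow j (Pi.single i 1)).map Polynomial.C) := by
      ext1 a b
      by_cases ha : a = j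
      · subst ha
        simp [Pi.single_apply, apply_ite (Polynomial.C (R := R))]
      · simp [ha, polyPencil, hC]
        ring
    rw [this]
    exact (Polynomial.natDegree_det_X_add_C_le _ _).trans_eq (Fintype.card_fin n)
  have h2 := (Polynomial.coeToPowerSeries.ringHom (R := R)).map_adjugate (polyPencil A)
  have h3 := (Polynomial.evalRingHom (1 : R)).map_adjugate (polyPencil A)
  rw [RingHom.mapMatrix_apply, RingHom.mapMatrix_apply] at h2 h3
  rw [polyPencil_eval_one] at h3
  rw [serPencil, ← h2, ← h3, map_apply, map_apply, Polynomial.coeToPowerSeries.ringHom_apply,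
    coeffSum_coe h1]
  rfl

/-- The derivative of repeated squaring at a lower precision. -/
theorem run_matPowersDiff_resize (hM : MulRoutine.Correct.{u} M) {A : Matrix (Fin n) (Fin n) R}
    {f g : Polynomial R⟦X⟧} {D : DetData R n} (hD : DetSpec A f g D) {e : ℕ} (he : e ≤ baby n)
    (z : Fin n → Fin n → Ser R e) (X : Matrix (Fin n) (Fin n) R⟦X⟧) :
    ((ser M e).matPowersDiff (matResize e D.Z).run
      (get z fun q : Fin (baby n + 1) => (matResize e (D.powers q)).run) (baby n)
        fun i j => jet e (X i j)).run =
      fun i j => jet e (powDeriv (serPencil A) (baby n) X i j) := by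
  rw [hD.Z, run_matResize (.inl he)]
  refine (ser_models hM e).matPowersDiff _ _ _ (fun k => ?_) X
  have : baby n / 2 ^ k ≤ baby n := Nat.div_le_self _ _
  rw [get, dif_pos (by omega)]
  simp only [hD.powers, run_matResize (.inl he)]

/-- For the part of `∂B` of low degree, nothing is truncated modulo `z ^ (n + 1)`, and `z = 1` may
be substituted in advance. The contribution of the remaining part is divisible by
`z ^ (n - r + 2)`. -/
theorem run_stepIVLazy (hM : MulRoutine.Correct.{u} M) (hn : 1 ≤ n)
    {A : Matrix (Fin n) (Fin n) R} {f g : Polynomial R⟦X⟧} {D : DetData R n}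
    (hD : DetSpec A f g D) (P : Matrix (Fin n) (Fin n) R⟦X⟧) :
    (stepIVLazy M D fun i j => jet n (P i j)).run =
      fun i j => coeffSum n (powDeriv (serPencil A) (baby n) P i j) := by
  have hr := two_le_baby hn
  have hr' := baby_le hn
  obtain ⟨e, he⟩ : ∃ e, n + 2 - baby n = e + 1 := ⟨n + 1 - baby n, by omega⟩
  set high : Matrix (Fin n) (Fin n) R⟦X⟧ := of fun i j => mk fun k => coeff (k + (e + 1)) (P i j)
    with hhigh
  set low : Matrix (Fin n) (Fin n) (Polynomial R) := of fun i j => trunc (e + 1) (P i j) with hlow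
  set val : Matrix (Fin n) (Fin n) R := low.map (Polynomial.evalRingHom 1) with hval
  have h1 : (fun i j => fun k : Fin (baby n - 2 + 1) =>
      get 0 (jet n (P i j)) (n + 2 - baby n + k)) = fun i j => jet (baby n - 2) (high i j) := by
    funext i j k
    have := k.2
    simp only [he]
    rw [get, dif_pos (by omega), jet_apply, jet_apply, hhigh, of_apply, coeff_mk, add_comm (k : ℕ)]
  have h2 : ∀ i j, ∑ k : Fin (n + 2 - baby n), get 0 (jet n (P i j)) k = val i j := by
    intro i j
    rw [hval, map_apply, hlow, of_apply, Polynomial.coe_evalRingHom,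
      Polynomial.eval_eq_sum_range' (natDegree_trunc_lt (P i j) e), ← he, Finset.sum_range]
    refine Finset.sum_congr rfl fun k _ => ?_
    have := k.2
    rw [get, dif_pos (by omega), jet_apply, coeff_trunc, if_pos this, one_pow, mul_one]
  have h3 : P = low.map (Polynomial.coeToPowerSeries.ringHom (R := R)) +
      (X ^ (e + 1) : R⟦X⟧) • high := by
    ext1 i j
    rw [add_comm]
    exact eq_X_pow_mul_shift_add_trunc (e + 1) (P i j)
  simp only [stepIVLazy, Prog.run_bind, run_tab, run_lit, Int.cast_zero, h1, run_cellSum, h2,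
    run_serC]
  have h4 : (fun i j => jet (baby n - 1) (C (val i j))) = fun i j => jet (baby n - 1)
      (((low.map (Polynomial.evalRingHom 1)).map (Polynomial.C : R →+* Polynomial R)).map
        (Polynomial.coeToPowerSeries.ringHom (R := R)) i j) := by
    funext i j
    simp [hval]
  rw [run_matPowersDiff_resize hM hD (by omega), run_matEvalOne, h4,
    run_matPowersDiff_resize hM hD (by omega), run_matEvalOne]
  funext i j
  have e1 := coeffSum_powDeriv A (r := baby n) (e := e) (d := n) (X := low) (by omega)
    (fun i j => Nat.le_of_lt_succ (natDegree_trunc_lt (P i j) e))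
    (by omega) i j
  have e2 := coeffSum_powDeriv A (r := baby n) (e := 0) (d := baby n - 1)
    (X := (low.map (Polynomial.evalRingHom 1)).map (Polynomial.C : R →+* Polynomial R)) (by omega)
    (fun i j => by simp) (by omega) i j
  have e3 : ((low.map (Polynomial.evalRingHom 1)).map (Polynomial.C : R →+* Polynomial R)).map
      (Polynomial.evalRingHom 1) = low.map (Polynomial.evalRingHom 1) := by
    ext; simp
  have e4 := coeffSum_X_pow_mul (baby n - 2) (e + 1) (powDeriv (serPencil A) (baby n) high i j)
  rw [show baby n - 2 + (e + 1) = n by omega] at e4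
  rw [e3] at e2
  conv_rhs => rw [h3, powDeriv_add, powDeriv_smul, Matrix.add_apply, Matrix.smul_apply,
    smul_eq_mul, map_add, e4, e1, ← e2]
  exact add_comm _ _

end Lazy

/-! ### Correctness of the adjoint algorithm -/

section Correctness

open PowerSeries Matrix

variable {R : Type u} [CommRing R] {n : ℕ} {M : MulRoutine}

theorem run_adjointAlg (hM : MulRoutine.Correct.{u} M) (hn : 1 ≤ n)
    (A : Matrix (Fin n) (Fin n) R) : (adjointAlg M A).run = A.adjugate := by
  rcases subsingleton_or_nontrivial R with hR | hR
  · exact Subsingleton.elim _ _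
  have hr := two_le_baby hn
  have hs := one_le_giant hn
  have hm := ser_models (R := R) hM n
  obtain ⟨f, g, hp, hD⟩ := run_detAlg hM hn A
  obtain ⟨w₀, hw₀, hadj⟩ := run_stepI hM hn A hp hD
  obtain ⟨w, hw⟩ : ∃ w : ℕ → R⟦X⟧, ∀ k, w k = if k < 2 * n then w₀ k else 0 := ⟨_, fun _ => rfl⟩
  set Z := serPencil A with hZ
  set φ := serPhi R n with hφ
  set ψ := serPsi R n with hψ
  set U : ℕ → Fin n → R⟦X⟧ := fun t =>
    ∑ i ∈ Finset.range (baby n), w (i + t * baby n) • (Z ^ i *ᵥ ψ) with hU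
  set V : ℕ → Fin n → R⟦X⟧ := fun i =>
    ∑ t ∈ Finset.range (giant n), w (i + t * baby n) • (φ ᵥ* (Z ^ baby n) ^ t) with hV
  have hadj' : Z.adjugate = powDeriv Z (baby n) (∑ t ∈ Finset.range (giant n),
      powDeriv (Z ^ baby n) t (vecMulVec (U t) φ)) +
        ∑ i ∈ Finset.range (baby n), powDeriv Z i (vecMulVec ψ (V i)) := by
    rw [← sum_powDeriv_split, hadj]
    refine (Finset.sum_congr rfl fun k hk => ?_).trans
      (Finset.sum_subset (Finset.range_subset_range.2 ?_) fun k _ hk => ?_)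
    · rw [hw, if_pos (Finset.mem_range.1 hk)]
    · rw [mul_comm (giant n)]
      exact two_mul_le_baby_mul_giant hn
    · rw [hw, if_neg (by simpa using hk), zero_smul]
  have hdH : (fun (i : Fin (baby n)) (j : Fin (giant n)) =>
      get (jet n 0) (fun k : Fin (2 * n) => jet n (w₀ k)) (i + j * baby n)) =
        fun i j => jet n ((of fun (i : Fin (baby n)) (j : Fin (giant n)) =>
          w (i + j * baby n)) i j) := by
    funext i j
    rw [get, of_apply, hw]
    split_ifs <;> rfl
  have hv : (fun (l : Fin n) (i : Fin (baby n)) => (detAlg M A).run.v i l) =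
      fun l i => jet n ((of fun l (i : Fin (baby n)) => (Z ^ (i : ℕ) *ᵥ ψ) l) l i) := by
    funext l i
    rw [hD.v i i.2]
    rfl
  have hu : (fun (j : Fin (giant n)) (l : Fin n) => (detAlg M A).run.u j l) =
      fun j l => jet n ((of fun (j : Fin (giant n)) l => (φ ᵥ* (Z ^ baby n) ^ (j : ℕ)) l) j l) := by
    funext j l
    rw [hD.u j j.2]
    rfl
  have hdu : ∀ i ≤ giant n - 1, (fun l : Fin n => get (jet n 0) (fun j : Fin (giant n) =>
      jet n (((of fun l (i : Fin (baby n)) => (Z ^ (i : ℕ) *ᵥ ψ) l) *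
        (of fun (i : Fin (baby n)) (j : Fin (giant n)) => w (i + j * baby n))) l j)) i) =
          fun l => jet n (U i l) := by
    intro i hi
    funext l
    rw [get, dif_pos (by omega), mul_apply]
    congr 1
    simp only [hU, Finset.sum_apply, Pi.smul_apply, smul_eq_mul, of_apply]
    rw [Finset.sum_range]
    exact Finset.sum_congr rfl fun k _ => mul_comm _ _
  have hdv : ∀ i ≤ baby n - 1, get (fun _ => jet n 0) (fun (i : Fin (baby n)) (l : Fin n) =>
      jet n (((of fun (i : Fin (baby n)) (j : Fin (giant n)) => w (i + j * baby n)) *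
        (of fun (j : Fin (giant n)) l => (φ ᵥ* (Z ^ baby n) ^ (j : ℕ)) l)) i l)) i =
          fun l => jet n (V i l) := by
    intro i hi
    funext l
    rw [get, dif_pos (by omega), mul_apply]
    congr 1
    simp only [hV, Finset.sum_apply, Pi.smul_apply, smul_eq_mul, of_apply]
    rw [Finset.sum_range]
  have hZn : (matResize n (detAlg M A).run.Z).run = fun i j => jet n (Z i j) := by
    rw [hD.Z]
    refine run_matResize (.inr fun i j k hk => ?_)
    rw [← pow_one (serPencil A)]
    exact coeff_serPencil_pow A (by omega) i j
  change Prog.run (α := Fin n → Fin n → R) (adjointAlg M A) = _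
  simp only [adjointAlg, Prog.run_bind, run_tab, hw₀, hm.zero, hdH, hv, hu, hm.matMul, hm.matZero,
    hD.B, hZn]
  rw [run_stepIII hM _ φ (fun i hi => hD.u i (by omega)) U hdu,
    run_stepV hM _ ψ (fun i hi => hD.v i (by omega)) V hdv, run_stepIVLazy hM hn hD,
    run_matEvalOne, show giant n - 1 + 1 = giant n by omega,
    show baby n - 1 + 1 = baby n by omega, zero_add, zero_add]
  funext i j
  rw [← coeffSum_adjugate, ← hZ, hadj', Matrix.add_apply, map_add]
  rfl

end Correctness

/-! ### Costs of loops and of linear algebra -/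

section Cost

theorem clog_two_succ {r : ℕ} (hr : r ≠ 0) :
    Nat.clog 2 (r + 1) = Nat.clog 2 (r / 2 + 1) + 1 := by
  rw [Nat.clog_of_two_le (by norm_num) (by omega), show (r + 1 + 2 - 1) / 2 = r / 2 + 1 by omega]

theorem sq_mul_le (n c : ℕ) : n * (n * c) ≤ n * (n * ((2 * n + 1) * c)) :=
  Nat.mul_le_mul_left _ (Nat.mul_le_mul_left _ (Nat.le_mul_of_pos_left _ (by omega)))

variable {R : Type u} [CommRing R] {α β : Type u}

@[simp] theorem cost_pure (a : α) : (pure a : Prog R α).cost = 0 := rfl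

@[simp] theorem cost_bind (p : Prog R α) (f : α → Prog R β) :
    (p >>= f).cost = p.cost + (f p.run).cost := by
  change (Prog.bind p f).cost = _
  induction p with
  | ret a => simp [Prog.bind, Prog.cost, Prog.run]
  | const c k ih => simp only [Prog.bind, Prog.cost, Prog.run, ih]; omega
  | add x y k ih => simp only [Prog.bind, Prog.cost, Prog.run, ih]; omega
  | sub x y k ih => simp only [Prog.bind, Prog.cost, Prog.run, ih]; omega
  | mul x y k ih => simp only [Prog.bind, Prog.cost, Prog.run, ih]; omega

theorem cost_call {q m : ℕ} (p : SLP q m) (x : Fin m → R) : (p.call x).cost = p.size := by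
  induction p with
  | out o => rfl
  | const c p ih => simp only [SLP.call, Prog.cost, SLP.size, ih]
  | add j k p ih => simp only [SLP.call, Prog.cost, SLP.size, ih]
  | sub j k p ih => simp only [SLP.call, Prog.cost, SLP.size, ih]
  | mul j k p ih => simp only [SLP.call, Prog.cost, SLP.size, ih]

theorem cost_tab_le {m c : ℕ} {f : Fin m → Prog R α} (h : ∀ i, (f i).cost ≤ c) :
    (tab f).cost ≤ m * c := by
  induction m with
  | zero => simp [tab]
  | succ m ih =>
    simp only [tab, cost_bind, cost_pure]
    have h1 := h 0
    have h2 := ih (f := fun i => f i.succ) fun i => h i.succ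
    rw [Nat.succ_mul]
    omega

theorem cost_iterates_le {f : α → Prog R α} {c : ℕ} (h : ∀ x, (f x).cost ≤ c) (a : α) (m : ℕ) :
    (iterates f a m).cost ≤ m * c := by
  induction m with
  | zero => simp [iterates]
  | succ m ih =>
    simp only [iterates, cost_bind, cost_pure]
    have h1 := h ((iterates f a m).run m)
    rw [Nat.succ_mul]
    omega

namespace Arith

variable {S : Type u}

/-- Every operation of the arithmetic `K` takes at most `c` instructions. -/
structure CostLE (K : Arith R S) (c : ℕ) : Prop where
  zero : K.zero.cost ≤ c
  one : K.one.cost ≤ c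
  add (a b : S) : (K.add a b).cost ≤ c
  sub (a b : S) : (K.sub a b).cost ≤ c
  mul (a b : S) : (K.mul a b).cost ≤ c

namespace CostLE

variable {K : Arith R S} {c : ℕ} (h : K.CostLE c)

include h

theorem sum {m : ℕ} (f : Fin m → S) : (K.sum f).cost ≤ (m + 1) * c := by
  induction m with
  | zero => simpa [Arith.sum] using h.zero
  | succ m ih =>
    simp only [Arith.sum, cost_bind]
    have h1 := ih fun i => f i.castSucc
    have h2 := h.add (K.sum fun i => f i.castSucc).run (f (Fin.last m))
    rw [Nat.succ_mul (m + 1)]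
    omega

theorem dot {m : ℕ} (x y : Fin m → S) : (K.dot x y).cost ≤ (2 * m + 1) * c := by
  simp only [Arith.dot, cost_bind]
  refine (add_le_add (cost_tab_le fun i => h.mul _ _) (h.sum _)).trans_eq ?_
  ring

theorem vecAdd {m : ℕ} (x y : Fin m → S) : (K.vecAdd x y).cost ≤ m * c :=
  cost_tab_le fun _ => h.add _ _

theorem vecMul {a b : ℕ} (x : Fin a → S) (M : Fin a → Fin b → S) :
    (K.vecMul x M).cost ≤ b * ((2 * a + 1) * c) :=
  cost_tab_le fun _ => h.dot _ _

theorem mulVec {a b : ℕ} (M : Fin a → Fin b → S) (x : Fin b → S) :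
    (K.mulVec M x).cost ≤ a * ((2 * b + 1) * c) :=
  cost_tab_le fun _ => h.dot _ _

theorem outer {a b : ℕ} (x : Fin a → S) (y : Fin b → S) : (K.outer x y).cost ≤ a * (b * c) :=
  cost_tab_le fun _ => cost_tab_le fun _ => h.mul _ _

theorem matAdd {a b : ℕ} (M N : Fin a → Fin b → S) : (K.matAdd M N).cost ≤ a * (b * c) :=
  cost_tab_le fun _ => h.vecAdd _ _

theorem matMul {a b d : ℕ} (M : Fin a → Fin b → S) (N : Fin b → Fin d → S) :
    (K.matMul M N).cost ≤ a * (d * ((2 * b + 1) * c)) :=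
  cost_tab_le fun _ => h.vecMul _ _

theorem matZero (a b : ℕ) : (K.matZero a b).cost ≤ a * (b * c) :=
  cost_tab_le fun _ => cost_tab_le fun _ => h.zero

theorem matOne (a : ℕ) : (K.matOne a).cost ≤ a * (a * c) :=
  cost_tab_le fun _ => cost_tab_le fun _ => by split_ifs; exacts [h.one, h.zero]

variable {n : ℕ}

theorem matPowers (M : Fin n → Fin n → S) (r : ℕ) :
    (K.matPowers M r).cost ≤ (2 * Nat.clog 2 (r + 1) + 1) * (n * (n * ((2 * n + 1) * c))) := by
  induction r using Nat.strong_induction_on with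
  | _ r ih =>
    rw [Arith.matPowers]
    split_ifs with hr h2
    · simp only [cost_bind, cost_pure]
      refine (h.matOne n).trans ((sq_mul_le n c).trans (Nat.le_mul_of_pos_left _ (by omega)))
    all_goals
      have h0 := ih (r / 2) (by omega)
      rw [clog_two_succ hr]
      generalize Nat.clog 2 (r / 2 + 1) = l at h0
      have h1 := fun A B : Fin n → Fin n → S => h.matMul A B
      simp only [cost_bind, cost_pure]
    · refine (add_le_add h0 (add_le_add (h1 _ _) le_rfl)).trans ?_
      rw [show 2 * (l + 1) + 1 = 2 * l + 1 + 2 by ring, add_mul (2 * l + 1) 2]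
      omega
    · refine (add_le_add h0 (add_le_add (h1 _ _) (add_le_add (h1 _ _) le_rfl))).trans ?_
      rw [show 2 * (l + 1) + 1 = 2 * l + 1 + 2 by ring, add_mul (2 * l + 1) 2]
      omega

theorem matPowersDiff (M : Fin n → Fin n → S) (T : ℕ → Fin n → Fin n → S) (r : ℕ)
    (X : Fin n → Fin n → S) : (K.matPowersDiff M T r X).cost ≤
      (7 * Nat.clog 2 (r + 1) + 1) * (n * (n * ((2 * n + 1) * c))) := by
  have hsq := sq_mul_le n c
  induction r using Nat.strong_induction_on generalizing X with
  | _ r ih =>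
    rw [Arith.matPowersDiff]
    split_ifs with hr h2
    · exact (h.matZero n n).trans (hsq.trans (Nat.le_mul_of_pos_left _ (by omega)))
    all_goals
      have h0 := fun X => ih (r / 2) (by omega) X
      rw [clog_two_succ hr]
      generalize Nat.clog 2 (r / 2 + 1) = l at h0
      have h1 := fun A B : Fin n → Fin n → S => h.matMul A B
      have h3 := fun A B : Fin n → Fin n → S => (h.matAdd A B).trans hsq
      rw [show (7 * (l + 1) + 1) = 7 * l + 1 + 7 by ring, add_mul]
      simp only [cost_bind]
    · refine (add_le_add (h1 _ _) (add_le_add (h1 _ _) (add_le_add (h3 _ _) (h0 _)))).trans ?_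
      omega
    · refine (add_le_add (h1 _ _) (add_le_add (h1 _ _) (add_le_add (h1 _ _) (add_le_add (h1 _ _)
        (add_le_add (h1 _ _) (add_le_add (h3 _ _) (add_le_add (h0 _) (h3 _ _)))))))).trans ?_
      omega

end CostLE

end Arith

end Cost

/-! ### Costs of the power series programs -/

section SeriesCost

variable {R : Type u} [CommRing R] {M : MulRoutine} {d : ℕ}

/-- A bound for the cost of an operation on power series modulo `z ^ (d + 1)`. -/
def serCost (M : MulRoutine) (d : ℕ) : ℕ := (M d).size + d + 2

@[simp] theorem cost_lit (c : ℤ) : (lit c : Prog R R).cost = 1 := rfl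

@[simp] theorem cost_serC (d : ℕ) (c : R) : (serC d c).cost = 1 := by simp [serC]

@[simp] theorem cost_serLit (d : ℕ) (c : ℤ) : (serLit d c : Prog R _).cost = 2 := by simp [serLit]

theorem cost_ser (M : MulRoutine) (d : ℕ) :
    (ser M d : Arith R (Ser R d)).CostLE (serCost M d) where
  zero := by simp [ser, serCost]
  one := by simp [ser, serCost]
  add a b := by
    have : ((ser M d).add a b : Prog R _).cost ≤ (d + 1) * 1 := cost_tab_le fun _ => le_rfl
    rw [serCost]; omega
  sub a b := by
    have : ((ser M d).sub a b : Prog R _).cost ≤ (d + 1) * 1 := cost_tab_le fun _ => le_rfl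
    rw [serCost]; omega
  mul a b := by
    simp only [ser, cost_bind, cost_call, cost_pure, serCost]
    omega

theorem cost_serScale (M : MulRoutine) (c : ℤ) (a : Ser R d) :
    (serScale c a).cost ≤ serCost M d := by
  have h : (tab fun i => Prog.mul ((lit c : Prog R R).run) (a i) .ret).cost ≤ (d + 1) * 1 :=
    cost_tab_le fun _ => le_rfl
  simp only [serScale, cost_bind, cost_lit, serCost]
  omega

theorem cost_serInv (M : MulRoutine) (a : Ser R d) :
    (serInv M a).cost ≤ (3 * Nat.clog 2 (d + 1) + 2) * serCost M d := by
  have h := cost_ser (R := R) M d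
  have h2 : 2 ≤ serCost M d := by rw [serCost]; omega
  simp only [serInv, cost_bind, cost_serLit, cost_serC, cost_pure]
  refine (add_le_add_right (add_le_add_right (add_le_add_left
    (cost_iterates_le (c := 3 * serCost M d) (fun x => ?_) _ _) _) _) _).trans ?_
  · simp only [cost_bind]
    refine (add_le_add (h.mul _ _) (add_le_add (h.sub _ _) (h.mul _ _))).trans_eq ?_
    ring
  · nlinarith

@[simp] theorem cost_serResize (e : ℕ) (a : Ser R d) : (serResize e a).cost = 1 := by
  simp [serResize]

theorem cost_matResize {a b : ℕ} (e : ℕ) (X : Fin a → Fin b → Ser R d) :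
    (matResize e X).cost ≤ a * b := by
  refine (cost_tab_le (c := b * 1) fun i => cost_tab_le fun j => ?_).trans_eq (by rw [mul_one])
  rw [cost_serResize]

theorem cost_cellSum {m : ℕ} (f : Fin m → R) : (cellSum f).cost = m + 1 := by
  induction m with
  | zero => rfl
  | succ m ih => simp [cellSum, ih, Prog.cost]

theorem cost_matEvalOne {a b : ℕ} (X : Fin a → Fin b → Ser R d) :
    (matEvalOne X).cost ≤ a * (b * (d + 2)) :=
  cost_tab_le fun _ => cost_tab_le fun _ => by rw [cost_cellSum]

theorem cost_pencil (d : ℕ) {n : ℕ} (A : Fin n → Fin n → R) : (pencil d A).cost ≤ n * (n * 3) :=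
  cost_tab_le fun _ => cost_tab_le fun _ => by simp [Prog.cost]

/-! ### Costs of the Hankel computations -/

theorem cost_polyReduce (L : ℕ) (q₁ q₀ : Ser R d) (p c : ℕ → Ser R d) :
    (polyReduce M L q₁ q₀ p c).cost ≤ (4 * L + 1) * serCost M d := by
  have h := cost_ser (R := R) M d
  simp only [polyReduce, cost_bind, cost_pure]
  refine (add_le_add h.zero (add_le_add_left (cost_tab_le (c := 4 * serCost M d) fun i => ?_)
    _)).trans_eq ?_
  · simp only [cost_bind]
    refine (add_le_add (h.mul _ _) (add_le_add (h.mul _ _)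
      (add_le_add (h.sub _ _) (h.sub _ _)))).trans_eq ?_
    ring
  · ring

theorem cost_euclidStep (n e : ℕ) (st : EuclidState (Ser R d)) :
    (euclidStep M n e st).cost ≤ (3 * Nat.clog 2 (d + 1) + 12 * n + 16) * serCost M d := by
  have h := cost_ser (R := R) M d
  simp only [euclidStep, cost_bind, cost_pure]
  refine (add_le_add (cost_serInv M _) (add_le_add (h.mul _ _) (add_le_add (h.mul _ _)
    (add_le_add (h.sub _ _) (add_le_add (h.mul _ _) (add_le_add (cost_polyReduce _ _ _ _ _)
    (add_le_add_left (cost_polyReduce _ _ _ _ _) _))))))).trans_eq ?_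
  ring

theorem cost_euclid (n : ℕ) (h : ℕ → Ser R d) (i : ℕ) :
    (euclid M n h i).cost ≤
      (i * (3 * Nat.clog 2 (d + 1) + 12 * n + 16) + 2) * serCost M d := by
  have hc := cost_ser (R := R) M d
  induction i with
  | zero =>
    simp only [euclid, cost_bind, cost_pure]
    refine (add_le_add hc.zero (add_le_add_left hc.one _)).trans_eq ?_
    ring
  | succ i ih =>
    simp only [euclid, cost_bind]
    refine (add_le_add ih (cost_euclidStep _ _ _)).trans_eq ?_
    ring

theorem cost_minPolyAndColumn (n : ℕ) (h : ℕ → Ser R d) :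
    (minPolyAndColumn M n h).cost ≤
      (n * (3 * Nat.clog 2 (d + 1) + 12 * n + 18) + 6 * Nat.clog 2 (d + 1) + 8) * serCost M d := by
  have hc := cost_ser (R := R) M d
  simp only [minPolyAndColumn, cost_bind, cost_pure]
  refine (add_le_add hc.zero (add_le_add (cost_euclid _ _ _) (add_le_add (cost_serInv M _)
    (add_le_add (cost_serInv M _) (add_le_add (cost_tab_le fun i => hc.mul _ _)
    (add_le_add_left (cost_tab_le fun i => hc.mul _ _) _)))))).trans_eq ?_
  ring

theorem cost_wronskian (n : ℕ) (p q v w : ℕ → Ser R d) :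
    (wronskian M n p q v w).cost ≤ (n * (4 * n + 5)) * serCost M d := by
  have hc := cost_ser (R := R) M d
  simp only [wronskian, cost_bind]
  refine (add_le_add (cost_tab_le fun i => cost_serScale M _ _) (add_le_add
    (cost_tab_le fun i => cost_serScale M _ _)
    (cost_tab_le (c := (4 * n + 3) * serCost M d) fun k => ?_))).trans_eq ?_
  · have hk : (2 * ((k : ℕ) + 1) + 1) * serCost M d ≤ (2 * n + 1) * serCost M d :=
      Nat.mul_le_mul_right _ (by omega)
    simp only [cost_bind]
    refine (add_le_add ((hc.dot _ _).trans hk) (add_le_add ((hc.dot _ _).trans hk)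
      (hc.sub _ _))).trans_eq ?_
    ring
  · ring

theorem cost_antiDiagonalSums (n : ℕ) (f g : ℕ → Ser R d) :
    (antiDiagonalSums M n f g).cost ≤ (2 * (n * (4 * n + 5)) + 1) * serCost M d := by
  have hc := cost_ser (R := R) M d
  simp only [antiDiagonalSums, cost_bind, cost_pure]
  refine (add_le_add hc.zero (add_le_add (cost_wronskian _ _ _ _ _)
    (add_le_add_left (cost_wronskian _ _ _ _ _) _))).trans_eq ?_
  ring

theorem cost_shiftedColumn (n : ℕ) (f g : ℕ → Ser R d) :
    (shiftedColumn M n f g).cost ≤ (3 * Nat.clog 2 (d + 1) + 2 * n + 4) * serCost M d := by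
  have hc := cost_ser (R := R) M d
  simp only [shiftedColumn, cost_bind, cost_pure]
  refine (add_le_add hc.zero (add_le_add (cost_serInv M _) (add_le_add (hc.mul _ _)
    (add_le_add_left (cost_tab_le (c := 2 * serCost M d) fun i => ?_) _)))).trans_eq ?_
  · simp only [cost_bind]
    refine (add_le_add (hc.mul _ _) (hc.sub _ _)).trans_eq ?_
    ring
  · ring

theorem cost_stepI {n : ℕ} (D : DetData R n) :
    (stepI M D).cost ≤
      (4 * (n * (4 * n + 5)) + 3 * Nat.clog 2 (n + 1) + 6 * n + 7) * serCost M n := by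
  have hc := cost_ser (R := R) M n
  simp only [stepI, cost_bind]
  refine (add_le_add hc.zero (add_le_add (cost_shiftedColumn _ _ _) (add_le_add
    (cost_antiDiagonalSums _ _ _) (add_le_add (cost_antiDiagonalSums _ _ _)
    (cost_tab_le (c := 2 * serCost M n) fun i => ?_))))).trans_eq ?_
  · simp only [cost_bind]
    refine (add_le_add (hc.sub _ _) (hc.mul _ _)).trans_eq ?_
    ring
  · ring

end SeriesCost

/-! ### The cost of the adjoint algorithm -/

section TotalCost

variable {R : Type u} [CommRing R] {M : MulRoutine} {n : ℕ}

theorem Arith.CostLE.mono {S : Type u} {K : Arith R S} {c c' : ℕ} (h : K.CostLE c) (hc : c ≤ c') :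
    K.CostLE c' :=
  ⟨h.zero.trans hc, h.one.trans hc, fun a b => (h.add a b).trans hc,
    fun a b => (h.sub a b).trans hc, fun a b => (h.mul a b).trans hc⟩

theorem cost_detAlg {b : ℕ} (hb : serCost M (baby n) ≤ b) (A : Fin n → Fin n → R) :
    (detAlg M A).cost ≤ 4 * (n * n) + 4 * n + baby n * n +
      (baby n - 1) * (n * ((2 * n + 1) * b)) +
      (2 * Nat.clog 2 (baby n + 1) + 1) * (n * (n * ((2 * n + 1) * b))) +
      (n + (giant n - 1) * (n * (2 * n + 1)) + baby n * (giant n * (2 * n + 1)) +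
        (n * (3 * Nat.clog 2 (n + 1) + 12 * n + 18) + 6 * Nat.clog 2 (n + 1) + 8) + 2) *
        serCost M n := by
  have hr := (cost_ser (R := R) M (baby n)).mono hb
  have hn := cost_ser (R := R) M n
  simp only [detAlg, cost_bind]
  refine (add_le_add (cost_pencil _ _) (add_le_add (cost_tab_le (c := 2) fun i => by
    rw [cost_serLit]) (add_le_add (cost_iterates_le (fun x => hr.mulVec _ _) _ _) (add_le_add
    (hr.matPowers _ _) (add_le_add (cost_matResize _ _) (add_le_add (cost_matResize _ _)
    (add_le_add (cost_tab_le fun i => hn.zero) (add_le_add (cost_tab_le (c := 2) fun i => by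
    rw [cost_serLit]) (add_le_add (cost_iterates_le (fun x => hn.vecMul _ _) _ _) (add_le_add
    (cost_tab_le fun i => cost_tab_le fun j => hn.dot _ _) (add_le_add hn.zero
    (add_le_add (cost_minPolyAndColumn _ _) (?_ : _ ≤ serCost M n))))))))))))).trans_eq ?_
  · split_ifs
    · simp
    · simpa using hn.sub _ _
  · ring

theorem cost_stepIII (B : Fin n → Fin n → Ser R n) (u : ℕ → Fin n → Ser R n) (j : ℕ)
    (du : ℕ → Fin n → Ser R n) (dB : Fin n → Fin n → Ser R n) :
    (stepIII M B u j du dB).cost ≤ j * (n * (4 * n + 2)) * serCost M n := by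
  have hc := cost_ser (R := R) M n
  induction j generalizing du dB with
  | zero => simp [stepIII]
  | succ j ih =>
    simp only [stepIII, cost_bind]
    refine (add_le_add (hc.mulVec _ _) (add_le_add (hc.vecAdd _ _) (add_le_add (hc.outer _ _)
      (add_le_add (hc.matAdd _ _) (ih _ _))))).trans_eq ?_
    ring

theorem cost_stepV (Z : Fin n → Fin n → Ser R n) (v : ℕ → Fin n → Ser R n) (j : ℕ)
    (dv : ℕ → Fin n → Ser R n) (X : Fin n → Fin n → Ser R n) :
    (stepV M Z v j dv X).cost ≤ j * (n * (4 * n + 2)) * serCost M n := by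
  have hc := cost_ser (R := R) M n
  induction j generalizing dv X with
  | zero => simp [stepV]
  | succ j ih =>
    simp only [stepV, cost_bind]
    refine (add_le_add (hc.vecMul _ _) (add_le_add (hc.vecAdd _ _) (add_le_add (hc.outer _ _)
      (add_le_add (hc.matAdd _ _) (ih _ _))))).trans_eq ?_
    ring

theorem cost_stepIVLazy (hr : 2 ≤ baby n) {b : ℕ} (hb : ∀ d ≤ baby n, serCost M d ≤ b)
    (D : DetData R n) (dB : Fin n → Fin n → Ser R n) :
    (stepIVLazy M D dB).cost ≤ 2 * ((7 * Nat.clog 2 (baby n + 1) + 1) *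
      (n * (n * ((2 * n + 1) * b)))) + 2 * (n * (n * b)) +
        n * n * (4 * baby n + n + 10) + 1 := by
  have h₁ := (cost_ser (R := R) M (baby n - 2)).mono (hb _ (by omega))
  have h₂ := (cost_ser (R := R) M (baby n - 1)).mono (hb _ (by omega))
  simp only [stepIVLazy, cost_bind, cost_lit]
  refine (add_le_add le_rfl (add_le_add (cost_matResize _ _) (add_le_add
    (cost_tab_le fun q => cost_matResize _ _) (add_le_add (h₁.matZero n n) (add_le_add
    (h₁.matPowersDiff _ _ _ _) (add_le_add (cost_matEvalOne _) (add_le_add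
    (cost_tab_le (c := n * (n + 4)) fun i => cost_tab_le fun j => ?_) (add_le_add
    (cost_matResize _ _) (add_le_add (cost_tab_le fun q => cost_matResize _ _) (add_le_add
    (h₂.matZero n n) (add_le_add (h₂.matPowersDiff _ _ _ _) (add_le_add (cost_matEvalOne _)
    (cost_tab_le (c := n * 1) fun i => cost_tab_le fun j => le_rfl))))))))))))).trans ?_
  · simp only [cost_bind, cost_cellSum, cost_serC]
    omega
  · obtain ⟨e, he⟩ : ∃ e, baby n = e + 2 := ⟨baby n - 2, by omega⟩
    rw [he]
    simp only [Nat.add_sub_cancel, show e + 2 - 1 = e + 1 by omega]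
    generalize (7 * Nat.clog 2 (e + 2 + 1) + 1) * (n * (n * ((2 * n + 1) * b))) = P
    nlinarith [Nat.zero_le (n * n)]

theorem cost_adjointAlg_le (hr : 2 ≤ baby n) {b : ℕ} (hb : ∀ d ≤ baby n, serCost M d ≤ b)
    (A : Matrix (Fin n) (Fin n) R) :
    (adjointAlg M A).cost ≤
      (4 * (n * n) + 4 * n + baby n * n +
        (baby n - 1) * (n * ((2 * n + 1) * b)) +
        (2 * Nat.clog 2 (baby n + 1) + 1) * (n * (n * ((2 * n + 1) * b))) +
        (n + (giant n - 1) * (n * (2 * n + 1)) + baby n * (giant n * (2 * n + 1)) +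
          (n * (3 * Nat.clog 2 (n + 1) + 12 * n + 18) + 6 * Nat.clog 2 (n + 1) + 8) + 2) *
          serCost M n) +
      ((4 * (n * (4 * n + 5)) + 3 * Nat.clog 2 (n + 1) + 6 * n + 7) * serCost M n) +
      (1 + n * (giant n * (2 * baby n + 1)) + baby n * (n * (2 * giant n + 1)) + 2 * (n * n) +
        (giant n - 1) * (n * (4 * n + 2)) + (baby n - 1) * (n * (4 * n + 2))) * serCost M n +
      (2 * ((7 * Nat.clog 2 (baby n + 1) + 1) * (n * (n * ((2 * n + 1) * b)))) +
        2 * (n * (n * b)) + n * n * (4 * baby n + n + 10) + 1) +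
      n * n * (n + 4) := by
  have hn := cost_ser (R := R) M n
  change Prog.cost (α := Fin n → Fin n → R) (adjointAlg M A) ≤ _
  simp only [adjointAlg, cost_bind]
  refine (add_le_add (cost_detAlg (hb _ le_rfl) _) (add_le_add (cost_stepI _) (add_le_add hn.zero
    (add_le_add (hn.matMul _ _) (add_le_add (hn.matMul _ _) (add_le_add (hn.matZero _ _)
    (add_le_add (cost_stepIII _ _ _ _ _) (add_le_add (cost_stepIVLazy hr hb _ _) (add_le_add
    (cost_matResize _ _) (add_le_add (hn.matZero _ _) (add_le_add (cost_stepV _ _ _ _ _)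
    (add_le_add (cost_matEvalOne _) (cost_tab_le (c := n * 1) fun i => cost_tab_le fun j =>
    le_rfl))))))))))))).trans_eq ?_
  ring

/-- The dominating terms are `n ^ 3` operations on short series for the baby steps, and
`n ^ 2 * (r + s)` operations on long series. -/
theorem cost_adjointAlg (hn : 1 ≤ n) {b : ℕ} (hb : ∀ d ≤ baby n, serCost M d ≤ b)
    (A : Matrix (Fin n) (Fin n) R) :
    (adjointAlg M A).cost ≤ 300 * ((Nat.clog 2 (n + 1) + 1) *
      (n ^ 3 * b + n ^ 2 * (baby n + giant n) * serCost M n)) := by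
  have hr := two_le_baby hn
  have hrn : baby n ≤ 2 * n := (baby_le hn).trans (by omega)
  have hs := one_le_giant hn
  have hsn := giant_le hn
  have hL : Nat.clog 2 (baby n + 1) ≤ Nat.clog 2 (n + 1) + 1 := by
    have h1 : Nat.clog 2 (2 * n + 1) = Nat.clog 2 (n + 1) + 1 := by
      rw [clog_two_succ (by omega), show 2 * n / 2 = n by omega]
    rw [← h1]
    exact Nat.clog_mono_right 2 (by omega)
  have hc : n + 2 ≤ serCost M n := by rw [serCost]; omega
  have h0 := cost_adjointAlg_le hr hb A
  have hs1 : giant n - 1 ≤ giant n := Nat.sub_le _ _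
  have hr1 : baby n - 1 ≤ baby n := Nat.sub_le _ _
  generalize serCost M n = c at *
  generalize giant n - 1 = s' at *
  generalize baby n - 1 = r' at *
  generalize Nat.clog 2 (baby n + 1) = L at *
  generalize Nat.clog 2 (n + 1) = K at *
  generalize baby n = r at *
  generalize giant n = s at *
  refine h0.trans ?_
  have hr0 : 1 ≤ r := by omega
  have hc0 : 1 ≤ c := by omega
  have hnc : n ≤ c := by omega
  -- multiples of the cost of long operations
  have a1 : c ≤ n * c := Nat.le_mul_of_pos_left _ hn
  have a2 : n * c ≤ n * n * c := by rw [mul_assoc]; exact Nat.le_mul_of_pos_left _ hn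
  have a3 : n * n * c ≤ n * n * s * c := by
    rw [mul_right_comm (n * n)]; exact Nat.le_mul_of_pos_right _ hs
  have a4 : s' * n * n * c ≤ s * n * n * c := by gcongr
  have a5 : s' * n * c ≤ s' * n * n * c := by
    rw [mul_right_comm (s' * n)]; exact Nat.le_mul_of_pos_right _ hn
  have a6 : r * s * n * c ≤ r * n * n * c := by gcongr
  have a7 : r * s * c ≤ r * s * n * c := by
    rw [mul_right_comm (r * s)]; exact Nat.le_mul_of_pos_right _ hn
  have a8 : r' * n * n * c ≤ r * n * n * c := by gcongr
  have a9 : r' * n * c ≤ r' * n * n * c := by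
    rw [mul_right_comm (r' * n)]; exact Nat.le_mul_of_pos_right _ hn
  have a10 : r * n * c ≤ r * n * n * c := by
    rw [mul_right_comm (r * n)]; exact Nat.le_mul_of_pos_right _ hn
  have a11 : n * s * c ≤ n * n * s * c := by
    rw [mul_assoc n n, mul_assoc n (n * s)]
    exact (mul_assoc n s c).le.trans (Nat.mul_le_mul_left _ (Nat.mul_le_mul_right _
      (Nat.le_mul_of_pos_left _ hn)))
  have a12 : K * (n * c) ≤ K * (n * n * s * c) := Nat.mul_le_mul_left _ (a2.trans a3)
  have a13 : K * c ≤ K * (n * c) := by gcongr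
  -- terms without multiplications of series
  have d1 : n * n * n ≤ n * n * c := by gcongr
  have d2 : n * n ≤ n * c := by gcongr
  have d3 : n ≤ n * n := Nat.le_mul_of_pos_left _ hn
  have d4 : n * n * r ≤ r * n * n * c := by
    rw [mul_comm (n * n), ← mul_assoc]; exact Nat.le_mul_of_pos_right _ hc0
  have d5 : r * n ≤ r * n * c := Nat.le_mul_of_pos_right _ hc0
  -- multiples of the cost of short operations
  have e1 : n * n * b ≤ n * n * n * b := by
    rw [mul_assoc (n * n)]; exact Nat.mul_le_mul_left _ (Nat.le_mul_of_pos_left _ hn)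
  have e2 : r' * (n * n * b) ≤ 2 * n * (n * n * b) := by gcongr; omega
  have e3 : r' * (n * b) ≤ 2 * n * (n * b) := by gcongr; omega
  have e4 : L * (n * n * n * b) ≤ (K + 1) * (n * n * n * b) := by gcongr
  have e5 : L * (n * n * b) ≤ L * (n * n * n * b) := by gcongr
  have K0 : 0 ≤ K * (r * n * n * c) := Nat.zero_le _
  have K2 : 0 ≤ r * n * n * c := Nat.zero_le _
  have K3 : 0 ≤ n * n * n * b := Nat.zero_le _
  have K4 : 0 ≤ n * n * s * c := Nat.zero_le _
  have K5 : 0 ≤ K * (n * n * s * c) := Nat.zero_le _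
  have K1 : 0 ≤ K * (n * n * n * b) := Nat.zero_le _
  linarith only [a1, a2, a3, a4, a5, a6, a7, a8, a9, a10, a11, a12, a13, d1, d2, d3, d4, d5, e1,
    e2, e3, e4, e5, K0, K1, K2, K3, K4, K5, hc0]

end TotalCost

/-! ### The asymptotic bound -/

section Asymptotics

open Real

theorem sqrt_le_giant (n : ℕ) : √(n : ℝ) ≤ giant n := by
  unfold giant
  split_ifs with h
  · conv_lhs => rw [← h]
    push_cast
    rw [Real.sqrt_sq (Nat.cast_nonneg _)]
  · exact_mod_cast Real.real_sqrt_le_nat_sqrt_succ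

theorem giant_le_sqrt {n : ℕ} (hn : 1 ≤ n) : (giant n : ℝ) ≤ 2 * √(n : ℝ) := by
  have h1 : (1 : ℝ) ≤ √(n : ℝ) := Real.one_le_sqrt.2 (by exact_mod_cast hn)
  have h2 : (Nat.sqrt n : ℝ) ≤ √(n : ℝ) := Real.nat_sqrt_le_real_sqrt
  unfold giant
  split_ifs
  · linarith
  · push_cast; linarith

theorem baby_le_sqrt {n : ℕ} (hn : 1 ≤ n) : (baby n : ℝ) ≤ 3 * √(n : ℝ) := by
  have h1 : (1 : ℝ) ≤ √(n : ℝ) := Real.one_le_sqrt.2 (by exact_mod_cast hn)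
  have h2 : baby n * giant n + 1 ≤ 2 * n + giant n := by
    have := one_le_giant hn
    have h := Nat.div_mul_le_self (2 * n + giant n - 1) (giant n)
    rw [← Nat.ceilDiv_eq_add_pred_div] at h
    change baby n * giant n ≤ _ at h
    omega
  have h3 : ((baby n : ℝ) - 1) * giant n ≤ 2 * n := by
    have : (baby n : ℝ) * giant n + 1 ≤ 2 * n + giant n := by exact_mod_cast h2
    linarith
  have h4 : (1 : ℝ) ≤ baby n := by exact_mod_cast (by have := two_le_baby hn; omega)
  have h5 := mul_le_mul_of_nonneg_left (sqrt_le_giant n) (sub_nonneg.2 h4)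
  have h6 : √(n : ℝ) * √(n : ℝ) = n := Real.mul_self_sqrt (Nat.cast_nonneg _)
  by_contra hcon
  nlinarith

/-- The bit length of `n` is `O(log n)`. -/
theorem clog_add_one_le {n : ℕ} (hn : 2 ≤ n) :
    ((Nat.clog 2 (n + 1) + 1 : ℕ) : ℝ) ≤ 3 / log 2 * log n := by
  have hlog2 : 0 < log 2 := Real.log_pos (by norm_num)
  have hle : log 2 ≤ log n := Real.log_le_log (by norm_num) (by exact_mod_cast hn)
  have h1 : 2 ^ (Nat.clog 2 (n + 1) - 1) < n + 1 :=
    Nat.pow_pred_clog_lt_self (by norm_num) (by omega)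
  have h2 : ((2 : ℝ) ^ (Nat.clog 2 (n + 1) - 1)) ≤ n := by exact_mod_cast Nat.lt_succ_iff.1 h1
  have h3 := Real.log_le_log (by positivity) h2
  rw [Real.log_pow] at h3
  have h4 : 0 < Nat.clog 2 (n + 1) := Nat.clog_pos (by norm_num) (by omega)
  rw [Nat.cast_sub h4] at h3
  rw [div_mul_eq_mul_div, le_div_iff₀ hlog2]
  push_cast at h3 ⊢
  linarith

/-- Up to the precision `n + 1`, a quasi-linear routine takes `O(d (log n) ^ β)` instructions; the
degrees `0` and `1`, to which the hypothesis does not apply, only affect the constant. -/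
theorem serCost_le {M : MulRoutine} {α β : ℝ} (hα : 0 < α) (hβ : 0 < β)
    (h : ∀ d : ℕ, 2 ≤ d → ((M d).size : ℝ) ≤ α * d * log d ^ β) :
    ∃ γ : ℝ, 0 < γ ∧ ∀ n : ℕ, 2 ≤ n → ∀ d ≤ n + 1,
      (serCost M d : ℝ) ≤ (d + 1) * (γ * log n ^ β) := by
  have hlog2 : 0 < log 2 := Real.log_pos (by norm_num)
  refine ⟨α * 2 ^ β + ((M 0).size + (M 1).size + 2) / log 2 ^ β, by positivity, fun n hn d hd => ?_⟩
  have hle : log 2 ≤ log n := Real.log_le_log (by norm_num) (by exact_mod_cast hn)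
  have h1 : ((M 0).size + (M 1).size + 2 : ℝ) ≤
      ((M 0).size + (M 1).size + 2) / log 2 ^ β * log n ^ β := by
    rw [div_mul_eq_mul_div, le_div_iff₀ (by positivity)]
    exact mul_le_mul_of_nonneg_left (Real.rpow_le_rpow hlog2.le hle hβ.le) (by positivity)
  have h2 : ((M d).size : ℝ) ≤ d * (α * 2 ^ β * log n ^ β) + ((M 0).size + (M 1).size) := by
    have hpos : 0 ≤ (d : ℝ) * (α * 2 ^ β * log n ^ β) := by
      have := hlog2.trans_le hle
      positivity
    have g0 : (0 : ℝ) ≤ (M 0).size := Nat.cast_nonneg _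
    have g1 : (0 : ℝ) ≤ (M 1).size := Nat.cast_nonneg _
    rcases (show d = 0 ∨ d = 1 ∨ 2 ≤ d by omega) with rfl | rfl | h2
    · linarith
    · linarith
    · refine (h d h2).trans ?_
      have hd0 : (0 : ℝ) < d := by exact_mod_cast (show 0 < d by omega)
      have h3 : log d ≤ 2 * log n := by
        rw [← Real.log_rpow (by exact_mod_cast (show 0 < n by omega))]
        refine Real.log_le_log hd0 ?_
        have : d ≤ n ^ 2 := by nlinarith
        exact_mod_cast this
      have h4 : log d ^ β ≤ (2 * log n) ^ β :=
        Real.rpow_le_rpow (Real.log_nonneg (by exact_mod_cast (show 1 ≤ d by omega))) h3 hβ.le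
      rw [Real.mul_rpow (by norm_num) (hlog2.le.trans hle)] at h4
      have h5 := mul_le_mul_of_nonneg_left h4 (mul_pos hα hd0).le
      linarith
  have hS : (0 : ℝ) ≤ (M 0).size + (M 1).size + 2 := by positivity
  have hd0 : (0 : ℝ) ≤ d := Nat.cast_nonneg _
  rw [serCost, add_mul (α * 2 ^ β)]
  push_cast
  have h6 : 0 ≤ α * 2 ^ β * log n ^ β := by
    have := hlog2.trans_le hle
    positivity
  nlinarith [mul_nonneg hd0 (hS.trans h1)]

theorem cost_adjointAlg_quasiLinear {M : MulRoutine} (hM : M.QuasiLinear) :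
    ∃ α β : ℝ, 0 < α ∧ 0 < β ∧
      ∀ n : ℕ, 2 ≤ n → ∀ (R : Type u) [CommRing R] (A : Matrix (Fin n) (Fin n) R),
        ((adjointAlg M A).cost : ℝ) ≤ α * ((n : ℝ) ^ 3 * √(n : ℝ)) * log n ^ β := by
  obtain ⟨α, β, hα, hβ, h⟩ := hM
  obtain ⟨γ, hγ, hc⟩ := serCost_le hα hβ h
  have hlog2 : 0 < log 2 := Real.log_pos (by norm_num)
  refine ⟨300 * (3 / log 2) * (14 * γ), β + 1, by positivity, by positivity, ?_⟩
  intro n hn R _ A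
  have hlog : 0 < log n := Real.log_pos (by exact_mod_cast hn)
  have hn1 : (1 : ℝ) ≤ n := by exact_mod_cast (show 1 ≤ n by omega)
  have h1 : (1 : ℝ) ≤ √(n : ℝ) := Real.one_le_sqrt.2 hn1
  set P := γ * log n ^ β with hP
  have hP0 : 0 < P := by positivity
  -- the largest cost of the operations on short series
  obtain ⟨e, he, hmax⟩ := Finset.exists_max_image (Finset.range (baby n + 1)) (serCost M)
    ⟨0, by simp⟩
  have he' : e ≤ baby n := Nat.lt_succ_iff.1 (Finset.mem_range.1 he)
  have h2 := cost_adjointAlg (show 1 ≤ n by omega) (b := serCost M e)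
    (fun d hd => hmax d (Finset.mem_range.2 (by omega))) A
  have hb : (serCost M e : ℝ) ≤ 4 * √(n : ℝ) * P := by
    refine (hc n hn e (he'.trans (baby_le (by omega)))).trans
      (mul_le_mul_of_nonneg_right ?_ hP0.le)
    have := baby_le_sqrt (show 1 ≤ n by omega)
    have : (e : ℝ) ≤ baby n := by exact_mod_cast he'
    linarith
  have hC : (serCost M n : ℝ) ≤ 2 * n * P :=
    (hc n hn n (by omega)).trans (mul_le_mul_of_nonneg_right (by linarith) hP0.le)
  have hq : ((baby n : ℝ) + giant n) ≤ 5 * √(n : ℝ) := by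
    have := baby_le_sqrt (show 1 ≤ n by omega)
    have := giant_le_sqrt (show 1 ≤ n by omega)
    linarith
  calc ((adjointAlg M A).cost : ℝ)
      ≤ 300 * (((Nat.clog 2 (n + 1) + 1 : ℕ) : ℝ) * ((n : ℝ) ^ 3 * serCost M e +
          (n : ℝ) ^ 2 * (baby n + giant n) * serCost M n)) := by exact_mod_cast h2
    _ ≤ 300 * ((3 / log 2 * log n) * ((n : ℝ) ^ 3 * (4 * √(n : ℝ) * P) +
          (n : ℝ) ^ 2 * (5 * √(n : ℝ)) * (2 * n * P))) := by
        have := clog_add_one_le hn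
        gcongr
    _ = 300 * (3 / log 2) * (14 * γ) * ((n : ℝ) ^ 3 * √(n : ℝ)) * log n ^ (β + 1) := by
        rw [Real.rpow_add_one hlog.ne', hP]
        ring

end Asymptotics

end DivFree

theorem theorem3 :
    (∃ M : DivFree.MulRoutine, DivFree.MulRoutine.Correct.{u} M ∧ M.QuasiLinear) ∧
    ∀ M : DivFree.MulRoutine, DivFree.MulRoutine.Correct.{u} M →
      (∀ n : ℕ, 1 ≤ n → ∀ (R : Type u) [CommRing R] (A : Matrix (Fin n) (Fin n) R),
        (DivFree.adjointAlg M A).run = A.adjugate) ∧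
      (M.QuasiLinear →
        ∃ α β : ℝ, 0 < α ∧ 0 < β ∧
          ∀ n : ℕ, 2 ≤ n → ∀ (R : Type u) [CommRing R] (A : Matrix (Fin n) (Fin n) R),
            ((DivFree.adjointAlg M A).cost : ℝ) ≤
              α * ((n : ℝ) ^ 3 * √(n : ℝ)) * Real.log n ^ β) :=
  ⟨DivFree.exists_quasiLinear_mulRoutine, fun _ hM =>
    ⟨fun _ hn _ _ A => DivFree.run_adjointAlg hM hn A, DivFree.cost_adjointAlg_quasiLinear⟩⟩
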